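/- Let $R$ be a commutative artinian ring and let $\Lambda$ be an artin $R$-algebra, i.e. an $R$-algebra that is finitely generated as an $R$-module. Let $D(\Lambda)=\operatorname{Hom}_R(\Lambda,E)$ be the Matlis dual of $\Lambda$, where $E$ is the injective envelope of $R/J(R)$ and $J(R)$ is the Jacobson radical of $R$; it is a $\Lambda$-$\Lambda$-bimodule via $(af)(x)=f(xa)$ and $(fa)(x)=f(ax)$. Write $\operatorname{mod}\Lambda$ and $\operatorname{mod}\Lambda^{op}$ for the finitely generated left and right $\Lambda$-modules. Infima below are taken in $\mathbb{N}\cup\{\infty\}$, with $\inf\emptyset=\infty$. For a ring $A$ ($A=\Lambda$ or $A=\Lambda^{op}$), let $0\to A\to I^0(A)\to I^1(A)\to\cdots$ be the minimal injective resolution of the left $A$-module $A$. For $n\ge 1$, $A$ is called Auslander $n$-Gorenstein if the flat dimension of $I^i(A)$ over $A$ is at most $i$ for all $0\le i\le n-1$. For an $A$-module $M$ put $\operatorname{grade}_AM=\inf\{i\ge 0\mid \operatorname{Ext}^i_A(M,A)\ne 0\}$, and say that $\operatorname{s.grade}_AM\ge m$ if $\operatorname{grade}_AX\ge m$ for every submodule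 $X$ of $M$. For a left $\Lambda$-module $M$ put $\operatorname{E\text{-}cograde}M=\inf\{i\ge0\mid\operatorname{Ext}^i_\Lambda(D(\Lambda),M)\ne0\}$, and say that $\operatorname{s.E\text{-}cograde}M\ge m$ if $\operatorname{E\text{-}cograde}X\ge m$ for every quotient module $X$ of $M$. Put $\operatorname{T\text{-}cograde}M=\inf\{i\ge0\mid\operatorname{Tor}_i^\Lambda(D(\Lambda),M)\ne0\}$, and say that $\operatorname{s.T\text{-}cograde}M\ge m$ if $\operatorname{T\text{-}cograde}Y\ge m$ for every submodule $Y$ of $M$. Then for every $n\ge 1$ the following statements are equivalent. - $(1)$ $\Lambda$ is Auslander $n$-Gorenstein. - $(1)^{op}$ $\Lambda^{op}$ is Auslander $n$-Gorenstein. - $(2)$ $\operatorname{s.grade}_{\Lambda^{op}}\operatorname{Ext}^i_\Lambda(M,\Lambda)\ge i$ for all $M\in\operatorname{mod}\Lambda$ and $1\le i\le n$, where $\operatorname{Ext}^i_\Lambda(M,\Lambda)$ is the right $\Lambda$-module with action induced by right multiplication on $\Lambda$. - $(2)^{op}$ $\operatorname{s.grade}_{\Lambda}\operatorname{Ext}^i_{\Lambda^{op}}(N,\Lambda)\ge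 i$ for all $N\in\operatorname{mod}\Lambda^{op}$ and $1\le i\le n$, where $\operatorname{Ext}^i_{\Lambda^{op}}(N,\Lambda)$ is the left $\Lambda$-module with action induced by left multiplication on $\Lambda$. - $(3)$ $\operatorname{s.E\text{-}cograde}\operatorname{Tor}_i^\Lambda(D(\Lambda),M)\ge i$ for all $M\in\operatorname{mod}\Lambda$ and $1\le i\le n$, where $\operatorname{Tor}_i^\Lambda(D(\Lambda),M)$ is a left $\Lambda$-module through the left action on $D(\Lambda)$. - $(4)$ $\operatorname{s.T\text{-}cograde}\operatorname{Ext}^i_\Lambda(D(\Lambda),M)\ge i$ for all $M\in\operatorname{mod}\Lambda$ and $1\le i\le n$, where $\operatorname{Ext}^i_\Lambda(D(\Lambda),M)$ is a left $\Lambda$-module through the right action on $D(\Lambda)$. -/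

import Mathlib

open CategoryTheory MulOpposite
open scoped TensorProduct

universe v u

noncomputable section

/-! ### Injective envelopes and minimal injective resolutions -/

/-- `i : M → E` is an injective envelope: `E` is injective, `i` is injective, and every nonzero
submodule of `E` meets the image of `i` nontrivially. -/
structure IsInjectiveEnvelope {A : Type u} [Ring A] {M E : Type u} [AddCommGroup M] [Module A M]
    [AddCommGroup E] [Module A E] (i : M →ₗ[A] E) : Prop where
  injective_module : Module.Injective A E
  injective_map : Function.Injective i
  essential : ∀ N : Submodule A E, N ⊓ LinearMap.range i = ⊥ → N = ⊥

theorem exists_injectiveEnvelope (A : Type u) [Ring A] (M : ModuleCat.{u} A) :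
    ∃ (E : ModuleCat.{u} A) (i : M →ₗ[A] E), IsInjectiveEnvelope i := by
  obtain ⟨⟨J, hinj, f, hf⟩⟩ := EnoughInjectives.presentation M
  have hJ : Module.Injective A J := Module.injective_module_of_injective_object A J
  have hι : Function.Injective f.hom := (ModuleCat.mono_iff_injective f).1 hf
  generalize f.hom = ι at hι
  set L : Submodule A J := LinearMap.range ι with hL
  let s : Set (Submodule A J) := {E | L ≤ E ∧ ∀ N ≤ E, N ⊓ L = ⊥ → N = ⊥}
  have hLs : L ∈ s := ⟨le_rfl, fun N hN h => by rwa [inf_eq_left.2 hN] at h⟩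
  obtain ⟨E, hLE, hEmax⟩ := zorn_le_nonempty₀ s (by
    intro c hc hchain y hy
    refine ⟨sSup c, ⟨(hc hy).1.trans (le_sSup hy), ?_⟩, fun z hz => le_sSup hz⟩
    intro N hN hNL
    rw [Submodule.eq_bot_iff]
    intro x hx
    obtain ⟨F, hF, hxF⟩ := (Submodule.mem_sSup_of_directed ⟨y, hy⟩ hchain.directedOn).1 (hN hx)
    have h1 := (hc hF).2 (Submodule.span A {x})
      ((Submodule.span_singleton_le_iff_mem _ _).2 hxF) (by
        rw [eq_bot_iff, ← hNL]
        exact inf_le_inf_right _ ((Submodule.span_singleton_le_iff_mem _ _).2 hx))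
    exact Submodule.span_singleton_eq_bot.1 h1) L hLs
  have hEs : E ∈ s := hEmax.1
  let t : Set (Submodule A J) := {C | C ⊓ E = ⊥}
  obtain ⟨C, -, hCmax⟩ := zorn_le_nonempty₀ t (by
    intro c hc hchain y hy
    refine ⟨sSup c, ?_, fun z hz => le_sSup hz⟩
    change sSup c ⊓ E = ⊥
    rw [Submodule.eq_bot_iff]
    rintro x ⟨hx, hxE⟩
    obtain ⟨F, hF, hxF⟩ := (Submodule.mem_sSup_of_directed ⟨y, hy⟩ hchain.directedOn).1 hx
    exact (Submodule.eq_bot_iff _).1 (hc hF) x ⟨hxF, hxE⟩) ⊥ (bot_inf_eq _)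
  have hC : C ⊓ E = ⊥ := hCmax.1
  have hCmem : ∀ K : Submodule A J, C ≤ K → K ⊓ E = ⊥ → K ≤ C := fun K h h' => hCmax.2 h' h
  have hφ : Function.Injective (C.mkQ ∘ₗ E.subtype) := by
    rw [← LinearMap.ker_eq_bot, Submodule.eq_bot_iff]
    rintro ⟨x, hx⟩ h
    have hxC : x ∈ C := by simpa using h
    exact Subtype.ext ((Submodule.eq_bot_iff _).1 hC x ⟨hxC, hx⟩)
  obtain ⟨g, hg⟩ := hJ.out (C.mkQ ∘ₗ E.subtype) hφ E.subtype
  have hgE : ∀ x ∈ E, g (C.mkQ x) = x := fun x hx => hg ⟨x, hx⟩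
  have hrange : LinearMap.range g ∈ s := by
    refine ⟨fun x hx => ⟨C.mkQ x, hgE x (hEs.1 hx)⟩, ?_⟩
    intro N hN hNL
    have hNE : N ⊓ E = ⊥ := hEs.2 _ inf_le_right (by
      rw [eq_bot_iff, ← hNL]; exact inf_le_inf_right _ inf_le_left)
    have hK := hCmem (N.comap (g ∘ₗ C.mkQ))
      (fun x hx => by
        have : C.mkQ x = 0 := by simpa using hx
        simp only [Submodule.mem_comap, LinearMap.comp_apply, this, map_zero, zero_mem])
      (by
        rw [Submodule.eq_bot_iff]
        rintro x ⟨hx, hxE⟩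
        have hxN : g (C.mkQ x) ∈ N := hx
        rw [hgE x hxE] at hxN
        exact (Submodule.eq_bot_iff _).1 hNE x ⟨hxN, hxE⟩)
    rw [Submodule.eq_bot_iff]
    intro y hy
    obtain ⟨q, rfl⟩ := hN hy
    obtain ⟨x, rfl⟩ := C.mkQ_surjective q
    have : C.mkQ x = 0 := by simpa using hK (show x ∈ N.comap (g ∘ₗ C.mkQ) from hy)
    rw [this, map_zero]
  have hle : LinearMap.range g ≤ E :=
    hEmax.2 hrange (fun x hx => ⟨C.mkQ x, hgE x hx⟩)
  let r : J →ₗ[A] E := LinearMap.codRestrict E (g ∘ₗ C.mkQ) (fun x => hle ⟨_, rfl⟩)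
  refine ⟨ModuleCat.of A E, LinearMap.codRestrict E ι (fun m => hEs.1 ⟨m, rfl⟩), ?_, ?_, ?_⟩
  · refine ⟨fun X Y _ _ _ _ f hf k => ?_⟩
    obtain ⟨h, hh⟩ := hJ.out f hf (E.subtype ∘ₗ k)
    refine ⟨r ∘ₗ h, fun x => Subtype.ext ?_⟩
    change g (C.mkQ (h (f x))) = k x
    rw [hh x]
    exact hgE _ (k x).2
  · exact fun a b hab => hι (congrArg Subtype.val hab)
  · intro N hN
    have := hEs.2 (N.map E.subtype) (Submodule.map_subtype_le _ _) (by
      rw [Submodule.eq_bot_iff]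
      rintro _ ⟨⟨x, hx, rfl⟩, ⟨m, hm⟩⟩
      have h0 := (Submodule.eq_bot_iff _).1 hN x ⟨hx, ⟨m, Subtype.ext hm⟩⟩
      rw [h0]; rfl)
    rw [Submodule.eq_bot_iff] at this ⊢
    exact fun x hx => Subtype.ext (this x ⟨x, hx, rfl⟩)

/-- The injective envelope `E⁰(M)` of a module. -/
def injectiveEnvelope {A : Type u} [Ring A] (M : ModuleCat.{u} A) : ModuleCat.{u} A :=
  (exists_injectiveEnvelope A M).choose

/-- The embedding of `M` into its injective envelope. -/
def injectiveEnvelopeMap {A : Type u} [Ring A] (M : ModuleCat.{u} A) :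
    M →ₗ[A] injectiveEnvelope M :=
  (exists_injectiveEnvelope A M).choose_spec.choose

theorem injectiveEnvelopeMap_spec {A : Type u} [Ring A] (M : ModuleCat.{u} A) :
    IsInjectiveEnvelope (injectiveEnvelopeMap M) :=
  (exists_injectiveEnvelope A M).choose_spec.choose_spec

/-- The `k`-th cosyzygy `coΩᵏ(M)`. -/
def cosyzygy {A : Type u} [Ring A] (M : ModuleCat.{u} A) : ℕ → ModuleCat.{u} A
  | 0 => M
  | k + 1 => ModuleCat.of A
      (injectiveEnvelope (cosyzygy M k) ⧸ LinearMap.range (injectiveEnvelopeMap (cosyzygy M k)))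

/-- The `k`-th term `Iᵏ(M)` of the minimal injective resolution
`0 → M → I⁰(M) → I¹(M) → ⋯`, where `Iᵏ(M)` is the injective envelope of `coΩᵏ(M)`. -/
def minimalInjectiveTerm {A : Type u} [Ring A] (M : ModuleCat.{u} A) (k : ℕ) : ModuleCat.{u} A :=
  injectiveEnvelope (cosyzygy M k)

/-! ### Tensor products over a noncommutative ring -/

section Tensor

section Group

variable (A : Type u) [Ring A] (X : Type u) [AddCommGroup X] [Module Aᵐᵒᵖ X]
  (Y : Type u) [AddCommGroup Y] [Module A Y]

/-- The subgroup of `X ⊗_ℤ Y` generated by the elements `x a ⊗ y - x ⊗ a y`. -/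
def balancedRelations : AddSubgroup (X ⊗[ℤ] Y) :=
  AddSubgroup.closure
    {z | ∃ (x : X) (a : A) (y : Y), z = (op a • x) ⊗ₜ[ℤ] y - x ⊗ₜ[ℤ] (a • y)}

/-- The tensor product `X ⊗_A Y` of a right `A`-module `X` and a left `A`-module `Y`. -/
def BalancedTensor : Type u := (X ⊗[ℤ] Y) ⧸ balancedRelations A X Y

end Group

namespace BalancedTensor

instance (A : Type u) [Ring A] (X : Type u) [AddCommGroup X] [Module Aᵐᵒᵖ X]
    (Y : Type u) [AddCommGroup Y] [Module A Y] : AddCommGroup (BalancedTensor A X Y) :=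
  inferInstanceAs (AddCommGroup ((X ⊗[ℤ] Y) ⧸ balancedRelations A X Y))

section

variable {A : Type u} [Ring A] {X : Type u} [AddCommGroup X] [Module Aᵐᵒᵖ X]
  {Y : Type u} [AddCommGroup Y] [Module A Y]

variable (A) in
/-- The element `x ⊗ y` of `X ⊗_A Y`. -/
def tmul (x : X) (y : Y) : BalancedTensor A X Y :=
  QuotientAddGroup.mk' (balancedRelations A X Y) (x ⊗ₜ[ℤ] y)

theorem tmul_add (x : X) (y y' : Y) : tmul A x (y + y') = tmul A x y + tmul A x y' :=
  (congrArg (QuotientAddGroup.mk' (balancedRelations A X Y)) (TensorProduct.tmul_add x y y')).trans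
    (map_add _ _ _)

theorem add_tmul (x x' : X) (y : Y) : tmul A (x + x') y = tmul A x y + tmul A x' y :=
  (congrArg (QuotientAddGroup.mk' (balancedRelations A X Y)) (TensorProduct.add_tmul x x' y)).trans
    (map_add _ _ _)

theorem op_smul_tmul (a : A) (x : X) (y : Y) : tmul A (op a • x) y = tmul A x (a • y) := by
  refine (QuotientAddGroup.eq_iff_sub_mem (N := balancedRelations A X Y)).2 ?_
  exact AddSubgroup.subset_closure ⟨x, a, y, rfl⟩

theorem tmul_induction {p : BalancedTensor A X Y → Prop} (z : BalancedTensor A X Y)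
    (zero : p 0) (tmul : ∀ x y, p (tmul A x y)) (add : ∀ z w, p z → p w → p (z + w)) : p z := by
  obtain ⟨t, rfl⟩ := QuotientAddGroup.mk'_surjective (balancedRelations A X Y) z
  induction t with
  | zero => exact zero
  | tmul x y => exact tmul x y
  | add a b ha hb => rw [map_add]; exact add _ _ ha hb

theorem addHom_ext {W : Type*} [AddCommGroup W] {f g : BalancedTensor A X Y →+ W}
    (h : ∀ x y, f (tmul A x y) = g (tmul A x y)) : f = g := by
  ext z
  induction z using tmul_induction with
  | zero => rw [map_zero, map_zero]
  | tmul x y => exact h x y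
  | add z w hz hw => rw [map_add, map_add, hz, hw]

/-- The universal property of `X ⊗_A Y`: balanced biadditive maps factor through it. -/
def lift {W : Type*} [AddCommGroup W] (φ : X →+ Y →+ W)
    (h : ∀ (a : A) (x : X) (y : Y), φ (op a • x) y = φ x (a • y)) : BalancedTensor A X Y →+ W :=
  QuotientAddGroup.lift (balancedRelations A X Y)
    (TensorProduct.liftAddHom φ fun r x y => by
      rw [map_zsmul, map_zsmul, AddMonoidHom.zsmul_apply])
    (by
      rw [balancedRelations, AddSubgroup.closure_le]
      rintro _ ⟨x, a, y, rfl⟩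
      change TensorProduct.liftAddHom φ _ ((op a • x) ⊗ₜ[ℤ] y - x ⊗ₜ[ℤ] (a • y)) = 0
      rw [map_sub, TensorProduct.liftAddHom_tmul, TensorProduct.liftAddHom_tmul, h, sub_self])

@[simp]
theorem lift_tmul {W : Type*} [AddCommGroup W] (φ : X →+ Y →+ W)
    (h : ∀ (a : A) (x : X) (y : Y), φ (op a • x) y = φ x (a • y)) (x : X) (y : Y) :
    lift φ h (tmul A x y) = φ x y := rfl

/-- The map `f ⊗ g : X ⊗_A Y → X' ⊗_A Y'`, for a map `f` of right and a map `g` of left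
`A`-modules. -/
def map {X' Y' : Type u} [AddCommGroup X'] [Module Aᵐᵒᵖ X'] [AddCommGroup Y'] [Module A Y']
    (f : X →ₗ[Aᵐᵒᵖ] X') (g : Y →ₗ[A] Y') : BalancedTensor A X Y →+ BalancedTensor A X' Y' :=
  lift (AddMonoidHom.mk' (fun x => AddMonoidHom.mk' (fun y => tmul A (f x) (g y))
      fun y y' => by rw [map_add, tmul_add])
      fun x x' => by ext y; simp [add_tmul])
    fun a x y => by
      change tmul A (f (op a • x)) (g y) = tmul A (f x) (g (a • y))
      rw [map_smul, map_smul, op_smul_tmul]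

@[simp]
theorem map_tmul {X' Y' : Type u} [AddCommGroup X'] [Module Aᵐᵒᵖ X'] [AddCommGroup Y']
    [Module A Y'] (f : X →ₗ[Aᵐᵒᵖ] X') (g : Y →ₗ[A] Y') (x : X) (y : Y) :
    map f g (tmul A x y) = tmul A (f x) (g y) := rfl

end

section Bimodule

variable {S : Type v} {A : Type u} [Ring S] [Ring A] {X : Type u} [AddCommGroup X] [Module S X]
  [Module Aᵐᵒᵖ X] [SMulCommClass S Aᵐᵒᵖ X] {Y : Type u} [AddCommGroup Y] [Module A Y]

/-- The action of `s : S` on an `S`-`A`-bimodule `X`, as a map of right `A`-modules. -/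
def leftMul (X : Type u) [AddCommGroup X] [Module S X] [Module Aᵐᵒᵖ X] [SMulCommClass S Aᵐᵒᵖ X]
    (s : S) : X →ₗ[Aᵐᵒᵖ] X where
  toFun x := s • x
  map_add' := smul_add s
  map_smul' a x := smul_comm s a x

/-- If `X` is an `S`-`A`-bimodule, then `X ⊗_A Y` is a left `S`-module with
`s (x ⊗ y) = (s x) ⊗ y`. -/
instance : Module S (BalancedTensor A X Y) where
  smul s z := map (leftMul X s) LinearMap.id z
  one_smul z := by
    change map (leftMul X (1 : S)) LinearMap.id z = AddMonoidHom.id _ z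
    exact DFunLike.congr_fun (addHom_ext fun x y => congrArg (tmul A · y) (one_smul S x)) z
  mul_smul s t z := by
    change map (leftMul X (s * t)) LinearMap.id z =
      ((map (leftMul X s) LinearMap.id).comp (map (leftMul X t) LinearMap.id)) z
    exact DFunLike.congr_fun (addHom_ext fun x y => congrArg (tmul A · y) (mul_smul s t x)) z
  smul_zero s := map_zero _
  smul_add s := map_add _
  add_smul s t z := by
    change map (leftMul X (s + t)) LinearMap.id z =
      (map (leftMul X s) LinearMap.id + map (leftMul X t) LinearMap.id :
        BalancedTensor A X Y →+ BalancedTensor A X Y) z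
    exact DFunLike.congr_fun (addHom_ext fun x y =>
      (congrArg (tmul A · y) (add_smul s t x)).trans (add_tmul _ _ y)) z
  zero_smul z := by
    change map (leftMul X (0 : S)) LinearMap.id z = (0 : _ →+ BalancedTensor A X Y) z
    refine DFunLike.congr_fun (addHom_ext fun x y => ?_) z
    change tmul A ((0 : S) • x) y = 0
    have h := add_tmul (A := A) (0 : X) 0 y
    rw [add_zero] at h
    rw [zero_smul]
    exact left_eq_add.1 h

theorem smul_tmul (s : S) (x : X) (y : Y) : s • tmul A x y = tmul A (s • x) y := rfl

variable (S X) in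
/-- The `S`-linear map `X ⊗_A g : X ⊗_A Y → X ⊗_A Z`, for an `S`-`A`-bimodule `X` and an
`A`-linear map `g : Y → Z`. -/
def mapRight {Z : Type u} [AddCommGroup Z] [Module A Z] (g : Y →ₗ[A] Z) :
    BalancedTensor A X Y →ₗ[S] BalancedTensor A X Z where
  toFun := map LinearMap.id g
  map_add' := map_add _
  map_smul' s z := by
    change ((map LinearMap.id g).comp (map (leftMul X s) LinearMap.id)) z =
      ((map (leftMul X s) LinearMap.id).comp (map LinearMap.id g)) z
    exact DFunLike.congr_fun (addHom_ext
      (f := (map LinearMap.id g).comp (map (leftMul X s) LinearMap.id))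
      (g := (map (leftMul X s) LinearMap.id).comp (map LinearMap.id g)) fun x y => rfl) z

end Bimodule

end BalancedTensor

variable (S : Type v) (A : Type u) [Ring S] [Ring A] (X : Type u) [AddCommGroup X] [Module S X]
  [Module Aᵐᵒᵖ X] [SMulCommClass S Aᵐᵒᵖ X]

/-- The functor `X ⊗_A -` from left `A`-modules to left `S`-modules, for an `S`-`A`-bimodule
`X`. -/
def tensorFunctor : ModuleCat.{u} A ⥤ ModuleCat.{u} S where
  obj Y := ModuleCat.of S (BalancedTensor A X Y)
  map f := ModuleCat.ofHom (BalancedTensor.mapRight S X f.hom)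
  map_id Y := by
    ext z
    exact DFunLike.congr_fun (BalancedTensor.addHom_ext
      (f := BalancedTensor.map LinearMap.id LinearMap.id) (g := AddMonoidHom.id _)
      fun x y => rfl) z
  map_comp f g := by
    ext z
    exact DFunLike.congr_fun (BalancedTensor.addHom_ext
      (f := BalancedTensor.map LinearMap.id (g.hom ∘ₗ f.hom))
      (g := (BalancedTensor.map LinearMap.id g.hom).comp (BalancedTensor.map LinearMap.id f.hom))
      fun x y => rfl) z

instance tensorFunctor_additive : (tensorFunctor S A X).Additive where
  map_add {Y Z f g} := by
    ext z
    exact DFunLike.congr_fun (BalancedTensor.addHom_ext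
      (f := BalancedTensor.map LinearMap.id (f.hom + g.hom))
      (g := BalancedTensor.map LinearMap.id f.hom + BalancedTensor.map LinearMap.id g.hom)
      fun x y => by
        rw [AddMonoidHom.add_apply, BalancedTensor.map_tmul, BalancedTensor.map_tmul,
          BalancedTensor.map_tmul, LinearMap.add_apply, BalancedTensor.tmul_add]) z

/-- `Tor_i^A(X, Y)` as a left `S`-module, for an `S`-`A`-bimodule `X`: the `i`-th left derived
functor of `X ⊗_A -`. -/
def torModule (i : ℕ) (Y : ModuleCat.{u} A) : ModuleCat.{u} S :=
  ((tensorFunctor S A X).leftDerived i).obj Y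

end Tensor

/-! ### Flat dimension -/

/-- A left `A`-module `M` is flat if `- ⊗_A M` preserves injectivity of maps of right
`A`-modules. -/
def IsFlatModule {A : Type u} [Ring A] (M : ModuleCat.{u} A) : Prop :=
  ∀ (X Y : Type u) [AddCommGroup X] [AddCommGroup Y] [Module Aᵐᵒᵖ X] [Module Aᵐᵒᵖ Y]
    (f : X →ₗ[Aᵐᵒᵖ] Y), Function.Injective f →
      Function.Injective (BalancedTensor.map f (LinearMap.id : M →ₗ[A] M))

/-- `fd_A M ≤ k`: there is an exact sequence `0 → F_k → ⋯ → F_1 → F_0 → M → 0` with all `F_j` flat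
(spliced from short exact sequences `0 → K → F_0 → M → 0` with `fd_A K ≤ k - 1`). -/
def FlatDimLE {A : Type u} [Ring A] : ℕ → ModuleCat.{u} A → Prop
  | 0, M => IsFlatModule M
  | k + 1, M => ∃ (K F : ModuleCat.{u} A) (f : K →ₗ[A] F) (g : F →ₗ[A] M),
      Function.Injective f ∧ Function.Exact f g ∧ Function.Surjective g ∧
        IsFlatModule F ∧ FlatDimLE k K

/-- `A` is Auslander `n`-Gorenstein: `fd_A Iⁱ(A) ≤ i` for `0 ≤ i ≤ n - 1`, where `Iⁱ(A)` are the
terms of the minimal injective resolution of the left module `A`. -/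
def IsAuslanderGorenstein (A : Type u) [Ring A] (n : ℕ) : Prop :=
  ∀ i < n, FlatDimLE i (minimalInjectiveTerm (ModuleCat.of A A) i)

/-! ### Module structures on Ext groups -/

section Ext

variable (S T : Type u) [Ring S] [Ring T] (B : Type u) [AddCommGroup B] [Module S B]

section Second

variable [Module T B] [SMulCommClass S T B]

/-- The action of `t : T` on `B`, as an endomorphism of the `S`-module `B`. -/
def actionHom (t : T) : ModuleCat.of S B ⟶ ModuleCat.of S B :=
  ModuleCat.ofHom
    { toFun := fun b => t • b
      map_add' := smul_add t
      map_smul' := fun s b => (smul_comm s t b).symm }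

variable {S T B}

theorem actionHom_one : actionHom S T B 1 = 𝟙 _ := by
  ext b; exact one_smul T b

theorem actionHom_mul (t t' : T) :
    actionHom S T B (t * t') = actionHom S T B t' ≫ actionHom S T B t := by
  ext b; exact mul_smul t t' b

theorem actionHom_add (t t' : T) :
    actionHom S T B (t + t') = actionHom S T B t + actionHom S T B t' := by
  ext b; exact add_smul t t' b

theorem actionHom_zero : actionHom S T B 0 = 0 := by
  ext b; exact zero_smul T b

/-- The `T`-module structure on `Ext^i_S(X, B)` induced by functoriality from a `T`-action on `B`
that commutes with the `S`-action. -/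
abbrev extSecondModule (X : ModuleCat.{u} S) (i : ℕ) :
    Module T (Abelian.Ext X (ModuleCat.of S B) i) where
  smul t x := x.comp (Abelian.Ext.mk₀ (actionHom S T B t)) (add_zero i)
  one_smul x := by
    change x.comp (Abelian.Ext.mk₀ (actionHom S T B 1)) (add_zero i) = x
    rw [actionHom_one, Abelian.Ext.comp_mk₀_id]
  mul_smul t t' x := by
    change x.comp (Abelian.Ext.mk₀ (actionHom S T B (t * t'))) (add_zero i) =
      (x.comp (Abelian.Ext.mk₀ (actionHom S T B t')) (add_zero i)).comp
        (Abelian.Ext.mk₀ (actionHom S T B t)) (add_zero i)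
    rw [actionHom_mul, Abelian.Ext.comp_assoc_of_third_deg_zero, Abelian.Ext.mk₀_comp_mk₀]
  smul_zero t := Abelian.Ext.zero_comp _ _ _ _ _
  smul_add t x y := Abelian.Ext.add_comp _ _ _ _
  add_smul t t' x := by
    change x.comp (Abelian.Ext.mk₀ (actionHom S T B (t + t'))) (add_zero i) =
      x.comp (Abelian.Ext.mk₀ (actionHom S T B t)) (add_zero i) +
        x.comp (Abelian.Ext.mk₀ (actionHom S T B t')) (add_zero i)
    rw [actionHom_add, Abelian.Ext.mk₀_add, Abelian.Ext.comp_add]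
  zero_smul x := by
    change x.comp (Abelian.Ext.mk₀ (actionHom S T B 0)) (add_zero i) = 0
    rw [actionHom_zero, Abelian.Ext.mk₀_zero, Abelian.Ext.comp_zero]

variable (S T B) in
/-- `Ext^i_S(X, B)` as a `T`-module, where `T` acts through `B`. -/
def extToBimodule (X : ModuleCat.{u} S) (i : ℕ) : ModuleCat.{u} T :=
  letI := extSecondModule (T := T) (B := B) X i
  ModuleCat.of T (Abelian.Ext X (ModuleCat.of S B) i)

end Second

section First

variable [Module Tᵐᵒᵖ B] [SMulCommClass S Tᵐᵒᵖ B]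

variable {S T B}

/-- The left `T`-module structure on `Ext^i_S(B, X)` induced by functoriality from the right
`T`-action on an `S`-`T`-bimodule `B`. -/
abbrev extFirstModule (X : ModuleCat.{u} S) (i : ℕ) :
    Module T (Abelian.Ext (ModuleCat.of S B) X i) where
  smul t x := (Abelian.Ext.mk₀ (actionHom S Tᵐᵒᵖ B (op t))).comp x (zero_add i)
  one_smul x := by
    change (Abelian.Ext.mk₀ (actionHom S Tᵐᵒᵖ B 1)).comp x (zero_add i) = x
    rw [actionHom_one, Abelian.Ext.mk₀_id_comp]
  mul_smul t t' x := by
    change (Abelian.Ext.mk₀ (actionHom S Tᵐᵒᵖ B (op t' * op t))).comp x (zero_add i) =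
      (Abelian.Ext.mk₀ (actionHom S Tᵐᵒᵖ B (op t))).comp
        ((Abelian.Ext.mk₀ (actionHom S Tᵐᵒᵖ B (op t'))).comp x (zero_add i)) (zero_add i)
    rw [actionHom_mul, Abelian.Ext.mk₀_comp_mk₀_assoc]
  smul_zero t := Abelian.Ext.comp_zero _ _ _ _ _
  smul_add t x y := Abelian.Ext.comp_add _ _ _ _
  add_smul t t' x := by
    change (Abelian.Ext.mk₀ (actionHom S Tᵐᵒᵖ B (op t + op t'))).comp x (zero_add i) =
      (Abelian.Ext.mk₀ (actionHom S Tᵐᵒᵖ B (op t))).comp x (zero_add i) +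
        (Abelian.Ext.mk₀ (actionHom S Tᵐᵒᵖ B (op t'))).comp x (zero_add i)
    rw [actionHom_add, Abelian.Ext.mk₀_add, Abelian.Ext.add_comp]
  zero_smul x := by
    change (Abelian.Ext.mk₀ (actionHom S Tᵐᵒᵖ B 0)).comp x (zero_add i) = 0
    rw [actionHom_zero, Abelian.Ext.mk₀_zero, Abelian.Ext.zero_comp]

variable (S T B) in
/-- `Ext^i_S(B, X)` as a left `T`-module, for an `S`-`T`-bimodule `B`. -/
def extFromBimodule (X : ModuleCat.{u} S) (i : ℕ) : ModuleCat.{u} T :=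
  letI := extFirstModule (T := T) (B := B) X i
  ModuleCat.of T (Abelian.Ext (ModuleCat.of S B) X i)

end First

end Ext

/-! ### Grade, Ext-cograde and Tor-cograde -/

/-- `grade_A M = inf {i ≥ 0 | Ext^i_A(M, A) ≠ 0}`, with `inf ∅ = ∞`. -/
def moduleGrade {A : Type u} [Ring A] (M : ModuleCat.{u} A) : ℕ∞ :=
  ⨅ (i : ℕ) (_ : Nontrivial (Abelian.Ext M (ModuleCat.of A A) i)), (i : ℕ∞)

/-- `s.grade_A M ≥ n`. -/
def StrongGradeGE {A : Type u} [Ring A] (M : ModuleCat.{u} A) (n : ℕ) : Prop :=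
  ∀ X : Submodule A M, (n : ℕ∞) ≤ moduleGrade (ModuleCat.of A X)

section Cograde

variable (S T : Type u) [Ring S] [Ring T] (W : Type u) [AddCommGroup W] [Module S W]

/-- The Ext-cograde of `M` with respect to `W`: `inf {i ≥ 0 | Ext^i_S(W, M) ≠ 0}`. -/
def extCograde (M : ModuleCat.{u} S) : ℕ∞ :=
  ⨅ (i : ℕ) (_ : Nontrivial (Abelian.Ext (ModuleCat.of S W) M i)), (i : ℕ∞)

/-- The strong Ext-cograde of `M` with respect to `W` is at least `n`. -/
def StrongExtCogradeGE (M : ModuleCat.{u} S) (n : ℕ) : Prop :=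
  ∀ K : Submodule S M, (n : ℕ∞) ≤ extCograde S W (ModuleCat.of S (M ⧸ K))

/-- The Tor-cograde of `N` with respect to the `S`-`T`-bimodule `W`:
`inf {i ≥ 0 | Tor_i^T(W, N) ≠ 0}`. -/
def torCograde [Module Tᵐᵒᵖ W] [SMulCommClass S Tᵐᵒᵖ W] (N : ModuleCat.{u} T) : ℕ∞ :=
  ⨅ (i : ℕ) (_ : Nontrivial (torModule S T W i N)), (i : ℕ∞)

/-- The strong Tor-cograde of `N` with respect to `W` is at least `n`. -/
def StrongTorCogradeGE [Module Tᵐᵒᵖ W] [SMulCommClass S Tᵐᵒᵖ W]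
    (N : ModuleCat.{u} T) (n : ℕ) : Prop :=
  ∀ Y : Submodule T N, (n : ℕ∞) ≤ torCograde S T W (ModuleCat.of T Y)

end Cograde

/-! ### The Matlis dual of an algebra -/

section Matlis

variable (R Λ : Type u) [CommRing R] [Ring Λ] [Algebra R Λ]

/-- The injective envelope `E⁰(R / J(R))`, with `J(R)` the Jacobson radical of `R`. -/
abbrev matlisModule : ModuleCat.{u} R :=
  injectiveEnvelope (ModuleCat.of R (R ⧸ Ring.jacobson R))

/-- `D(Λ) = Hom_R(Λ, E⁰(R / J(R)))`. -/
def MatlisDual : Type u :=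
  Λ →ₗ[R] matlisModule R

namespace MatlisDual

instance : AddCommGroup (MatlisDual R Λ) :=
  inferInstanceAs (AddCommGroup (Λ →ₗ[R] matlisModule R))

variable {R Λ} in
/-- An element of `D(Λ)` as a linear map. -/
def toLinearMap (f : MatlisDual R Λ) : Λ →ₗ[R] matlisModule R := f

/-- The left action `(a f)(x) = f(x a)`. -/
instance : Module Λ (MatlisDual R Λ) where
  smul a f := LinearMap.comp f (LinearMap.mulRight R a)
  one_smul f := LinearMap.ext fun x => congrArg (toLinearMap f) (mul_one x)
  mul_smul a b f := LinearMap.ext fun x => congrArg (toLinearMap f) (mul_assoc x a b).symm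
  smul_zero _ := LinearMap.zero_comp _
  smul_add _ f g := LinearMap.add_comp _ g f
  add_smul a b f := LinearMap.ext fun x =>
    (congrArg (toLinearMap f) (mul_add x a b)).trans (map_add (toLinearMap f) _ _)
  zero_smul f := LinearMap.ext fun x =>
    (congrArg (toLinearMap f) (mul_zero x)).trans (map_zero (toLinearMap f))

/-- The right action `(f a)(x) = f(a x)`. -/
instance : Module Λᵐᵒᵖ (MatlisDual R Λ) where
  smul a f := LinearMap.comp f (LinearMap.mulLeft R (unop a))
  one_smul f := LinearMap.ext fun x => congrArg (toLinearMap f) (one_mul x)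
  mul_smul a b f := LinearMap.ext fun x =>
    congrArg (toLinearMap f) (mul_assoc (unop b) (unop a) x)
  smul_zero _ := LinearMap.zero_comp _
  smul_add _ f g := LinearMap.add_comp _ g f
  add_smul a b f := LinearMap.ext fun x =>
    (congrArg (toLinearMap f) (add_mul (unop a) (unop b) x)).trans (map_add (toLinearMap f) _ _)
  zero_smul f := LinearMap.ext fun x =>
    (congrArg (toLinearMap f) (zero_mul x)).trans (map_zero (toLinearMap f))

variable {R Λ} in
theorem smul_apply (a : Λ) (f : MatlisDual R Λ) (x : Λ) :
    toLinearMap (a • f) x = toLinearMap f (x * a) := rfl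

variable {R Λ} in
theorem op_smul_apply (a : Λ) (f : MatlisDual R Λ) (x : Λ) :
    toLinearMap (op a • f) x = toLinearMap f (a * x) := rfl

instance : SMulCommClass Λ Λᵐᵒᵖ (MatlisDual R Λ) where
  smul_comm a b f := by
    refine LinearMap.ext fun x => ?_
    change toLinearMap f (unop b * (x * a)) = toLinearMap f (unop b * x * a)
    rw [mul_assoc]

end MatlisDual

end Matlis

end

/-!
Flatness is tested on character modules, so `fd I^i ≤ i` says that
`Hom(Ext^{i+1}(N, Λ), I^i) = 0` for every finitely generated right module `N`. As the resolution
is minimal, every nonzero submodule of `I^i` meets the `i`-th cosyzygy, and the vanishing of these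
groups for `i < n` is the strong grade condition on `Ext^i(N, Λ)`.

The strong grade conditions on the two sides are equivalent by an idea of Auslander and Bridger:
a submodule `Y` of `Ext^{m+1}(M, Λ)` embeds into the transpose `Tr K` of an `m`-th syzygy `K` of
`M` with `Ext^m(Tr K, Λ) = 0` (for `m = 0`, the maps `Tr K → Λ` vanish on `Y`), so `Ext^m(Y, Λ)`
embeds into `Ext^{m+1}(Tr K / Y, Λ)`. By the grade condition on the other side, `Ext^m(Y, Λ)` then
has grade greater than `m`, and this forces it to vanish if `Ext^j(Y, Λ) = 0` for all `j < m`.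

Matlis duality makes `D(Λ)` a bimodule for which `D = Hom(-, D(Λ))` is a Morita duality between
finitely generated left and right modules. For any such bimodule `W`,
`Tor_i(W, M) ≅ D(Ext^i_Λ(M, Λ))` and `Ext^i_Λ(W, M) ≅ Ext^i_{Λᵒᵖ}(D M, Λ)`, which turns the two
cograde conditions into the two strong grade conditions.
-/

noncomputable section

/-! ### Short exact sequences of modules and vanishing of Ext groups -/

/-- `0 → X → Y → Z → 0` is a short exact sequence of modules. -/
structure IsShortExact {A : Type u} [Ring A] {X Y Z : Type u} [AddCommGroup X] [Module A X]
    [AddCommGroup Y] [Module A Y] [AddCommGroup Z] [Module A Z] (f : X →ₗ[A] Y) (g : Y →ₗ[A] Z) :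
    Prop where
  injective : Function.Injective f
  exact : Function.Exact f g
  surjective : Function.Surjective g

/-- The group `Ext^n_A(X, Y)` of unbundled modules. -/
abbrev ExtGroup (A : Type u) [Ring A] (X Y : Type u) [AddCommGroup X] [Module A X]
    [AddCommGroup Y] [Module A Y] (n : ℕ) : Type u :=
  Abelian.Ext (ModuleCat.of A X) (ModuleCat.of A Y) n

section ExtVanishing

variable {A : Type u} [Ring A] {X Y Z W : Type u} [AddCommGroup X] [Module A X]
    [AddCommGroup Y] [Module A Y] [AddCommGroup Z] [Module A Z] [AddCommGroup W] [Module A W]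

namespace IsShortExact

variable {f : X →ₗ[A] Y} {g : Y →ₗ[A] Z}

theorem ker_subtype_mkQ (K : Submodule A Y) : IsShortExact K.subtype K.mkQ where
  injective := K.injective_subtype
  exact := LinearMap.exact_subtype_mkQ K
  surjective := K.mkQ_surjective

theorem of_surjective (hg : Function.Surjective g) :
    IsShortExact (LinearMap.ker g).subtype g where
  injective := Submodule.injective_subtype _
  exact := LinearMap.exact_subtype_ker_map g
  surjective := hg

theorem of_injective (hf : Function.Injective f) :
    IsShortExact f (LinearMap.range f).mkQ where
  injective := hf
  exact := LinearMap.exact_map_mkQ_range f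
  surjective := Submodule.mkQ_surjective _

/-- The short complex `0 → X → Y → Z → 0` in the category of modules, as required by Mathlib's
long exact sequences of `Ext`. -/
abbrev shortComplex (h : IsShortExact f g) : ShortComplex (ModuleCat.{u} A) :=
  ModuleCat.shortComplexOfCompEqZero f g h.exact.linearMap_comp_eq_zero

theorem shortExact (h : IsShortExact f g) : h.shortComplex.ShortExact :=
  ModuleCat.shortComplex_shortExact _ h.exact h.injective h.surjective

theorem subsingleton_ext_left (h : IsShortExact f g) {n : ℕ}
    (hY : Subsingleton (ExtGroup A W Y (n + 1))) (hZ : Subsingleton (ExtGroup A W Z n)) :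
    Subsingleton (ExtGroup A W X (n + 1)) := by
  refine subsingleton_of_forall_eq 0 fun x => ?_
  obtain ⟨y, rfl⟩ := Abelian.Ext.covariant_sequence_exact₁ _ h.shortExact x
    (Subsingleton.elim (α := ExtGroup A W Y (n + 1)) _ _) rfl
  rw [Subsingleton.elim (α := ExtGroup A W Z n) y 0, Abelian.Ext.zero_comp]

theorem subsingleton_ext_right (h : IsShortExact f g) {n : ℕ}
    (hY : Subsingleton (ExtGroup A W Y n)) (hX : Subsingleton (ExtGroup A W X (n + 1))) :
    Subsingleton (ExtGroup A W Z n) := by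
  refine subsingleton_of_forall_eq 0 fun x => ?_
  obtain ⟨y, rfl⟩ := Abelian.Ext.covariant_sequence_exact₃ _ h.shortExact x rfl
    (Subsingleton.elim (α := ExtGroup A W X (n + 1)) _ _)
  rw [Subsingleton.elim (α := ExtGroup A W Y n) y 0, Abelian.Ext.zero_comp]

theorem subsingleton_ext_from_left (h : IsShortExact f g) {n : ℕ}
    (hY : Subsingleton (ExtGroup A Y W n)) (hZ : Subsingleton (ExtGroup A Z W (n + 1))) :
    Subsingleton (ExtGroup A X W n) := by
  refine subsingleton_of_forall_eq 0 fun x => ?_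
  obtain ⟨y, rfl⟩ := Abelian.Ext.contravariant_sequence_exact₁ h.shortExact _ x (add_comm 1 n)
    (Subsingleton.elim (α := ExtGroup A Z W (n + 1)) _ _)
  rw [Subsingleton.elim (α := ExtGroup A Y W n) y 0, Abelian.Ext.comp_zero]

theorem subsingleton_ext_from_right (h : IsShortExact f g) {n : ℕ}
    (hX : Subsingleton (ExtGroup A X W n)) (hY : Subsingleton (ExtGroup A Y W (n + 1))) :
    Subsingleton (ExtGroup A Z W (n + 1)) := by
  refine subsingleton_of_forall_eq 0 fun x => ?_
  obtain ⟨y, rfl⟩ := Abelian.Ext.contravariant_sequence_exact₃ h.shortExact _ x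
    (Subsingleton.elim (α := ExtGroup A Y W (n + 1)) _ _) (add_comm 1 n)
  rw [Subsingleton.elim (α := ExtGroup A X W n) y 0, Abelian.Ext.comp_zero]

end IsShortExact

theorem subsingleton_ext_zero_iff :
    Subsingleton (ExtGroup A X Y 0) ↔ ∀ f : X →ₗ[A] Y, f = 0 := by
  rw [(Abelian.Ext.addEquiv₀.trans ModuleCat.homAddEquiv).toEquiv.subsingleton_congr]
  exact ⟨fun h f => Subsingleton.elim f 0, subsingleton_of_forall_eq 0⟩

theorem subsingleton_ext_of_injective [Module.Injective A Y] (n : ℕ) :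
    Subsingleton (ExtGroup A X Y (n + 1)) :=
  have : Injective (ModuleCat.of A Y) := Module.injective_object_of_injective_module A Y
  Abelian.Ext.subsingleton_of_injective _ _ n

theorem subsingleton_ext_of_projective [Module.Projective A X] (n : ℕ) :
    Subsingleton (ExtGroup A X Y (n + 1)) :=
  have : Projective (ModuleCat.of A X) := (IsProjective.iff_projective X).1 inferInstance
  Abelian.Ext.subsingleton_of_projective _ _ n

theorem subsingleton_ext_congr_left (e : X ≃ₗ[A] Y) {n : ℕ}
    (h : Subsingleton (ExtGroup A Y Z n)) : Subsingleton (ExtGroup A X Z n) :=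
  (((Abelian.extFunctor n).mapIso e.toModuleIso.op.symm).app
    (ModuleCat.of A Z)).addCommGroupIsoToAddEquiv.toEquiv.subsingleton_congr.2 h

theorem subsingleton_ext_congr_right (e : Y ≃ₗ[A] Z) {n : ℕ}
    (h : Subsingleton (ExtGroup A X Z n)) : Subsingleton (ExtGroup A X Y n) :=
  ((Abelian.extFunctorObj (ModuleCat.of A X) n).mapIso
    e.toModuleIso).addCommGroupIsoToAddEquiv.toEquiv.subsingleton_congr.2 h

theorem subsingleton_ext_pi {ι : Type} [Finite ι] {n : ℕ} (h : Subsingleton (ExtGroup A X Y n)) :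
    Subsingleton (ExtGroup A X (ι → Y) n) := by
  have := Fintype.ofFinite ι
  let Y' : ι → ModuleCat.{u} A := fun _ => ModuleCat.of A Y
  have : Subsingleton (Abelian.Ext (ModuleCat.of A X) (⨁ Y') n) :=
    (Abelian.Ext.addEquivBiproduct _ (Limits.biproduct.isBilimit Y') n).subsingleton
  exact subsingleton_ext_congr_right (ModuleCat.biproductIsoPi Y').symm.toLinearEquiv this

end ExtVanishing

theorem natCast_le_iInf_nontrivial_iff {F : ℕ → Type u} {n : ℕ} :
    (n : ℕ∞) ≤ ⨅ (i : ℕ) (_ : Nontrivial (F i)), (i : ℕ∞) ↔ ∀ j < n, Subsingleton (F j) := by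
  rw [le_iInf₂_iff]
  constructor
  · intro h j hj
    by_contra hc
    exact absurd (Nat.cast_le.1 (h j (not_subsingleton_iff_nontrivial.1 hc))) (by omega)
  · intro h i hi
    by_contra hc
    have hlt : i < n := Nat.cast_lt.1 (not_le.1 hc)
    exact not_subsingleton_iff_nontrivial.2 hi (h i hlt)

/-! ### Linear structure on the long exact sequences of Ext -/

section ExtTo

variable {S T : Type u} [Ring S] [Ring T] (B : Type u) [AddCommGroup B] [Module S B]
  [Module T B] [SMulCommClass S T B]

variable (T) in
/-- Composition with a fixed class on the left, as a `T`-linear map. -/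
def extToPrecomp {X Y : ModuleCat.{u} S} {k i j : ℕ} (α : Abelian.Ext X Y k) (h : k + i = j) :
    extToBimodule S T B Y i →ₗ[T] extToBimodule S T B X j where
  toFun x := α.comp (show Abelian.Ext Y (ModuleCat.of S B) i from x) h
  map_add' _ _ := Abelian.Ext.comp_add _ _ _ _
  map_smul' t x := (Abelian.Ext.comp_assoc_of_third_deg_zero α
    (show Abelian.Ext Y (ModuleCat.of S B) i from x)
    (Abelian.Ext.mk₀ (actionHom S T B t)) h).symm

variable {X Y Z : Type u} [AddCommGroup X] [Module S X]
  [AddCommGroup Y] [Module S Y] [AddCommGroup Z] [Module S Z]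

variable (S T X) in
/-- `Hom_S(X, B) ≅ Ext^0_S(X, B)` as `T`-modules. -/
def homEquivExtTo : (X →ₗ[S] B) ≃ₗ[T] extToBimodule S T B (ModuleCat.of S X) 0 :=
  LinearEquiv.ofBijective
    (show (X →ₗ[S] B) →ₗ[T]
        extToBimodule S T B (ModuleCat.of S X) 0 from
    { toFun := fun f => Abelian.Ext.mk₀ (ModuleCat.ofHom f)
      map_add' := fun f g =>
        (congrArg Abelian.Ext.mk₀ (ModuleCat.ofHom_add f g)).trans (Abelian.Ext.mk₀_add _ _)
      map_smul' := fun t f => by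
        have h : ModuleCat.ofHom (t • f) = ModuleCat.ofHom f ≫ actionHom S T B t := rfl
        rw [h, ← Abelian.Ext.mk₀_comp_mk₀]
        rfl })
    ((Abelian.Ext.mk₀_bijective (ModuleCat.of S X) (ModuleCat.of S B)).comp
      (ModuleCat.homEquiv (M := ModuleCat.of S X) (N := ModuleCat.of S B)).symm.bijective)

theorem homEquivExtTo_apply (φ : X →ₗ[S] B) :
    homEquivExtTo S T B X φ = Abelian.Ext.mk₀ (ModuleCat.ofHom φ) := rfl

variable (T) in
/-- Isomorphic modules have isomorphic Ext modules. -/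
def extToCongr (e : X ≃ₗ[S] Y) (i : ℕ) :
    extToBimodule S T B (ModuleCat.of S X) i ≃ₗ[T] extToBimodule S T B (ModuleCat.of S Y) i :=
  LinearEquiv.ofLinearMap
    (extToPrecomp T B (Abelian.Ext.mk₀ e.toModuleIso.inv) (zero_add i))
    (extToPrecomp T B (Abelian.Ext.mk₀ e.toModuleIso.hom) (zero_add i))
    (LinearMap.ext fun x => by
      refine (Abelian.Ext.mk₀_comp_mk₀_assoc _ _ _).trans ?_
      rw [Iso.inv_hom_id]
      exact Abelian.Ext.mk₀_id_comp _)
    (LinearMap.ext fun x => by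
      refine (Abelian.Ext.mk₀_comp_mk₀_assoc _ _ _).trans ?_
      rw [Iso.hom_inv_id]
      exact Abelian.Ext.mk₀_id_comp _)

namespace IsShortExact

variable {f : X →ₗ[S] Y} {g : Y →ₗ[S] Z}

variable (T) in
/-- The connecting map `Ext^n_S(X, B) → Ext^{n+1}_S(Z, B)`. -/
def connectingTo (h : IsShortExact f g) (n : ℕ) :
    extToBimodule S T B (ModuleCat.of S X) n →ₗ[T]
      extToBimodule S T B (ModuleCat.of S Z) (n + 1) :=
  extToPrecomp T B h.shortExact.extClass (add_comm 1 n)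

theorem connectingTo_surjective (h : IsShortExact f g) (n : ℕ)
    (hY : Subsingleton (ExtGroup S Y B (n + 1))) :
    Function.Surjective (h.connectingTo T B n) := fun x =>
  Abelian.Ext.contravariant_sequence_exact₃ h.shortExact _ x (hY.elim _ _) (add_comm 1 n)

theorem connectingTo_injective (h : IsShortExact f g) (n : ℕ)
    (hY : ∀ x : ExtGroup S Y B n, (Abelian.Ext.mk₀ (ModuleCat.ofHom f)).comp x (zero_add n) = 0) :
    Function.Injective (h.connectingTo T B n) := by
  refine (injective_iff_map_eq_zero _).2 fun x hx => ?_
  obtain ⟨y, rfl⟩ := Abelian.Ext.contravariant_sequence_exact₁ h.shortExact _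
    (show ExtGroup S X B n from x) (add_comm 1 n) hx
  exact hY y

variable (T) in
/-- `Ext^{n+2}_S(Z, B) ≅ Ext^{n+1}_S(X, B)` if the middle term is projective. -/
def extToShift (h : IsShortExact f g) [Module.Projective S Y] (n : ℕ) :
    extToBimodule S T B (ModuleCat.of S X) (n + 1) ≃ₗ[T]
      extToBimodule S T B (ModuleCat.of S Z) (n + 2) :=
  LinearEquiv.ofBijective (h.connectingTo T B (n + 1))
    ⟨h.connectingTo_injective B _ fun x => by
      have : Subsingleton (ExtGroup S Y B (n + 1)) := subsingleton_ext_of_projective n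
      rw [Subsingleton.elim x 0, Abelian.Ext.comp_zero],
    h.connectingTo_surjective B _ (subsingleton_ext_of_projective _)⟩

theorem connectingTo_zero_eq_zero_iff (h : IsShortExact f g) (φ : X →ₗ[S] B) :
    h.connectingTo T B 0 (homEquivExtTo S T B X φ) = 0 ↔ ∃ ψ : Y →ₗ[S] B, ψ ∘ₗ f = φ := by
  constructor
  · intro hφ
    obtain ⟨x, hx⟩ := Abelian.Ext.contravariant_sequence_exact₁ h.shortExact _ _ (add_comm 1 0) hφ
    obtain ⟨ψ, rfl⟩ := (homEquivExtTo S T B Y).surjective x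
    exact ⟨ψ, (homEquivExtTo S T B X).injective ((Abelian.Ext.mk₀_comp_mk₀ _ _).symm.trans hx)⟩
  · rintro ⟨ψ, rfl⟩
    change Abelian.Ext.comp _ (Abelian.Ext.mk₀ (ModuleCat.ofHom f ≫ ModuleCat.ofHom ψ))
      (add_comm 1 0) = 0
    rw [← Abelian.Ext.mk₀_comp_mk₀]
    exact h.shortExact.extClass_comp_assoc (h := add_comm 1 0) _

variable (T) in
/-- `Ext^1_S(Z, B)` is the cokernel of `Hom_S(Y, B) → Hom_S(X, B)` if the middle term is
projective. -/
def extToOne (h : IsShortExact f g) [Module.Projective S Y] :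
    ((X →ₗ[S] B) ⧸ LinearMap.range (LinearMap.lcomp T B f)) ≃ₗ[T]
      extToBimodule S T B (ModuleCat.of S Z) 1 :=
  (Submodule.quotEquivOfEq _ _
    (Submodule.ext fun φ => (h.connectingTo_zero_eq_zero_iff B φ).symm)).trans
  (LinearMap.quotKerEquivOfSurjective
    (h.connectingTo T B 0 ∘ₗ (homEquivExtTo S T B X).toLinearMap)
    ((h.connectingTo_surjective B 0 (subsingleton_ext_of_projective 0)).comp
      (homEquivExtTo S T B X).surjective))

end IsShortExact

end ExtTo

section ExtFrom

variable {S T : Type u} [Ring S] [Ring T] (B : Type u) [AddCommGroup B] [Module S B]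
  [Module Tᵐᵒᵖ B] [SMulCommClass S Tᵐᵒᵖ B]

variable (T) in
/-- Composition with a fixed class on the right, as a `T`-linear map. -/
def extFromPostcomp {X Y : ModuleCat.{u} S} {k i j : ℕ} (α : Abelian.Ext X Y k) (h : i + k = j) :
    extFromBimodule S T B X i →ₗ[T] extFromBimodule S T B Y j where
  toFun x := Abelian.Ext.comp (show Abelian.Ext (ModuleCat.of S B) X i from x) α h
  map_add' _ _ := Abelian.Ext.add_comp _ _ _ _
  map_smul' t x := Abelian.Ext.comp_assoc (Abelian.Ext.mk₀ (actionHom S Tᵐᵒᵖ B (op t)))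
    (show Abelian.Ext (ModuleCat.of S B) X i from x) α (zero_add i) h (by omega)

variable {X Y Z : Type u} [AddCommGroup X] [Module S X]
  [AddCommGroup Y] [Module S Y] [AddCommGroup Z] [Module S Z]

variable (S T) in
/-- The left `T`-module structure on `Hom_S(B, X)`, for an `S`-`T`-bimodule `B`. -/
abbrev homFromModule (X : Type u) [AddCommGroup X] [Module S X] : Module T (B →ₗ[S] X) where
  smul t φ := φ ∘ₗ (actionHom S Tᵐᵒᵖ B (op t)).hom
  one_smul φ := LinearMap.ext fun b => congrArg φ (one_smul Tᵐᵒᵖ b)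
  mul_smul t t' φ := LinearMap.ext fun b => congrArg φ (mul_smul (op t') (op t) b)
  smul_zero _ := LinearMap.zero_comp _
  smul_add _ _ _ := LinearMap.add_comp _ _ _
  add_smul t t' φ := LinearMap.ext fun b =>
    (congrArg φ (add_smul (op t) (op t') b)).trans (map_add φ _ _)
  zero_smul φ := LinearMap.ext fun b =>
    (congrArg φ (zero_smul Tᵐᵒᵖ b)).trans (map_zero φ)

variable (S T X) in
/-- `Hom_S(B, X) ≅ Ext^0_S(B, X)` as `T`-modules. -/
def homEquivExtFrom :
    letI := homFromModule S T B X
    (B →ₗ[S] X) ≃ₗ[T] extFromBimodule S T B (ModuleCat.of S X) 0 :=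
  letI := homFromModule S T B X
  LinearEquiv.ofBijective
    (show (B →ₗ[S] X) →ₗ[T]
        extFromBimodule S T B (ModuleCat.of S X) 0 from
    { toFun := fun f => Abelian.Ext.mk₀ (ModuleCat.ofHom f)
      map_add' := fun f g =>
        (congrArg Abelian.Ext.mk₀ (ModuleCat.ofHom_add f g)).trans (Abelian.Ext.mk₀_add _ _)
      map_smul' := fun t f => by
        have h : ModuleCat.ofHom (t • f) = actionHom S Tᵐᵒᵖ B (op t) ≫ ModuleCat.ofHom f := rfl
        rw [h, ← Abelian.Ext.mk₀_comp_mk₀]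
        rfl })
    ((Abelian.Ext.mk₀_bijective (ModuleCat.of S B) (ModuleCat.of S X)).comp
      (ModuleCat.homEquiv (M := ModuleCat.of S B) (N := ModuleCat.of S X)).symm.bijective)

variable (T) in
/-- Isomorphic modules have isomorphic Ext modules. -/
def extFromCongr (e : X ≃ₗ[S] Y) (i : ℕ) :
    extFromBimodule S T B (ModuleCat.of S X) i ≃ₗ[T]
      extFromBimodule S T B (ModuleCat.of S Y) i :=
  LinearEquiv.ofLinearMap
    (extFromPostcomp T B (Abelian.Ext.mk₀ e.toModuleIso.hom) (add_zero i))
    (extFromPostcomp T B (Abelian.Ext.mk₀ e.toModuleIso.inv) (add_zero i))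
    (LinearMap.ext fun x => by
      refine (Abelian.Ext.comp_assoc_of_third_deg_zero _ _ _ (add_zero i)).trans ?_
      rw [Abelian.Ext.mk₀_comp_mk₀, Iso.inv_hom_id]
      exact Abelian.Ext.comp_mk₀_id _)
    (LinearMap.ext fun x => by
      refine (Abelian.Ext.comp_assoc_of_third_deg_zero _ _ _ (add_zero i)).trans ?_
      rw [Abelian.Ext.mk₀_comp_mk₀, Iso.hom_inv_id]
      exact Abelian.Ext.comp_mk₀_id _)

namespace IsShortExact

variable {f : X →ₗ[S] Y} {g : Y →ₗ[S] Z}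

variable (T) in
/-- The connecting map `Ext^n_S(B, Z) → Ext^{n+1}_S(B, X)`. -/
def connectingFrom (h : IsShortExact f g) (n : ℕ) :
    extFromBimodule S T B (ModuleCat.of S Z) n →ₗ[T]
      extFromBimodule S T B (ModuleCat.of S X) (n + 1) :=
  extFromPostcomp T B h.shortExact.extClass rfl

theorem connectingFrom_surjective (h : IsShortExact f g) (n : ℕ)
    (hY : Subsingleton (ExtGroup S B Y (n + 1))) :
    Function.Surjective (h.connectingFrom T B n) := fun x =>
  Abelian.Ext.covariant_sequence_exact₁ _ h.shortExact x (hY.elim _ _) rfl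

variable (T) in
/-- `Ext^{n+1}_S(B, Z) ≅ Ext^{n+2}_S(B, X)` if the middle term is injective. -/
def extFromShift (h : IsShortExact f g) [Module.Injective S Y] (n : ℕ) :
    extFromBimodule S T B (ModuleCat.of S Z) (n + 1) ≃ₗ[T]
      extFromBimodule S T B (ModuleCat.of S X) (n + 2) :=
  LinearEquiv.ofBijective (h.connectingFrom T B (n + 1))
    ⟨(injective_iff_map_eq_zero _).2 fun x hx => by
      obtain ⟨y, rfl⟩ := Abelian.Ext.covariant_sequence_exact₃ _ h.shortExact
        (show ExtGroup S B Z (n + 1) from x) rfl hx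
      have : Subsingleton (ExtGroup S B Y (n + 1)) := subsingleton_ext_of_injective n
      rw [Subsingleton.elim (α := ExtGroup S B Y (n + 1)) y 0]
      exact Abelian.Ext.zero_comp _ _ _ _ _,
    h.connectingFrom_surjective B _ (subsingleton_ext_of_injective _)⟩

theorem connectingFrom_zero_eq_zero_iff (h : IsShortExact f g) (φ : B →ₗ[S] Z) :
    h.connectingFrom T B 0 (homEquivExtFrom S T B Z φ) = 0 ↔ ∃ ψ : B →ₗ[S] Y, g ∘ₗ ψ = φ := by
  constructor
  · intro hφ
    obtain ⟨x, hx⟩ := Abelian.Ext.covariant_sequence_exact₃ _ h.shortExact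
      (show ExtGroup S B Z 0 from _) rfl hφ
    obtain ⟨ψ, rfl⟩ := (homEquivExtFrom S T B Y).surjective x
    exact ⟨ψ, (homEquivExtFrom S T B Z).injective ((Abelian.Ext.mk₀_comp_mk₀ _ _).symm.trans hx)⟩
  · rintro ⟨ψ, rfl⟩
    change Abelian.Ext.comp (Abelian.Ext.mk₀ (ModuleCat.ofHom ψ ≫ ModuleCat.ofHom g)) _
      (zero_add 1) = 0
    rw [← Abelian.Ext.mk₀_comp_mk₀, Abelian.Ext.comp_assoc_of_second_deg_zero,
      h.shortExact.comp_extClass, Abelian.Ext.comp_zero]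

end IsShortExact

end ExtFrom

/-! ### Duality of finite free modules with respect to a regular bimodule -/

theorem injective_lcomp {A S M F B : Type*} [Ring A] [Ring S] [AddCommGroup M] [Module A M]
    [AddCommGroup F] [Module A F] [AddCommGroup B] [Module A B] [Module S B] [SMulCommClass A S B]
    {f : F →ₗ[A] M} (hf : Function.Surjective f) : Function.Injective (LinearMap.lcomp S B f) :=
  hf.injective_linearMapComp_right

theorem exact_lcomp {A S K M F B : Type*} [Ring A] [Ring S] [AddCommGroup K] [Module A K]
    [AddCommGroup M] [Module A M] [AddCommGroup F] [Module A F] [AddCommGroup B] [Module A B]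
    [Module S B] [SMulCommClass A S B] {g : K →ₗ[A] F} {f : F →ₗ[A] M}
    (hgf : Function.Exact g f) (hf : Function.Surjective f) :
    Function.Exact (LinearMap.lcomp S B f) (LinearMap.lcomp S B g) := by
  refine fun φ => ⟨fun hφ => ?_, ?_⟩
  · refine ⟨(LinearMap.range g).liftQ φ (LinearMap.range_le_ker_iff.2 hφ) ∘ₗ
      (hgf.linearEquivOfSurjective hf).symm.toLinearMap, LinearMap.ext fun x => ?_⟩
    simp
  · rintro ⟨ψ, rfl⟩
    rw [LinearMap.lcomp_apply', LinearMap.lcomp_apply', LinearMap.comp_assoc,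
      hgf.linearMap_comp_eq_zero, LinearMap.comp_zero]

/-- `B` is a regular bimodule: it is free of rank one on the basis `b` on both sides. The bimodule
`Λ` over `Λ` and `Λᵐᵒᵖ` is regular in both orders, so a statement about an abstract regular
bimodule covers left and right `Λ`-modules without the double opposite of `Λ`. -/
structure IsRegularBimodule (A A' : Type u) [Ring A] [Ring A'] {B : Type u} [AddCommGroup B]
    [Module A B] [Module A' B] (b : B) : Prop where
  left : Function.Bijective fun a : A => a • b
  right : Function.Bijective fun a : A' => a • b

namespace IsRegularBimodule

variable {A A' : Type u} [Ring A] [Ring A'] {B : Type u} [AddCommGroup B]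
    [Module A B] [Module A' B] {b : B}

theorem symm (h : IsRegularBimodule A A' b) : IsRegularBimodule A' A b := ⟨h.right, h.left⟩

/-- The isomorphism `A ≅ B`, `a ↦ a b`, of left modules. -/
def leftEquiv (h : IsRegularBimodule A A' b) : A ≃ₗ[A] B :=
  LinearEquiv.ofBijective (LinearMap.toSpanSingleton A B b) h.left

/-- The coordinate functional `x ↦ xᵢ b` on a finite free module. -/
def coord (b : B) {n : ℕ} (i : Fin n) : (Fin n → A) →ₗ[A] B :=
  LinearMap.toSpanSingleton A B b ∘ₗ LinearMap.proj i

@[simp]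
theorem coord_apply {n : ℕ} (i : Fin n) (x : Fin n → A) : coord b i x = x i • b := rfl

theorem eq_zero_of_forall_dual_eq_zero (h : IsRegularBimodule A A' b) {n : ℕ} (x : Fin n → A)
    (hx : ∀ φ : (Fin n → A) →ₗ[A] B, φ x = 0) : x = 0 := by
  ext i
  exact h.left.1 ((hx (coord b i)).trans (zero_smul A b).symm)

variable [SMulCommClass A A' B]

/-- The dual of a finite free module is finite free. -/
def dualPi (h : IsRegularBimodule A A' b) (n : ℕ) :
    ((Fin n → A) →ₗ[A] B) ≃ₗ[A'] (Fin n → A') :=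
  ((Pi.basisFun A (Fin n)).constr A').symm.trans
    (LinearEquiv.piCongrRight fun _ => h.symm.leftEquiv.symm)

theorem finite_dual_pi (h : IsRegularBimodule A A' b) (n : ℕ) :
    Module.Finite A' ((Fin n → A) →ₗ[A] B) := Module.Finite.equiv (h.dualPi n).symm

theorem projective_dual_pi (h : IsRegularBimodule A A' b) (n : ℕ) :
    Module.Projective A' ((Fin n → A) →ₗ[A] B) := Module.Projective.of_equiv (h.dualPi n).symm

theorem finite_dual [IsNoetherianRing A'] (h : IsRegularBimodule A A' b)
    (M : Type u) [AddCommGroup M] [Module A M] [Module.Finite A M] :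
    Module.Finite A' (M →ₗ[A] B) := by
  obtain ⟨n, f, hf⟩ := Module.Finite.exists_fin' A M
  have := h.finite_dual_pi n
  exact Module.Finite.of_injective (LinearMap.lcomp A' B f) (injective_lcomp hf)

theorem exists_eq_sum_smul_coord (h : IsRegularBimodule A A' b) {n : ℕ}
    (φ : (Fin n → A) →ₗ[A] B) : ∃ c : Fin n → A', φ = ∑ i, c i • coord b i := by
  choose c hc using fun i => h.right.2 (φ (Pi.single i 1))
  refine ⟨c, (Pi.basisFun A (Fin n)).ext fun i => ?_⟩
  rw [Pi.basisFun_apply, ← hc, LinearMap.sum_apply, Finset.sum_eq_single i]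
  · simp
  · intro j _ hj
    simp [Pi.single_eq_of_ne hj]
  · simp

theorem exists_eval_eq (h : IsRegularBimodule A A' b) {n : ℕ}
    (θ : ((Fin n → A) →ₗ[A] B) →ₗ[A'] B) :
    ∃ x : Fin n → A, ∀ φ, θ φ = φ x := by
  choose x hx using fun i => h.left.2 (θ (coord b i))
  refine ⟨x, fun φ => ?_⟩
  obtain ⟨c, rfl⟩ := h.exists_eq_sum_smul_coord φ
  rw [map_sum, LinearMap.sum_apply]
  refine Finset.sum_congr rfl fun i _ => ?_
  rw [map_smul, ← hx, LinearMap.smul_apply, coord_apply]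

theorem exists_eval_eq_of_comp_lcomp_eq_zero (h : IsRegularBimodule A A' b) {n₁ n₀ : ℕ}
    (d : (Fin n₁ → A) →ₗ[A] (Fin n₀ → A)) (θ : ((Fin n₁ → A) →ₗ[A] B) →ₗ[A'] B)
    (hθ : θ ∘ₗ LinearMap.lcomp A' B d = 0) :
    ∃ x : Fin n₁ → A, d x = 0 ∧ ∀ φ, θ φ = φ x := by
  obtain ⟨x, hx⟩ := h.exists_eval_eq θ
  exact ⟨x, h.eq_zero_of_forall_dual_eq_zero _ fun φ =>
    (hx (φ ∘ₗ d)).symm.trans (LinearMap.congr_fun hθ φ), hx⟩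

end IsRegularBimodule

/-! ### The transpose -/

section Transpose

variable {A A' : Type u} [Ring A] [Ring A'] {B : Type u} [AddCommGroup B]
    [Module A B] [Module A' B] [SMulCommClass A A' B] {F₂ F₁ F₀ : Type u} [AddCommGroup F₂]
    [Module A F₂] [AddCommGroup F₁] [Module A F₁] [AddCommGroup F₀] [Module A F₀]

variable (A' B) in
/-- The transpose of a map `d : F₁ → F₀`: the cokernel of `Hom(F₀, B) → Hom(F₁, B)`. -/
abbrev Transpose (d : F₁ →ₗ[A] F₀) : Type u :=
  (F₁ →ₗ[A] B) ⧸ LinearMap.range (LinearMap.lcomp A' B d)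

variable (A' B) in
/-- The map from `Ext^1(Coker d, B)`, which is the cokernel of `Hom(F₀, B) → Hom(Im d, B)`, to the
transpose of `d`, induced by `F₁ → Im d`. -/
def extOneToTranspose [Module.Projective A F₀] (d : F₁ →ₗ[A] F₀) :
    extToBimodule A A' B (ModuleCat.of A (F₀ ⧸ LinearMap.range d)) 1 →ₗ[A'] Transpose A' B d :=
  Submodule.mapQ _ _ (LinearMap.lcomp A' B d.rangeRestrict)
      (LinearMap.range_le_iff_comap.2 (eq_top_iff.2 fun ψ _ => ⟨ψ, rfl⟩)) ∘ₗ
    ((IsShortExact.ker_subtype_mkQ (LinearMap.range d)).extToOne A' B).symm.toLinearMap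

theorem extOneToTranspose_injective [Module.Projective A F₀] (d : F₁ →ₗ[A] F₀) :
    Function.Injective (extOneToTranspose A' B d) := by
  rw [extOneToTranspose, LinearMap.coe_comp]
  refine Function.Injective.comp ((injective_iff_map_eq_zero _).2 fun x hx => ?_)
    (LinearEquiv.injective _)
  obtain ⟨φ, rfl⟩ := Submodule.mkQ_surjective _ x
  obtain ⟨ψ, hψ⟩ := (Submodule.Quotient.mk_eq_zero _).1 hx
  exact (Submodule.Quotient.mk_eq_zero _).2
    ⟨ψ, LinearMap.cancel_right d.surjective_rangeRestrict |>.1 hψ⟩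

theorem mk_mem_range_extOneToTranspose_iff [Module.Projective A F₀] (d : F₁ →ₗ[A] F₀)
    (φ : F₁ →ₗ[A] B) :
    Submodule.Quotient.mk φ ∈ LinearMap.range (extOneToTranspose A' B d) ↔
      ∀ y, d y = 0 → φ y = 0 := by
  rw [extOneToTranspose, LinearMap.range_comp_of_range_eq_top _ (LinearEquiv.range _)]
  constructor
  · rintro ⟨x, hx⟩ y hy
    obtain ⟨ψ, rfl⟩ := Submodule.mkQ_surjective _ x
    obtain ⟨χ, hχ⟩ := (Submodule.Quotient.eq _).1 hx
    have hy' : d.rangeRestrict y = 0 := Subtype.ext hy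
    simpa [hy, hy'] using LinearMap.congr_fun hχ y
  · intro hφ
    have hex : Function.Exact (LinearMap.ker d).subtype d.rangeRestrict := fun y =>
      Subtype.ext_iff.trans (LinearMap.exact_subtype_ker_map d y)
    obtain ⟨ψ, rfl⟩ := (exact_lcomp (S := A') hex d.surjective_rangeRestrict φ).1
      (LinearMap.ext fun y => hφ y y.2)
    exact ⟨Submodule.Quotient.mk ψ, rfl⟩

variable (A' B) in
/-- The map from the transpose of `d'` to the image of `Hom(F₁, B) → Hom(F₂, B)`, for a complex
`F₂ → F₁ → F₀` with maps `d` and `d'`. -/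
def transposeToRange {d : F₂ →ₗ[A] F₁} {d' : F₁ →ₗ[A] F₀} (hd : d' ∘ₗ d = 0) :
    Transpose A' B d' →ₗ[A'] LinearMap.range (LinearMap.lcomp A' B d) :=
  Submodule.liftQ _ (LinearMap.lcomp A' B d).rangeRestrict (by
    rintro _ ⟨ψ, rfl⟩
    refine Subtype.ext ?_
    change (ψ ∘ₗ d') ∘ₗ d = 0
    rw [LinearMap.comp_assoc, hd, LinearMap.comp_zero])

theorem isShortExact_extOneToTranspose [Module.Projective A F₀] {d : F₂ →ₗ[A] F₁}
    {d' : F₁ →ₗ[A] F₀} (hd : Function.Exact d d') :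
    IsShortExact (extOneToTranspose A' B d')
      (transposeToRange A' B hd.linearMap_comp_eq_zero) where
  injective := extOneToTranspose_injective d'
  exact x := by
    obtain ⟨φ, rfl⟩ := Submodule.Quotient.mk_surjective _ x
    refine Iff.trans ?_ (mk_mem_range_extOneToTranspose_iff d' φ).symm
    refine Subtype.ext_iff.trans ⟨fun hφ y hy => ?_, fun hφ => ?_⟩
    · obtain ⟨z, rfl⟩ := (hd y).1 hy
      exact LinearMap.congr_fun hφ z
    · exact LinearMap.ext fun z => hφ _ (hd.apply_apply_eq_zero z)
  surjective y := by
    obtain ⟨φ, rfl⟩ := (LinearMap.lcomp A' B d).surjective_rangeRestrict y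
    exact ⟨Submodule.Quotient.mk φ, rfl⟩

theorem subsingleton_ext_transpose_succ {C : Type u} [AddCommGroup C] [Module A' C]
    [Module.Projective A F₀] [Module.Projective A' (F₂ →ₗ[A] B)] {d : F₂ →ₗ[A] F₁}
    {d' : F₁ →ₗ[A] F₀} (hd : Function.Exact d d') {p : ℕ}
    (hext : Subsingleton (ExtGroup A'
      (extToBimodule A A' B (ModuleCat.of A (F₀ ⧸ LinearMap.range d')) 1) C p))
    (htr : Subsingleton (ExtGroup A' (Transpose A' B d') C (p + 1))) :
    Subsingleton (ExtGroup A' (Transpose A' B d) C (p + 2)) :=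
  (IsShortExact.ker_subtype_mkQ _).subsingleton_ext_from_right
    ((isShortExact_extOneToTranspose hd).subsingleton_ext_from_right hext htr)
    (subsingleton_ext_of_projective _)

variable (A' B) in
/-- `Ext^{k+2}(Coker d', B) ≅ Ext^{k+1}(Coker d, B)` for `d` and `d'` exact at a common term. -/
def extToCokerShift [Module.Projective A F₀] {d : F₂ →ₗ[A] F₁} {d' : F₁ →ₗ[A] F₀}
    (hd : Function.Exact d d') (k : ℕ) :
    extToBimodule A A' B (ModuleCat.of A (F₀ ⧸ LinearMap.range d')) (k + 2) ≃ₗ[A']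
      extToBimodule A A' B (ModuleCat.of A (F₁ ⧸ LinearMap.range d)) (k + 1) :=
  ((IsShortExact.ker_subtype_mkQ (LinearMap.range d')).extToShift A' B k).symm.trans
    (extToCongr A' B (d'.quotKerEquivRange.symm.trans
      (Submodule.quotEquivOfEq _ _ (LinearMap.exact_iff.1 hd))) (k + 1))

variable {b : B} {n₁ n₀ : ℕ}

theorem IsRegularBimodule.comp_extOneToTranspose_eq_zero (h : IsRegularBimodule A A' b)
    (d : (Fin n₁ → A) →ₗ[A] (Fin n₀ → A)) (θ : Transpose A' B d →ₗ[A'] B) :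
    θ ∘ₗ extOneToTranspose A' B d = 0 := by
  obtain ⟨z, hz, hθ⟩ := h.exists_eval_eq_of_comp_lcomp_eq_zero d (θ ∘ₗ Submodule.mkQ _) (by
    rw [LinearMap.comp_assoc, LinearMap.range_mkQ_comp, LinearMap.comp_zero])
  refine LinearMap.ext fun x => ?_
  obtain ⟨φ, hφ⟩ := Submodule.Quotient.mk_surjective _ (extOneToTranspose A' B d x)
  have hφz := (mk_mem_range_extOneToTranspose_iff d φ).1 ⟨x, hφ.symm⟩ z hz
  rw [LinearMap.comp_apply, ← hφ]
  exact (hθ φ).trans hφz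

theorem IsRegularBimodule.subsingleton_ext_one_transpose [SMulCommClass A' A B]
    (h : IsRegularBimodule A A' b) {n₂ : ℕ} {d : (Fin n₂ → A) →ₗ[A] (Fin n₁ → A)}
    {d' : (Fin n₁ → A) →ₗ[A] (Fin n₀ → A)} (hd : Function.Exact d d') :
    Subsingleton (ExtGroup A' (Transpose A' B d) B 1) := by
  have := h.projective_dual_pi n₂
  have hK := IsShortExact.ker_subtype_mkQ (LinearMap.range (LinearMap.lcomp A' B d))
  refine (hK.extToOne A B).symm.toEquiv.subsingleton_congr.2 ?_
  refine Submodule.Quotient.subsingleton_iff.2 (eq_top_iff.2 fun θ _ => ?_)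
  obtain ⟨x, hx, hθ⟩ := h.exists_eval_eq_of_comp_lcomp_eq_zero d'
    (θ ∘ₗ (LinearMap.lcomp A' B d).rangeRestrict) (LinearMap.ext fun φ => by
      have hφ : (LinearMap.lcomp A' B d).rangeRestrict (φ ∘ₗ d') = 0 :=
        Subtype.ext (LinearMap.ext fun z => by simp [hd.apply_apply_eq_zero])
      exact (congrArg θ hφ).trans (map_zero θ))
  obtain ⟨y, rfl⟩ := (hd x).1 hx
  refine ⟨LinearMap.applyₗ' A' y, LinearMap.ext ?_⟩
  rintro ⟨_, φ, rfl⟩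
  exact (hθ φ).symm

theorem exists_exact_of_finite [IsNoetherianRing A] [Module.Finite A F₁] (f : F₁ →ₗ[A] F₀) :
    ∃ (n : ℕ) (d : (Fin n → A) →ₗ[A] F₁), Function.Exact d f := by
  obtain ⟨n, g, hg⟩ := Module.Finite.exists_fin' A (LinearMap.ker f)
  refine ⟨n, (LinearMap.ker f).subtype ∘ₗ g, LinearMap.exact_iff.2 ?_⟩
  rw [LinearMap.range_comp_of_range_eq_top _ (LinearMap.range_eq_top.2 hg), Submodule.range_subtype]

theorem IsRegularBimodule.exists_syzygy_presentation [SMulCommClass A' A B] [IsNoetherianRing A]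
    (h : IsRegularBimodule A A' b) (M : Type u) [AddCommGroup M] [Module A M] [Module.Finite A M]
    (p : ℕ) (hM : ∀ q, 1 ≤ q → q ≤ p → ∀ j < q,
      Subsingleton (ExtGroup A' (extToBimodule A A' B (ModuleCat.of A M) q) B j)) :
    ∃ (n₁ n₀ : ℕ) (d : (Fin n₁ → A) →ₗ[A] (Fin n₀ → A)),
      (∀ k, Nonempty (extToBimodule A A' B (ModuleCat.of A M) (p + k + 1) ≃ₗ[A']
        extToBimodule A A' B (ModuleCat.of A ((Fin n₀ → A) ⧸ LinearMap.range d)) (k + 1))) ∧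
      (1 ≤ p → Subsingleton (ExtGroup A' (Transpose A' B d) B p)) := by
  induction p with
  | zero =>
    obtain ⟨n₀, f, hf⟩ := Module.Finite.exists_fin' A M
    obtain ⟨n₁, d, hd⟩ := exists_exact_of_finite f
    refine ⟨n₁, n₀, d, fun k => ?_, fun h0 => absurd h0 (by omega)⟩
    rw [zero_add]
    exact ⟨extToCongr A' B (hd.linearEquivOfSurjective hf).symm (k + 1)⟩
  | succ p ih =>
    obtain ⟨n₁, n₀, d', hext, htr⟩ := ih fun q hq hqp => hM q hq (by omega)
    obtain ⟨n₂, d, hd⟩ := exists_exact_of_finite d'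
    refine ⟨n₂, n₁, d, fun k => ?_, fun _ => ?_⟩
    · obtain ⟨e⟩ := hext (k + 1)
      rw [show p + 1 + k + 1 = p + (k + 1) + 1 by omega]
      exact ⟨e.trans (extToCokerShift A' B hd k)⟩
    · rcases p with _ | p
      · exact h.subsingleton_ext_one_transpose hd
      · have := h.projective_dual_pi n₂
        obtain ⟨e⟩ := hext 0
        exact subsingleton_ext_transpose_succ hd (subsingleton_ext_congr_left e.symm
          (hM (p + 1 + 1) (by omega) le_rfl p (by omega))) (htr (by omega))

end Transpose

/-! ### Left-right symmetry of the strong grade condition -/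

section Symmetry

variable {A A' : Type u} [Ring A] [Ring A'] {B : Type u} [AddCommGroup B]
    [Module A B] [Module A' B] {b : B}

theorem subsingleton_ext_of_subsingleton {X Y : Type u} [AddCommGroup X] [Module A X]
    [AddCommGroup Y] [Module A Y] [Subsingleton Y] (n : ℕ) : Subsingleton (ExtGroup A X Y n) := by
  have hY : 𝟙 (ModuleCat.of A Y) = 0 :=
    ModuleCat.hom_ext (LinearMap.ext fun _ => Subsingleton.elim (α := Y) _ _)
  refine subsingleton_of_forall_eq 0 fun x => ?_
  rw [← Abelian.Ext.comp_mk₀_id x, hY, Abelian.Ext.mk₀_zero, Abelian.Ext.comp_zero]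

section HomToExt

variable [SMulCommClass A A' B] {W : Type u} [AddCommGroup W] [Module A' W]

theorem subsingleton_ext_dual_pi {j : ℕ} (hW : Subsingleton (ExtGroup A' W B j)) (n : ℕ) :
    Subsingleton (ExtGroup A' W ((Fin n → A) →ₗ[A] B) j) :=
  subsingleton_ext_congr_right ((Pi.basisFun A (Fin n)).constr A').symm (subsingleton_ext_pi hW)

theorem hom_to_dual_eq_zero {X : Type u} [AddCommGroup X] [Module A X]
    (hW : ∀ ψ : W →ₗ[A'] B, ψ = 0) (θ : W →ₗ[A'] X →ₗ[A] B) : θ = 0 :=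
  LinearMap.ext fun w => LinearMap.ext fun x =>
    LinearMap.congr_fun (hW (LinearMap.applyₗ' A' x ∘ₗ θ)) w

theorem hom_eq_zero_of_linearEquiv {E E' : Type*} [AddCommGroup E] [Module A' E]
    [AddCommGroup E'] [Module A' E'] (e : E ≃ₗ[A'] E') (h : ∀ θ : W →ₗ[A'] E', θ = 0)
    (θ : W →ₗ[A'] E) : θ = 0 :=
  LinearMap.ext fun w =>
    e.map_eq_zero_iff.1 (LinearMap.congr_fun (h (e.toLinearMap ∘ₗ θ)) w)

variable {Z : Type u} [AddCommGroup Z] [Module A Z] [Module.Finite A Z]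

theorem hom_to_ext_one_eq_zero (hW : ∀ j ≤ 1, Subsingleton (ExtGroup A' W B j))
    (hZ : Subsingleton (ExtGroup A' W (Z →ₗ[A] B) 2))
    (θ : W →ₗ[A'] extToBimodule A A' B (ModuleCat.of A Z) 1) : θ = 0 := by
  obtain ⟨n, f, hf⟩ := Module.Finite.exists_fin' A Z
  have hK := IsShortExact.of_surjective hf
  let r := LinearMap.lcomp A' B (LinearMap.ker f).subtype
  have hr : IsShortExact (LinearMap.lcomp A' B f) r.rangeRestrict :=
    ⟨injective_lcomp hf, fun φ => Subtype.ext_iff.trans (exact_lcomp hK.exact hf φ),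
      r.surjective_rangeRestrict⟩
  have hker : Subsingleton (ExtGroup A' W (LinearMap.ker f →ₗ[A] B) 0) :=
    subsingleton_ext_zero_iff.2
      (hom_to_dual_eq_zero (subsingleton_ext_zero_iff.1 (hW 0 zero_le_one)))
  have hrange : Subsingleton (ExtGroup A' W (LinearMap.range r) 1) :=
    hr.subsingleton_ext_right (subsingleton_ext_dual_pi (hW 1 le_rfl) n) hZ
  exact hom_eq_zero_of_linearEquiv (hK.extToOne A' B).symm (subsingleton_ext_zero_iff.1
    ((IsShortExact.ker_subtype_mkQ _).subsingleton_ext_right hker hrange)) θ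

theorem hom_to_ext_eq_zero [IsNoetherianRing A] {m : ℕ}
    (hW : ∀ j ≤ m + 1, Subsingleton (ExtGroup A' W B j))
    (hZ : ∀ j ≤ m + 2, Subsingleton (ExtGroup A' W (Z →ₗ[A] B) j))
    (hZB : ∀ i < m, Subsingleton (ExtGroup A Z B (i + 1)))
    (θ : W →ₗ[A'] extToBimodule A A' B (ModuleCat.of A Z) (m + 1)) : θ = 0 := by
  induction m generalizing Z with
  | zero => exact hom_to_ext_one_eq_zero hW (hZ 2 le_rfl) θ
  | succ m ih =>
    obtain ⟨n, f, hf⟩ := Module.Finite.exists_fin' A Z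
    have hK := IsShortExact.of_surjective hf
    have hrestrict : Function.Surjective (LinearMap.lcomp A' B (LinearMap.ker f).subtype) :=
      LinearMap.range_eq_top.1 (Submodule.Quotient.subsingleton_iff.1
        ((hK.extToOne A' B).toEquiv.subsingleton_congr.2 (hZB 0 m.succ_pos)))
    have hdual : IsShortExact (LinearMap.lcomp A' B f)
        (LinearMap.lcomp A' B (LinearMap.ker f).subtype) :=
      ⟨injective_lcomp hf, exact_lcomp hK.exact hf, hrestrict⟩
    refine hom_eq_zero_of_linearEquiv (hK.extToShift A' B m).symm
      (ih (fun j hj => hW j (by omega)) (fun j hj => ?_) fun i hi => ?_) θ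
    · exact hdual.subsingleton_ext_right (subsingleton_ext_dual_pi (hW j (by omega)) n)
        (hZ (j + 1) (by omega))
    · exact hK.subsingleton_ext_from_left (subsingleton_ext_of_projective _)
        (hZB (i + 1) (by omega))

end HomToExt

theorem subsingleton_ext_of_subsingleton_ext_ext [SMulCommClass A A' B] [IsNoetherianRing A]
    {Y : Type u} [AddCommGroup Y] [Module A Y] [Module.Finite A Y] {m : ℕ}
    (hY : ∀ j < m, Subsingleton (ExtGroup A Y B j))
    (hExt : ∀ j ≤ m, Subsingleton
      (ExtGroup A' (extToBimodule A A' B (ModuleCat.of A Y) m) B j)) :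
    Subsingleton (ExtGroup A Y B m) := by
  suffices hid : (LinearMap.id : extToBimodule A A' B (ModuleCat.of A Y) m →ₗ[A'] _) = 0 from
    subsingleton_of_forall_eq (0 : ExtGroup A Y B m) fun x => LinearMap.congr_fun hid x
  rcases m with _ | m
  · exact hom_eq_zero_of_linearEquiv (homEquivExtTo A A' B Y).symm
      (hom_to_dual_eq_zero (subsingleton_ext_zero_iff.1 (hExt 0 le_rfl))) _
  · have hdual : Subsingleton (Y →ₗ[A] B) :=
      subsingleton_of_forall_eq 0 (subsingleton_ext_zero_iff.1 (hY 0 m.succ_pos))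
    exact hom_to_ext_eq_zero hExt (fun j _ => subsingleton_ext_of_subsingleton j)
      (fun i hi => hY (i + 1) (by omega)) _

variable (A A' B) in
/-- For every finitely generated `A'`-module `N` and `1 ≤ i ≤ n`, every `A`-submodule of
`Ext^i(N, B)` has grade at least `i` with respect to `B`. Submodules are given by injective maps,
so that the condition is visibly invariant under isomorphism. -/
def StrongGradeCondition [SMulCommClass A' A B] (n : ℕ) : Prop :=
  ∀ (N : Type u) [AddCommGroup N] [Module A' N] [Module.Finite A' N] (i : ℕ), 1 ≤ i → i ≤ n →
    ∀ (Y : Type u) [AddCommGroup Y] [Module A Y]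
      (ι : Y →ₗ[A] extToBimodule A' A B (ModuleCat.of A' N) i), Function.Injective ι →
      ∀ j < i, Subsingleton (ExtGroup A Y B j)

namespace StrongGradeCondition

variable [SMulCommClass A A' B] [SMulCommClass A' A B] [IsNoetherianRing A'] {n : ℕ}

theorem subsingleton_ext_of_injective_to_ext_one (hn : StrongGradeCondition A A' B n)
    (h : IsRegularBimodule A A' b) {n₁ n₀ m : ℕ} (hm : m < n)
    (d : (Fin n₁ → A) →ₗ[A] (Fin n₀ → A))
    (hd : 1 ≤ m → Subsingleton (ExtGroup A' (Transpose A' B d) B m)) {Y : Type u}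
    [AddCommGroup Y] [Module A' Y]
    {ι : Y →ₗ[A'] extToBimodule A A' B (ModuleCat.of A ((Fin n₀ → A) ⧸ LinearMap.range d)) 1}
    (hι : Function.Injective ι) (hY : ∀ j < m, Subsingleton (ExtGroup A' Y B j)) :
    Subsingleton (ExtGroup A' Y B m) := by
  let μ : Y →ₗ[A'] Transpose A' B d := extOneToTranspose A' B d ∘ₗ ι
  have hμ : Function.Injective μ := (extOneToTranspose_injective d).comp hι
  have := h.finite_dual_pi n₁
  have : Module.Finite A' Y := Module.Finite.of_injective μ hμ
  have hV := IsShortExact.of_injective hμ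
  have hδ : Function.Injective (hV.connectingTo A B m) := by
    refine hV.connectingTo_injective B m fun x => ?_
    rcases m with _ | m
    · obtain ⟨θ, rfl⟩ := (homEquivExtTo A' A B (Transpose A' B d)).surjective x
      have hθ : θ ∘ₗ μ = 0 := by
        rw [← LinearMap.comp_assoc, h.comp_extOneToTranspose_eq_zero, LinearMap.zero_comp]
      rw [homEquivExtTo_apply, Abelian.Ext.mk₀_comp_mk₀, Abelian.Ext.mk₀_eq_zero_iff]
      exact ModuleCat.hom_ext hθ
    · have := hd m.succ_pos
      rw [Subsingleton.elim x 0, Abelian.Ext.comp_zero]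
  exact subsingleton_ext_of_subsingleton_ext_ext hY fun j hj =>
    hn _ (m + 1) m.succ_pos hm _ (hV.connectingTo A B m) hδ j (Nat.lt_succ_of_le hj)

theorem symm [IsNoetherianRing A] (hn : StrongGradeCondition A A' B n)
    (h : IsRegularBimodule A A' b) : StrongGradeCondition A' A B n := by
  suffices hsymm : ∀ m < n, ∀ (M : Type u) [AddCommGroup M] [Module A M] [Module.Finite A M]
      (Y : Type u) [AddCommGroup Y] [Module A' Y]
      (ι : Y →ₗ[A'] extToBimodule A A' B (ModuleCat.of A M) (m + 1)), Function.Injective ι →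
      ∀ j ≤ m, Subsingleton (ExtGroup A' Y B j) by
    intro M _ _ _ i hi hin Y _ _ ι hι j hj
    obtain ⟨m, rfl⟩ := Nat.exists_eq_add_of_le' hi
    exact hsymm m hin M Y ι hι j (Nat.le_of_lt_succ hj)
  intro m
  induction m using Nat.strong_induction_on with
  | _ m ih =>
  intro hm M _ _ _ Y _ _ ι hι
  have hY : ∀ j < m, Subsingleton (ExtGroup A' Y B j) := by
    rcases m with _ | m
    · exact fun j hj => absurd hj j.not_lt_zero
    obtain ⟨k, f, hf⟩ := Module.Finite.exists_fin' A M
    have e := ((IsShortExact.of_surjective hf).extToShift A' B m).symm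
    exact fun j hj => ih m (by omega) (by omega) (LinearMap.ker f) Y (e.toLinearMap ∘ₗ ι)
      (e.injective.comp hι) j (Nat.le_of_lt_succ hj)
  obtain ⟨n₁, n₀, d, hext, htr⟩ := h.exists_syzygy_presentation M m fun q hq hqm j hj => by
    obtain ⟨q, rfl⟩ := Nat.exists_eq_add_of_le' hq
    exact ih q hqm (by omega) M _ LinearMap.id Function.injective_id j (Nat.le_of_lt_succ hj)
  obtain ⟨e⟩ := hext 0
  intro j hj
  rcases hj.lt_or_eq with hjm | rfl
  · exact hY j hjm
  · exact hn.subsingleton_ext_of_injective_to_ext_one h hm d htr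
      (ι := e.toLinearMap ∘ₗ ι) (e.injective.comp hι) hY

end StrongGradeCondition

end Symmetry

/-! ### Character modules and flat dimension -/

section CharDual

variable {A A' : Type u} [Ring A] [Ring A']

/-- The character module `Hom_ℤ(M, ℚ/ℤ)` of a left `A`-module, as a module over a ring `A'`
identified with `Aᵐᵒᵖ`. -/
def CharDual (_ : A' ≃+* Aᵐᵒᵖ) (M : Type u) [AddCommGroup M] : Type u :=
  M →+ AddCircle (1 : ℚ)

namespace CharDual

variable (ρ : A' ≃+* Aᵐᵒᵖ) (M : Type u) [AddCommGroup M]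

instance : AddCommGroup (CharDual ρ M) :=
  inferInstanceAs (AddCommGroup (M →+ AddCircle (1 : ℚ)))

variable {ρ M} in
/-- An element of the character module as an additive map. -/
def toHom (c : CharDual ρ M) : M →+ AddCircle (1 : ℚ) := c

variable {ρ M} in
theorem hom_ext {c c' : CharDual ρ M} (h : ∀ m, toHom c m = toHom c' m) : c = c' :=
  AddMonoidHom.ext h

variable {M}

theorem add_apply (c c' : CharDual ρ M) (m : M) :
    toHom (c + c') m = toHom c m + toHom c' m := rfl

theorem sum_apply {ι : Type*} (s : Finset ι) (c : ι → CharDual ρ M) (m : M) :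
    toHom (∑ i ∈ s, c i) m = ∑ i ∈ s, toHom (c i) m :=
  AddMonoidHom.finsetSum_apply c s m

variable [Module A M]

variable (M) in
instance : Module A' (CharDual ρ M) where
  smul a c := (toHom c).comp (DistribSMul.toAddMonoidHom M (unop (ρ a)))
  one_smul c := hom_ext fun m => by
    change toHom c (unop (ρ 1) • m) = toHom c m
    rw [map_one, unop_one, one_smul]
  mul_smul a a' c := hom_ext fun m => by
    change toHom c (unop (ρ (a * a')) • m) = toHom c (unop (ρ a') • unop (ρ a) • m)
    rw [map_mul, unop_mul, mul_smul]
  smul_zero _ := rfl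
  smul_add _ _ _ := rfl
  add_smul a a' c := hom_ext fun m => by
    change toHom c (unop (ρ (a + a')) • m) = toHom c (unop (ρ a) • m) + toHom c (unop (ρ a') • m)
    rw [map_add, MulOpposite.unop_add, add_smul, map_add]
  zero_smul c := hom_ext fun m => by
    change toHom c (unop (ρ 0) • m) = 0
    rw [map_zero, unop_zero, zero_smul, map_zero]

theorem smul_apply (a : A') (c : CharDual ρ M) (m : M) :
    toHom (a • c) m = toHom c (unop (ρ a) • m) := rfl

variable {N : Type u} [AddCommGroup N] [Module A N]

/-- The map of character modules induced by a linear map. -/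
def map (f : M →ₗ[A] N) : CharDual ρ N →ₗ[A'] CharDual ρ M where
  toFun c := (toHom c).comp f.toAddMonoidHom
  map_add' _ _ := rfl
  map_smul' a c := hom_ext fun m => congrArg (toHom c) (map_smul f (unop (ρ a)) m).symm

theorem map_apply (f : M →ₗ[A] N) (c : CharDual ρ N) (m : M) :
    toHom (map ρ f c) m = toHom c (f m) := rfl

variable (A M) in
/-- The tensor-hom adjunction: the characters of `X ⊗_A M` are the linear maps from `X` to the
character module of `M`. -/
def curryEquiv (X : Type u) [AddCommGroup X] [Module Aᵐᵒᵖ X] :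
    (BalancedTensor A X M →+ AddCircle (1 : ℚ)) ≃
      (X →ₗ[Aᵐᵒᵖ] CharDual (RingEquiv.refl Aᵐᵒᵖ) M) where
  toFun c :=
    { toFun := fun x => AddMonoidHom.mk' (fun m => c (BalancedTensor.tmul A x m)) fun m m' => by
        rw [BalancedTensor.tmul_add, map_add]
      map_add' := fun x x' => hom_ext fun m =>
        (congrArg c (BalancedTensor.add_tmul x x' m)).trans (map_add c _ _)
      map_smul' := fun a x => hom_ext fun m =>
        congrArg c (BalancedTensor.op_smul_tmul (unop a) x m) }
  invFun g := BalancedTensor.lift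
    (AddMonoidHom.mk' (fun x => toHom (g x)) fun x x' => map_add g x x') fun a x m =>
      congrArg (fun c => toHom c m) (map_smul g (op a) x)
  left_inv _ := BalancedTensor.addHom_ext fun _ _ => rfl
  right_inv _ := rfl

variable (M) in
/-- Reindexing the scalars of the character module. -/
def reindex : CharDual (RingEquiv.refl Aᵐᵒᵖ) M ≃+ CharDual ρ M := AddEquiv.refl _

variable (M) in
theorem injective_reindex_iff :
    Module.Injective A' (CharDual ρ M) ↔
      Module.Injective Aᵐᵒᵖ (CharDual (RingEquiv.refl Aᵐᵒᵖ) M) := by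
  have := RingHomInvPair.of_ringEquiv ρ
  have := RingHomInvPair.of_ringEquiv ρ.symm
  have := RingHomInvPair.of_ringEquiv ρ.symm.symm
  constructor
  · intro h
    exact Module.Injective.of_ringEquiv ρ
      { reindex ρ M |>.symm with map_smul' := fun a c => rfl }
  · intro h
    exact Module.Injective.of_ringEquiv ρ.symm
      { reindex ρ M with
        map_smul' := fun a c => hom_ext fun m => by
          change toHom c _ = toHom c (unop (ρ (ρ.symm a)) • m)
          rw [RingEquiv.apply_symm_apply]
          rfl }

end CharDual

theorem exists_addHom_extension {X Y : Type u} [AddCommGroup X] [AddCommGroup Y] (f : X →+ Y)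
    (hf : Function.Injective f) (c : X →+ AddCircle (1 : ℚ)) :
    ∃ c' : Y →+ AddCircle (1 : ℚ), ∀ x, c' (f x) = c x := by
  obtain ⟨c', hc'⟩ := (Module.Baer.of_divisible (AddCircle (1 : ℚ))).extension_property_addMonoidHom
    f hf c
  exact ⟨c', fun x => DFunLike.congr_fun hc' x⟩

theorem IsShortExact.charDual (ρ : A' ≃+* Aᵐᵒᵖ) {X Y Z : Type u} [AddCommGroup X] [Module A X]
    [AddCommGroup Y] [Module A Y] [AddCommGroup Z] [Module A Z] {f : X →ₗ[A] Y} {g : Y →ₗ[A] Z}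
    (h : IsShortExact f g) : IsShortExact (CharDual.map ρ g) (CharDual.map ρ f) where
  injective c c' hc := CharDual.hom_ext fun z => by
    obtain ⟨y, rfl⟩ := h.surjective z
    exact congrArg (fun d => CharDual.toHom d y) hc
  exact c := by
    constructor
    · intro hc
      let e := AddMonoidHom.liftOfSurjective g.toAddMonoidHom h.surjective
        ⟨CharDual.toHom c, fun y hy => by
          obtain ⟨x, rfl⟩ := (h.exact y).1 hy
          exact congrArg (fun d => CharDual.toHom d x) hc⟩
      exact ⟨e, CharDual.hom_ext fun y =>
        AddMonoidHom.liftOfRightInverse_comp_apply g.toAddMonoidHom _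
          (Function.rightInverse_surjInv h.surjective) _ y⟩
    · rintro ⟨c, rfl⟩
      exact CharDual.hom_ext fun x => by
        rw [CharDual.map_apply, CharDual.map_apply, h.exact.apply_apply_eq_zero, map_zero]
        rfl
  surjective c := by
    obtain ⟨c', hc'⟩ := exists_addHom_extension f.toAddMonoidHom h.injective (CharDual.toHom c)
    exact ⟨c', CharDual.hom_ext hc'⟩

theorem isFlatModule_iff_injective_charDual (ρ : A' ≃+* Aᵐᵒᵖ) {M : ModuleCat.{u} A} :
    IsFlatModule M ↔ Module.Injective A' (CharDual ρ M) := by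
  rw [CharDual.injective_reindex_iff]
  constructor
  · refine fun hM => ⟨fun X Y _ _ _ _ f hf g => ?_⟩
    obtain ⟨c, hc⟩ := exists_addHom_extension (BalancedTensor.map f LinearMap.id) (hM X Y f hf)
      ((CharDual.curryEquiv A M X).symm g)
    exact ⟨CharDual.curryEquiv A M Y c, fun x => CharDual.hom_ext fun m =>
      hc (BalancedTensor.tmul A x m)⟩
  · intro hM X Y _ _ _ _ f hf
    refine (injective_iff_map_eq_zero _).2 fun z hz => ?_
    by_contra hne
    obtain ⟨c, hc⟩ := CharacterModule.exists_character_apply_ne_zero_of_ne_zero hne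
    obtain ⟨g, hg⟩ := hM.out f hf (CharDual.curryEquiv A M X c)
    have hcg : ((CharDual.curryEquiv A M Y).symm g).comp (BalancedTensor.map f LinearMap.id) = c :=
      BalancedTensor.addHom_ext fun x m => congrArg (fun d => CharDual.toHom d m) (hg x)
    refine hc ((DFunLike.congr_fun hcg z).symm.trans ?_)
    rw [AddMonoidHom.comp_apply, hz, map_zero]

theorem injective_charDual_self (ρ : A' ≃+* Aᵐᵒᵖ) : Module.Injective A' (CharDual ρ A) := by
  refine ⟨fun X Y _ _ _ _ f hf g => ?_⟩
  obtain ⟨c, hc⟩ := exists_addHom_extension f.toAddMonoidHom hf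
    (AddMonoidHom.mk' (fun x => CharDual.toHom (g x) 1) fun x x' => by rw [map_add]; rfl)
  refine ⟨{ toFun := fun y => AddMonoidHom.mk' (fun a => c (ρ.symm (op a) • y)) fun a a' => by
              rw [MulOpposite.op_add, map_add, add_smul, map_add]
            map_add' := fun y y' => CharDual.hom_ext fun a => ?_
            map_smul' := fun a y => CharDual.hom_ext fun a' => ?_ },
    fun x => CharDual.hom_ext fun a => ?_⟩
  · change c _ = c _ + c _
    rw [smul_add, map_add]
  · change c (ρ.symm (op a') • a • y) = c (ρ.symm (op (unop (ρ a) * a')) • y)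
    rw [smul_smul, op_mul, map_mul, op_unop, RingEquiv.symm_apply_apply]
  · calc c (ρ.symm (op a) • f x) = c (f (ρ.symm (op a) • x)) :=
        congrArg c (map_smul f (ρ.symm (op a)) x).symm
      _ = CharDual.toHom (g (ρ.symm (op a) • x)) 1 := hc _
      _ = CharDual.toHom (g x) a := by
        rw [map_smul, CharDual.smul_apply, RingEquiv.apply_symm_apply, unop_op, smul_eq_mul,
          mul_one]

/-- The character module of a direct sum is the product of the character modules. -/
def charDualFinsuppEquiv (ρ : A' ≃+* Aᵐᵒᵖ) (ι : Type u) (M : Type u) [AddCommGroup M]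
    [Module A M] : CharDual ρ (ι →₀ M) ≃ₗ[A'] (ι → CharDual ρ M) where
  toFun c i := (CharDual.toHom c).comp (Finsupp.singleAddHom i)
  invFun c := Finsupp.liftAddHom c
  left_inv _ := Finsupp.addHom_ext fun i m => Finsupp.liftAddHom_apply_single _ i m
  right_inv _ := funext fun i => AddMonoidHom.ext fun m => Finsupp.liftAddHom_apply_single _ i m
  map_add' _ _ := rfl
  map_smul' a c := funext fun i => CharDual.hom_ext fun m =>
    congrArg (CharDual.toHom c) (Finsupp.smul_single (unop (ρ a)) i m)

theorem isFlatModule_finsupp (ι : Type u) : IsFlatModule (ModuleCat.of A (ι →₀ A)) := by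
  rw [isFlatModule_iff_injective_charDual (RingEquiv.refl Aᵐᵒᵖ)]
  have := injective_charDual_self (RingEquiv.refl Aᵐᵒᵖ)
  exact (Module.Baer.of_injective inferInstance).of_equiv
    (charDualFinsuppEquiv (RingEquiv.refl Aᵐᵒᵖ) ι A).symm |>.injective

theorem IsShortExact.subsingleton_ext_one_iff {X Y Z W : Type u} [AddCommGroup X] [Module A X]
    [AddCommGroup Y] [Module A Y] [AddCommGroup Z] [Module A Z] [AddCommGroup W] [Module A W]
    [Module.Projective A Y] {f : X →ₗ[A] Y} {g : Y →ₗ[A] Z} (h : IsShortExact f g) :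
    Subsingleton (ExtGroup A Z W 1) ↔ ∀ φ : X →ₗ[A] W, ∃ ψ : Y →ₗ[A] W, ψ ∘ₗ f = φ := by
  have : SMulCommClass A (ULift.{u} ℤ) W := ⟨fun a t w => smul_comm a t.down w⟩
  refine (h.extToOne (ULift.{u} ℤ) W).toEquiv.subsingleton_congr.symm.trans ?_
  rw [Submodule.Quotient.subsingleton_iff, LinearMap.range_eq_top]
  rfl

theorem isFlatModule_iff (ρ : A' ≃+* Aᵐᵒᵖ) {M : ModuleCat.{u} A} :
    IsFlatModule M ↔ ∀ (N : Type u) [AddCommGroup N] [Module A' N] [Module.Finite A' N],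
      Subsingleton (ExtGroup A' N (CharDual ρ M) 1) := by
  rw [isFlatModule_iff_injective_charDual ρ]
  constructor
  · intro _ N _ _ _
    exact subsingleton_ext_of_injective 0
  · refine fun hN => Module.Baer.injective fun I φ => ?_
    obtain ⟨ψ, hψ⟩ := (IsShortExact.ker_subtype_mkQ I).subsingleton_ext_one_iff.1 (hN (A' ⧸ I)) φ
    exact ⟨ψ, fun x hx => LinearMap.congr_fun hψ ⟨x, hx⟩⟩

theorem flatDimLE_iff (ρ : A' ≃+* Aᵐᵒᵖ) (k : ℕ) (M : ModuleCat.{u} A) :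
    FlatDimLE k M ↔ ∀ (N : Type u) [AddCommGroup N] [Module A' N] [Module.Finite A' N],
      Subsingleton (ExtGroup A' N (CharDual ρ M) (k + 1)) := by
  induction k generalizing M with
  | zero => exact isFlatModule_iff ρ
  | succ k ih =>
    constructor
    · rintro ⟨K, F, f, g, hf, hfg, hg, hF, hK⟩ N _ _ _
      have := (isFlatModule_iff_injective_charDual ρ).1 hF
      exact ((IsShortExact.mk hf hfg hg).charDual ρ).subsingleton_ext_left
        (subsingleton_ext_of_injective _) ((ih K).1 hK N)
    · intro hN
      have hg := Finsupp.linearCombination_id_surjective A M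
      have hS := IsShortExact.of_surjective hg
      have hF := isFlatModule_finsupp (A := A) M
      have := (isFlatModule_iff_injective_charDual ρ).1 hF
      exact ⟨ModuleCat.of A (LinearMap.ker _), ModuleCat.of A (M →₀ A), _, _, hS.injective,
        hS.exact, hg, hF, (ih _).2 fun N _ _ _ => (hS.charDual ρ).subsingleton_ext_right
          (subsingleton_ext_of_injective _) (hN N)⟩

end CharDual

section CharEval

theorem exists_comp_eq_of_exact {A X Y Z I : Type u} [Ring A] [AddCommGroup X] [Module A X]
    [AddCommGroup Y] [Module A Y] [AddCommGroup Z] [Module A Z] [AddCommGroup I] [Module A I]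
    [Module.Injective A I] {α : X →ₗ[A] Y} {β : Y →ₗ[A] Z} (h : Function.Exact α β)
    {θ : Y →ₗ[A] I} (hθ : θ ∘ₗ α = 0) : ∃ θ' : Z →ₗ[A] I, θ' ∘ₗ β = θ := by
  have hrange : Function.Exact α β.rangeRestrict := fun y => by
    rw [← h y, ← Subtype.val_inj]
    rfl
  obtain ⟨θ₁, rfl⟩ := (exact_lcomp (S := ℤ) hrange β.surjective_rangeRestrict θ).1 hθ
  obtain ⟨θ', hθ'⟩ := Module.Injective.out (LinearMap.range β).subtype
    (Submodule.injective_subtype _) θ₁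
  exact ⟨θ', LinearMap.ext fun y => hθ' (β.rangeRestrict y)⟩

section Bidual

variable {A A' : Type u} [Ring A] [Ring A'] {B : Type u} [AddCommGroup B] [Module A B]
  [Module A' B] [SMulCommClass A' A B] {F₁ F K : Type u} [AddCommGroup F₁] [Module A' F₁]
  [AddCommGroup F] [Module A' F] [AddCommGroup K] [Module A' K]
  (I : Type u) [AddCommGroup I] [Module A I]

/-- The map induced by `f` on the double duals `Hom_A(Hom_{A'}(-, B), I)`. -/
def bidualHom (f : F →ₗ[A'] K) : ((F →ₗ[A'] B) →ₗ[A] I) →+ ((K →ₗ[A'] B) →ₗ[A] I) where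
  toFun θ := θ ∘ₗ LinearMap.lcomp A B f
  map_zero' := LinearMap.zero_comp _
  map_add' _ _ := LinearMap.add_comp _ _ _

variable {I}

theorem bidualHom_surjective [Module.Injective A I] {f : F →ₗ[A'] K}
    (hf : Function.Surjective f) : Function.Surjective (bidualHom (A := A) (B := B) I f) := by
  intro θ
  obtain ⟨θ', hθ'⟩ := Module.Injective.out (LinearMap.lcomp A B f) (injective_lcomp hf) θ
  exact ⟨θ', LinearMap.ext hθ'⟩

theorem exists_bidualHom_eq [Module.Injective A I] {d : F₁ →ₗ[A'] F} {f : F →ₗ[A'] K}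
    (hdf : Function.Exact d f) (hf : Function.Surjective f) {θ : (F →ₗ[A'] B) →ₗ[A] I}
    (hθ : bidualHom I f θ = 0) : ∃ θ', bidualHom I d θ' = θ :=
  exists_comp_eq_of_exact (exact_lcomp hdf hf) hθ

theorem IsShortExact.hom_ext_one_eq_zero_iff {Z : Type u} [AddCommGroup Z] [Module A' Z]
    [Module.Projective A' F] {f : K →ₗ[A'] F} {g : F →ₗ[A'] Z} (h : IsShortExact f g) :
    (∀ θ : extToBimodule A' A B (ModuleCat.of A' Z) 1 →ₗ[A] I, θ = 0) ↔
      Function.Injective (bidualHom (A := A) (B := B) I f) := by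
  let q : (K →ₗ[A'] B) →ₗ[A] extToBimodule A' A B (ModuleCat.of A' Z) 1 :=
    h.connectingTo A B 0 ∘ₗ (homEquivExtTo A' A B K).toLinearMap
  have hq : Function.Surjective q :=
    (h.connectingTo_surjective B 0 (subsingleton_ext_of_projective 0)).comp
      (homEquivExtTo A' A B K).surjective
  have hexact : Function.Exact (LinearMap.lcomp A B f) q := h.connectingTo_zero_eq_zero_iff B
  rw [injective_iff_map_eq_zero]
  constructor
  · intro hExt θ hθ
    obtain ⟨θ', rfl⟩ := (exact_lcomp (S := ℤ) hexact hq θ).1 hθ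
    rw [hExt θ']
    exact LinearMap.zero_comp q
  · intro hinj θ
    refine (LinearMap.cancel_right hq).1 (hinj (θ ∘ₗ q) ?_)
    exact (exact_lcomp (S := ℤ) hexact hq (θ ∘ₗ q)).2 ⟨θ, rfl⟩

end Bidual

namespace IsRegularBimodule

variable {A A' : Type u} [Ring A] [Ring A'] {B : Type u} [AddCommGroup B] [Module A B]
  [Module A' B] {b : B} (h : IsRegularBimodule A A' b)

theorem leftEquiv_symm_self : h.leftEquiv.symm b = 1 :=
  h.leftEquiv.symm_apply_eq.2 (one_smul A b).symm

variable [SMulCommClass A' A B]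

theorem leftEquiv_symm_smul {ρ : A' ≃+* Aᵐᵒᵖ} (hρ : ∀ a : A', a • b = unop (ρ a) • b) (a : A')
    (c : B) : h.leftEquiv.symm (a • c) = h.leftEquiv.symm c * unop (ρ a) := by
  obtain ⟨x, rfl⟩ := h.leftEquiv.surjective c
  rw [LinearEquiv.symm_apply_apply, LinearEquiv.symm_apply_eq]
  change a • x • b = (x * unop (ρ a)) • b
  rw [smul_comm, hρ, mul_smul]

variable {K : Type u} [AddCommGroup K] [Module A' K] {I : Type u} [AddCommGroup I] [Module A I]

/-- The map `φ ↦ φ(x) y` from `Hom(K, B)` to `I`, where `B` is identified with `A`. -/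
def evalSMul (x : K) : I →+ ((K →ₗ[A'] B) →ₗ[A] I) :=
  AddMonoidHom.mk' (fun y => LinearMap.toSpanSingleton A I y ∘ₗ h.leftEquiv.symm.toLinearMap ∘ₗ
    LinearMap.applyₗ' A x) fun _ _ => LinearMap.ext fun _ => smul_add _ _ _

theorem evalSMul_apply (x : K) (y : I) (φ : K →ₗ[A'] B) :
    h.evalSMul x y φ = h.leftEquiv.symm (φ x) • y := rfl

variable {ρ : A' ≃+* Aᵐᵒᵖ} (hρ : ∀ a : A', a • b = unop (ρ a) • b)

/-- The natural map from the characters of `Hom_A(Hom_{A'}(K, B), I)` to `Hom_{A'}(K, I⁺)`. -/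
def charEval (c : ((K →ₗ[A'] B) →ₗ[A] I) →+ AddCircle (1 : ℚ)) : K →ₗ[A'] CharDual ρ I where
  toFun x := c.comp (h.evalSMul x)
  map_add' x x' := CharDual.hom_ext fun y => by
    refine (congrArg c (LinearMap.ext fun φ => ?_)).trans (map_add c _ _)
    rw [LinearMap.add_apply, evalSMul_apply, evalSMul_apply, evalSMul_apply, map_add, map_add,
      add_smul]
  map_smul' a x := CharDual.hom_ext fun y => by
    refine congrArg c (LinearMap.ext fun φ => ?_)
    rw [evalSMul_apply, evalSMul_apply, map_smul, h.leftEquiv_symm_smul hρ, mul_smul]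
    rfl

theorem charEval_apply (c : ((K →ₗ[A'] B) →ₗ[A] I) →+ AddCircle (1 : ℚ)) (x : K) (y : I) :
    CharDual.toHom (h.charEval hρ c x) y = c (h.evalSMul x y) := rfl

theorem charEval_comp {F : Type u} [AddCommGroup F] [Module A' F] (f : F →ₗ[A'] K)
    (c : ((K →ₗ[A'] B) →ₗ[A] I) →+ AddCircle (1 : ℚ)) :
    h.charEval hρ c ∘ₗ f = h.charEval hρ (c.comp (bidualHom I f)) := rfl

theorem eq_sum_evalSMul {n : ℕ} (θ : ((Fin n → A') →ₗ[A'] B) →ₗ[A] I) :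
    θ = ∑ i, h.evalSMul (Pi.single i 1) (θ (coord b i)) := by
  have hcoord (j : Fin n) :
      (∑ i, h.evalSMul (Pi.single i 1) (θ (coord b i))) (coord b j) = θ (coord b j) := by
    rw [LinearMap.sum_apply, Finset.sum_eq_single j]
    · rw [evalSMul_apply, coord_apply, Pi.single_eq_same, one_smul, h.leftEquiv_symm_self, one_smul]
    · intro i _ hij
      rw [evalSMul_apply, coord_apply, Pi.single_eq_of_ne' hij, zero_smul, map_zero, zero_smul]
    · exact fun hj => absurd (Finset.mem_univ j) hj
  refine LinearMap.ext fun φ => ?_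
  obtain ⟨a, rfl⟩ := h.symm.exists_eq_sum_smul_coord φ
  simp only [map_sum, map_smul, hcoord]

theorem charEval_pi_injective (n : ℕ) :
    Function.Injective (h.charEval hρ (K := Fin n → A') (I := I)) := by
  refine fun c c' hc => AddMonoidHom.ext fun θ => ?_
  rw [h.eq_sum_evalSMul θ, map_sum, map_sum]
  refine Finset.sum_congr rfl fun i _ => ?_
  rw [← h.charEval_apply hρ, ← h.charEval_apply hρ, hc]

theorem charEval_pi_surjective (n : ℕ) :
    Function.Surjective (h.charEval hρ (K := Fin n → A') (I := I)) := by
  intro φ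
  refine ⟨∑ i, (CharDual.toHom (φ (Pi.single i 1))).comp
    (LinearMap.applyₗ' ℤ (coord b i)).toAddMonoidHom, ?_⟩
  refine (Pi.basisFun A' (Fin n)).ext fun j => CharDual.hom_ext fun y => ?_
  rw [charEval_apply, Pi.basisFun_apply, AddMonoidHom.finsetSum_apply, Finset.sum_eq_single j]
  · change CharDual.toHom _ (h.evalSMul (Pi.single j 1) y (coord b j)) = _
    rw [evalSMul_apply, coord_apply, Pi.single_eq_same, one_smul, h.leftEquiv_symm_self, one_smul]
  · intro i _ hij
    change CharDual.toHom _ (h.evalSMul (Pi.single j 1) y (coord b i)) = _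
    rw [evalSMul_apply, coord_apply, Pi.single_eq_of_ne hij, zero_smul, map_zero, zero_smul,
      map_zero]
  · exact fun hj => absurd (Finset.mem_univ j) hj

variable [Module.Injective A I]

theorem charEval_injective [Module.Finite A' K] :
    Function.Injective (h.charEval hρ (K := K) (I := I)) := by
  intro c c' hc
  obtain ⟨n, f, hf⟩ := Module.Finite.exists_fin' A' K
  refine (AddMonoidHom.cancel_right (bidualHom_surjective hf)).1 (h.charEval_pi_injective hρ n ?_)
  rw [← charEval_comp, ← charEval_comp, hc]

theorem charEval_surjective [IsNoetherianRing A'] [Module.Finite A' K] :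
    Function.Surjective (h.charEval hρ (K := K) (I := I)) := by
  intro φ
  obtain ⟨n₀, f, hf⟩ := Module.Finite.exists_fin' A' K
  obtain ⟨n₁, d, hd⟩ := exists_exact_of_finite f
  have hs := bidualHom_surjective (A := A) (B := B) (I := I) hf
  obtain ⟨c₀, hc₀⟩ := h.charEval_pi_surjective hρ n₀ (φ ∘ₗ f)
  have hc₀d : c₀.comp (bidualHom I d) = 0 := by
    apply h.charEval_pi_injective hρ n₁
    rw [← charEval_comp, hc₀, LinearMap.comp_assoc, hd.linearMap_comp_eq_zero, LinearMap.comp_zero]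
    rfl
  let c := AddMonoidHom.liftOfSurjective (bidualHom I f) hs ⟨c₀, fun θ hθ => by
    obtain ⟨θ', rfl⟩ := exists_bidualHom_eq hd hf hθ
    exact DFunLike.congr_fun hc₀d θ'⟩
  have hc : c.comp (bidualHom I f) = c₀ := AddMonoidHom.ext fun θ =>
    AddMonoidHom.liftOfRightInverse_comp_apply (bidualHom I f) _
      (Function.rightInverse_surjInv hs) _ θ
  refine ⟨c, (LinearMap.cancel_right hf).1 ?_⟩
  rw [charEval_comp, hc, hc₀]

include h hρ

theorem forall_exists_comp_eq_iff [IsNoetherianRing A'] [Module.Finite A' K] {F : Type u}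
    [AddCommGroup F] [Module A' F] [Module.Finite A' F] (f : K →ₗ[A'] F) :
    (∀ φ : K →ₗ[A'] CharDual ρ I, ∃ ψ : F →ₗ[A'] CharDual ρ I, ψ ∘ₗ f = φ) ↔
      Function.Injective (bidualHom (A := A) (B := B) I f) := by
  constructor
  · intro hext
    refine (injective_iff_map_eq_zero _).2 fun θ hθ => ?_
    by_contra hne
    obtain ⟨c, hc⟩ := CharacterModule.exists_character_apply_ne_zero_of_ne_zero hne
    obtain ⟨ψ, hψ⟩ := hext (h.charEval hρ c)
    obtain ⟨c', rfl⟩ := h.charEval_surjective hρ ψ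
    rw [charEval_comp] at hψ
    apply hc
    rw [← h.charEval_injective hρ hψ]
    exact (congrArg c' hθ).trans (map_zero c')
  · intro hinj φ
    obtain ⟨c, rfl⟩ := h.charEval_surjective hρ φ
    obtain ⟨c', hc'⟩ := exists_addHom_extension _ hinj c
    refine ⟨h.charEval hρ c', ?_⟩
    rw [charEval_comp]
    exact congrArg _ (AddMonoidHom.ext hc')

theorem subsingleton_ext_charDual_iff [IsNoetherianRing A'] (k : ℕ)
    (N : Type u) [AddCommGroup N] [Module A' N] [Module.Finite A' N] :
    Subsingleton (ExtGroup A' N (CharDual ρ I) (k + 1)) ↔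
      ∀ θ : extToBimodule A' A B (ModuleCat.of A' N) (k + 1) →ₗ[A] I, θ = 0 := by
  induction k generalizing N with
  | zero =>
    obtain ⟨n, f, hf⟩ := Module.Finite.exists_fin' A' N
    have hK := IsShortExact.of_surjective hf
    rw [hK.subsingleton_ext_one_iff, hK.hom_ext_one_eq_zero_iff]
    exact h.forall_exists_comp_eq_iff hρ _
  | succ k ih =>
    obtain ⟨n, f, hf⟩ := Module.Finite.exists_fin' A' N
    have hK := IsShortExact.of_surjective hf
    let e := hK.extToShift A B k
    calc Subsingleton (ExtGroup A' N (CharDual ρ I) (k + 2))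
      _ ↔ Subsingleton (ExtGroup A' (LinearMap.ker f) (CharDual ρ I) (k + 1)) :=
        ⟨hK.subsingleton_ext_from_left (subsingleton_ext_of_projective _),
          fun hN => hK.subsingleton_ext_from_right hN (subsingleton_ext_of_projective _)⟩
      _ ↔ _ := ih _
      _ ↔ _ :=
        ⟨fun hθ θ => (LinearMap.cancel_right e.surjective).1 (hθ (θ ∘ₗ e.toLinearMap)),
          fun hθ θ => (LinearMap.cancel_right e.symm.surjective).1
            (hθ (θ ∘ₗ e.symm.toLinearMap))⟩

end IsRegularBimodule

end CharEval

/-! ### Minimal injective resolutions and strong grade -/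

section MinimalInjective

variable {A : Type u} [Ring A] {X : Type u} [AddCommGroup X] [Module A X]

theorem IsInjectiveEnvelope.hom_eq_zero {C E : Type u} [AddCommGroup C] [Module A C]
    [AddCommGroup E] [Module A E] {j : C →ₗ[A] E} (hj : IsInjectiveEnvelope j) {θ : X →ₗ[A] E}
    (hθ : ∀ φ : (LinearMap.range j).comap θ →ₗ[A] C, φ = 0) : θ = 0 := by
  let e := LinearEquiv.ofInjective j hj.injective_map
  let θ' : (LinearMap.range j).comap θ →ₗ[A] LinearMap.range j := θ.restrict fun _ hx => hx
  have hθ' : e.symm.toLinearMap ∘ₗ θ' = 0 := hθ _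
  refine LinearMap.range_eq_bot.1 (hj.essential _ ((Submodule.eq_bot_iff _).2 ?_))
  rintro _ ⟨⟨x, rfl⟩, hx⟩
  exact congrArg Subtype.val (e.symm.map_eq_zero_iff.1 (LinearMap.congr_fun hθ' ⟨x, hx⟩))

variable (M : ModuleCat.{u} A)

theorem cosyzygy_isShortExact (k : ℕ) :
    IsShortExact (Z := cosyzygy M (k + 1))
      (injectiveEnvelopeMap (cosyzygy M k))
      (LinearMap.range (injectiveEnvelopeMap (cosyzygy M k))).mkQ :=
  IsShortExact.of_injective (injectiveEnvelopeMap_spec _).injective_map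

instance injective_injectiveEnvelope : Module.Injective A (injectiveEnvelope M) :=
  (injectiveEnvelopeMap_spec M).injective_module

instance injective_minimalInjectiveTerm (k : ℕ) :
    Module.Injective A (minimalInjectiveTerm M k) :=
  injective_injectiveEnvelope _

variable {M}

theorem subsingleton_ext_cosyzygy {p q : ℕ}
    (hX : ∀ θ : X →ₗ[A] minimalInjectiveTerm M (q + p), θ = 0) :
    Subsingleton (ExtGroup A X (cosyzygy M q) p) := by
  induction p generalizing q with
  | zero =>
    refine subsingleton_ext_zero_iff.2 fun f => LinearMap.ext fun x =>
      (cosyzygy_isShortExact M q).injective ?_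
    rw [LinearMap.zero_apply, map_zero]
    exact LinearMap.congr_fun (hX (injectiveEnvelopeMap (cosyzygy M q) ∘ₗ f)) x
  | succ p ih =>
    refine (cosyzygy_isShortExact M q).subsingleton_ext_left (subsingleton_ext_of_injective p)
      (ih (q := q + 1) ?_)
    rwa [show q + 1 + p = q + (p + 1) by omega]

theorem subsingleton_ext_cosyzygy_of_subsingleton_ext {p q : ℕ}
    (hM : Subsingleton (ExtGroup A X M (p + q)))
    (hX : ∀ k < q, ∀ θ : X →ₗ[A] minimalInjectiveTerm M k, θ = 0) :
    Subsingleton (ExtGroup A X (cosyzygy M q) p) := by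
  induction q generalizing p with
  | zero => exact hM
  | succ q ih =>
    refine (cosyzygy_isShortExact M q).subsingleton_ext_right ?_
      (ih (p := p + 1) (by rwa [add_right_comm]) fun k hk => hX k (by omega))
    rcases p with _ | p
    · exact subsingleton_ext_zero_iff.2 (hX q (by omega))
    · exact subsingleton_ext_of_injective p

theorem hom_minimalInjectiveTerm_eq_zero {L : Type u} [AddCommGroup L] [Module A L] {i j : ℕ}
    (hL : ∀ (X : Type u) [AddCommGroup X] [Module A X] (ι : X →ₗ[A] L), Function.Injective ι →
      ∀ j < i, Subsingleton (ExtGroup A X M j)) (hj : j < i) {ι : X →ₗ[A] L}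
    (hι : Function.Injective ι) (θ : X →ₗ[A] minimalInjectiveTerm M j) : θ = 0 := by
  induction j using Nat.strong_induction_on generalizing X with
  | _ j ih =>
  refine (injectiveEnvelopeMap_spec (cosyzygy M j)).hom_eq_zero (subsingleton_ext_zero_iff.1 ?_)
  have hX' := hι.comp (Submodule.injective_subtype
    ((LinearMap.range (injectiveEnvelopeMap (cosyzygy M j))).comap θ))
  refine subsingleton_ext_cosyzygy_of_subsingleton_ext ?_ fun k hk =>
    ih k hk (hk.trans hj) (ι := ι ∘ₗ Submodule.subtype _) hX'
  rw [zero_add]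
  exact hL _ (ι ∘ₗ Submodule.subtype _) hX' j hj

end MinimalInjective

section AuslanderGorenstein

variable {A A' : Type u} [Ring A] [Ring A'] {B : Type u} [AddCommGroup B]
    [Module A B] [Module A' B] [SMulCommClass A' A B] {b : B}

theorem subsingleton_ext_of_le [IsNoetherianRing A] {Y : Type u} [AddCommGroup Y] [Module A Y]
    {k l : ℕ} (hkl : k ≤ l) (hY : ∀ (N : Type u) [AddCommGroup N] [Module A N] [Module.Finite A N],
      Subsingleton (ExtGroup A N Y (k + 1)))
    (N : Type u) [AddCommGroup N] [Module A N] [Module.Finite A N] :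
    Subsingleton (ExtGroup A N Y (l + 1)) := by
  induction l, hkl using Nat.le_induction generalizing N with
  | base => exact hY N
  | succ l _ ih =>
    obtain ⟨n, f, hf⟩ := Module.Finite.exists_fin' A N
    exact (IsShortExact.of_surjective hf).subsingleton_ext_from_right (ih _)
      (subsingleton_ext_of_projective _)

theorem isAuslanderGorenstein_iff [IsNoetherianRing A'] (h : IsRegularBimodule A A' b)
    {ρ : A' ≃+* Aᵐᵒᵖ} (hρ : ∀ a : A', a • b = unop (ρ a) • b) (n : ℕ) :
    IsAuslanderGorenstein A n ↔ StrongGradeCondition A A' B n := by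
  constructor
  · intro hA N _ _ _ i h1 hi Y _ _ ι hι j hj
    obtain ⟨i, rfl⟩ := Nat.exists_eq_add_of_le' h1
    refine subsingleton_ext_congr_right h.leftEquiv.symm
      (subsingleton_ext_cosyzygy (M := ModuleCat.of A A) (q := 0) ?_)
    rw [zero_add]
    intro θ
    obtain ⟨θ', hθ'⟩ := Module.Injective.out ι hι θ
    have hθ₀ : θ' = 0 := (h.subsingleton_ext_charDual_iff hρ i N).1
      (subsingleton_ext_of_le (by omega) ((flatDimLE_iff ρ j _).1 (hA j (by omega))) N) θ'
    exact LinearMap.ext fun y => (hθ' y).symm.trans (LinearMap.congr_fun hθ₀ (ι y))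
  · intro hS i hi
    refine (flatDimLE_iff ρ i _).2 fun N _ _ _ => (h.subsingleton_ext_charDual_iff hρ i N).2 ?_
    exact hom_minimalInjectiveTerm_eq_zero (fun X _ _ ι hι j hj =>
      subsingleton_ext_congr_right h.leftEquiv (hS N (i + 1) (by omega) hi X ι hι j hj))
      i.lt_succ_self Function.injective_id (ι := LinearMap.id)

end AuslanderGorenstein

/-! ### Matlis duality over a commutative artinian ring -/

section Matlis

variable (R : Type u) [CommRing R]

/-- The composite `R → R / J(R) → E⁰(R / J(R))`, whose image is that of `R / J(R)`. -/
def toMatlisModule : R →ₗ[R] matlisModule R :=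
  injectiveEnvelopeMap (ModuleCat.of R (R ⧸ Ring.jacobson R)) ∘ₗ (Ring.jacobson R).mkQ

variable {R}

theorem toMatlisModule_eq_zero_iff {a : R} : toMatlisModule R a = 0 ↔ a ∈ Ring.jacobson R := by
  rw [toMatlisModule, LinearMap.comp_apply,
    map_eq_zero_iff _ (injectiveEnvelopeMap_spec _).injective_map, Submodule.mkQ_apply,
    Submodule.Quotient.mk_eq_zero]

theorem exists_smul_eq_toMatlisModule {z : matlisModule R} (hz : z ≠ 0) :
    ∃ r a : R, r • z = toMatlisModule R a ∧ r • z ≠ 0 := by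
  have h : Submodule.span R {z} ⊓ LinearMap.range (toMatlisModule R) ≠ ⊥ := fun h =>
    hz (Submodule.span_singleton_eq_bot.1 ((injectiveEnvelopeMap_spec _).essential _
      (by rwa [toMatlisModule, LinearMap.range_comp_of_range_eq_top _ (Submodule.range_mkQ _)]
        at h)))
  obtain ⟨y, ⟨hy, a, ha⟩, hy0⟩ := Submodule.exists_mem_ne_zero_of_ne_bot h
  obtain ⟨r, rfl⟩ := Submodule.mem_span_singleton.1 hy
  exact ⟨r, a, ha.symm, hy0⟩

theorem exists_toMatlisModule_eq {m : Ideal R} [hm : m.IsMaximal] {z : matlisModule R}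
    (hz : ∀ r ∈ m, r • z = 0) : ∃ a : R, toMatlisModule R a = z := by
  by_cases h0 : z = 0
  · exact ⟨0, by rw [h0, map_zero]⟩
  obtain ⟨r, b, hb, hr0⟩ := exists_smul_eq_toMatlisModule h0
  have hr : r ∉ m := fun hr => hr0 (hz r hr)
  obtain ⟨c, d, hd, hcd⟩ := hm.exists_inv hr
  refine ⟨c • b, ?_⟩
  calc toMatlisModule R (c • b) = (c * r) • z + d • z := by
        rw [map_smul, ← hb, smul_smul, hz d hd, add_zero]
    _ = z := by rw [← add_smul, hcd, one_smul]

theorem mem_ringJacobson_iff {a : R} :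
    a ∈ Ring.jacobson R ↔ ∀ m : Ideal R, m.IsMaximal → a ∈ m := by
  rw [Ring.jacobson, Module.jacobson, Submodule.mem_sInf]
  exact ⟨fun h m hm => h m hm.out, fun h m hm => h m ⟨hm⟩⟩

theorem exists_mul_mem_ringJacobson [IsArtinianRing R] (m : Ideal R) [hm : m.IsMaximal] :
    ∃ a ∉ m, ∀ r ∈ m, r * a ∈ Ring.jacobson R := by
  classical
  let s : Finset (Ideal R) := (IsArtinianRing.setOfPred_isMaximal_finite R).toFinset.erase m
  have hs : ¬ s.prod id ≤ m := by
    rw [hm.isPrime.prod_le]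
    rintro ⟨I, hI, hIm⟩
    have hI' := Finset.mem_erase.1 hI
    have hImax : I.IsMaximal := by simpa using hI'.2
    exact hI'.1 (hImax.eq_of_le hm.ne_top hIm)
  obtain ⟨a, ha, ham⟩ := SetLike.not_le_iff_exists.1 hs
  refine ⟨a, ham, fun r hr => mem_ringJacobson_iff.2 fun p hp => ?_⟩
  by_cases hpm : p = m
  · subst hpm
    exact p.mul_mem_right _ hr
  · refine p.mul_mem_left _ (Ideal.le_of_dvd (Finset.dvd_prod_of_mem id ?_) ha)
    exact Finset.mem_erase.2 ⟨hpm, by simpa using hp⟩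

theorem exists_mul_sub_mem_ringJacobson {m : Ideal R} [hm : m.IsMaximal] {a b : R}
    (ha : ∀ r ∈ m, r * a ∈ Ring.jacobson R) (ha' : a ∉ Ring.jacobson R)
    (hb : ∀ r ∈ m, r * b ∈ Ring.jacobson R) : ∃ r, r * a - b ∈ Ring.jacobson R := by
  have ham : a ∉ m := fun h => ha' (mem_ringJacobson_iff.2 fun p hp =>
    (hp.isPrime.mem_or_mem (mem_ringJacobson_iff.1 (ha a h) p hp)).elim id id)
  obtain ⟨c, d, hd, hcd⟩ := hm.exists_inv ham
  refine ⟨c * b, ?_⟩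
  have : c * b * a - b = -(d * b) := by linear_combination b * hcd
  exact this ▸ neg_mem (hb d hd)

variable {M : Type u} [AddCommGroup M] [Module R M]

theorem exists_matlis_apply_ne_zero [IsArtinianRing R] {x : M} (hx : x ≠ 0) :
    ∃ f : M →ₗ[R] matlisModule R, f x ≠ 0 := by
  let I : Ideal R := LinearMap.ker (LinearMap.toSpanSingleton R M x)
  have hI : I ≠ ⊤ := (Ideal.ne_top_iff_one I).2 fun h => hx (by simpa [I] using h)
  obtain ⟨m, hm, hIm⟩ := Ideal.exists_le_maximal I hI
  obtain ⟨a, ha, ham⟩ := exists_mul_mem_ringJacobson m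
  let e := toMatlisModule R a
  have he : e ≠ 0 := fun h => ha (mem_ringJacobson_iff.1 (toMatlisModule_eq_zero_iff.1 h) m hm)
  have hle : I ≤ LinearMap.ker (LinearMap.toSpanSingleton R (matlisModule R) e) := fun r hr => by
    rw [LinearMap.mem_ker, LinearMap.toSpanSingleton_apply, ← map_smul,
      toMatlisModule_eq_zero_iff]
    exact ham r (hIm hr)
  obtain ⟨f, hf⟩ := (injective_injectiveEnvelope _).out
    (I.liftQ (LinearMap.toSpanSingleton R M x) le_rfl)
    (LinearMap.ker_eq_bot.1 (Submodule.ker_liftQ_eq_bot _ _ _ le_rfl))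
    (I.liftQ (LinearMap.toSpanSingleton R (matlisModule R) e) hle)
  have hfx := hf (Submodule.Quotient.mk 1)
  rw [Submodule.liftQ_apply, Submodule.liftQ_apply, LinearMap.toSpanSingleton_apply_one,
    LinearMap.toSpanSingleton_apply_one] at hfx
  exact ⟨f, hfx ▸ he⟩

theorem exists_smul_eq_of_isSimpleModule {S : Type u} [AddCommGroup S] [Module R S]
    [IsSimpleModule R S] {f : S →ₗ[R] matlisModule R} (hf : f ≠ 0) (g : S →ₗ[R] matlisModule R) :
    ∃ r : R, r • f = g := by
  obtain ⟨s, hs⟩ : ∃ s, f s ≠ 0 := by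
    by_contra! h
    exact hf (LinearMap.ext h)
  have hs0 : s ≠ 0 := fun h => hs (by rw [h, map_zero])
  let m : Ideal R := LinearMap.ker (LinearMap.toSpanSingleton R S s)
  have hm : m.IsMaximal := IsSimpleModule.ker_toSpanSingleton_isMaximal R hs0
  have hms (h : S →ₗ[R] matlisModule R) (r : R) (hr : r ∈ m) : r • h s = 0 := by
    rw [← map_smul, show r • s = 0 from hr, map_zero]
  have hmJ {c : R} {h : S →ₗ[R] matlisModule R} (hc : toMatlisModule R c = h s) (r : R)
      (hr : r ∈ m) : r * c ∈ Ring.jacobson R := by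
    rw [← toMatlisModule_eq_zero_iff, ← smul_eq_mul, map_smul, hc, hms h r hr]
  obtain ⟨a, ha⟩ := exists_toMatlisModule_eq (hms f)
  obtain ⟨b, hb⟩ := exists_toMatlisModule_eq (hms g)
  obtain ⟨r, hr⟩ := exists_mul_sub_mem_ringJacobson (hmJ ha)
    (fun h => hs (by rw [← ha, toMatlisModule_eq_zero_iff.2 h])) (hmJ hb)
  have hrs : r • f s = g s := by
    rw [← ha, ← hb, ← map_smul, ← sub_eq_zero, ← map_sub, smul_eq_mul,
      toMatlisModule_eq_zero_iff.2 hr]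
  refine ⟨r, LinearMap.ext fun t => ?_⟩
  obtain ⟨q, rfl⟩ := IsSimpleModule.toSpanSingleton_surjective R hs0 t
  rw [LinearMap.smul_apply, LinearMap.toSpanSingleton_apply, map_smul, map_smul, smul_comm, hrs]

theorem length_matlisDual_le_of_isSimpleModule {S : Type u} [AddCommGroup S] [Module R S]
    [IsSimpleModule R S] : Module.length R (S →ₗ[R] matlisModule R) ≤ 1 := by
  rcases subsingleton_or_nontrivial (S →ₗ[R] matlisModule R) with h | h
  · rw [Module.length_eq_zero]
    exact zero_le
  · have : IsSimpleModule R (S →ₗ[R] matlisModule R) :=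
      isSimpleModule_iff_toSpanSingleton_surjective.2
        ⟨h, fun f hf g => exists_smul_eq_of_isSimpleModule hf g⟩
    rw [Module.length_eq_one]

theorem length_matlisDual_le (h : IsFiniteLength R M) :
    Module.length R (M →ₗ[R] matlisModule R) ≤ Module.length R M := by
  induction h with
  | of_subsingleton =>
    rw [Module.length_eq_zero]
    exact zero_le
  | @of_simple_quotient M _ _ N _ _ ih =>
    have hN : Function.Exact N.subtype N.mkQ := LinearMap.exact_subtype_mkQ N
    have hres : Function.Surjective (LinearMap.lcomp R (matlisModule R) N.subtype) := fun f =>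
      let ⟨g, hg⟩ := (injective_injectiveEnvelope _).out N.subtype N.injective_subtype f
      ⟨g, LinearMap.ext hg⟩
    rw [Module.length_eq_add_of_exact N.subtype N.mkQ N.injective_subtype N.mkQ_surjective hN,
      Module.length_eq_add_of_exact _ _ (injective_lcomp N.mkQ_surjective) hres
        (exact_lcomp hN N.mkQ_surjective), add_comm]
    refine add_le_add ih (length_matlisDual_le_of_isSimpleModule.trans ?_)
    rw [Module.length_eq_one]

variable (R M) in
/-- The evaluation map of `M` into its double Matlis dual. -/
abbrev matlisBidual : M →ₗ[R] ((M →ₗ[R] matlisModule R) →ₗ[R] matlisModule R) :=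
  LinearMap.applyₗ

variable [IsArtinianRing R] [Module.Finite R M]

theorem isFiniteLength_of_finite : IsFiniteLength R M :=
  isFiniteLength_iff_isNoetherian_isArtinian.2 ⟨inferInstance, inferInstance⟩

theorem finite_matlisDual : Module.Finite R (M →ₗ[R] matlisModule R) := by
  have h : IsFiniteLength R M := isFiniteLength_of_finite
  have h' : IsFiniteLength R (M →ₗ[R] matlisModule R) := Module.length_ne_top_iff.1
    (ne_top_of_le_ne_top (Module.length_ne_top_iff.2 h) (length_matlisDual_le h))
  have := (isFiniteLength_iff_isNoetherian_isArtinian.1 h').1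
  infer_instance

theorem matlisBidual_bijective : Function.Bijective (matlisBidual R M) := by
  have hinj : Function.Injective (matlisBidual R M) := by
    refine (injective_iff_map_eq_zero _).2 fun x hx => ?_
    by_contra h
    obtain ⟨f, hf⟩ := exists_matlis_apply_ne_zero (R := R) h
    exact hf (LinearMap.congr_fun hx f)
  refine ⟨hinj, ?_⟩
  have : Module.Finite R (M →ₗ[R] matlisModule R) := finite_matlisDual
  have : Module.Finite R ((M →ₗ[R] matlisModule R) →ₗ[R] matlisModule R) := finite_matlisDual
  rw [← LinearMap.range_eq_top]
  by_contra h
  have hlt := Submodule.length_lt h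
  rw [← (LinearEquiv.ofInjective _ hinj).length_eq] at hlt
  exact hlt.not_ge ((length_matlisDual_le isFiniteLength_of_finite).trans
    (length_matlisDual_le isFiniteLength_of_finite))

end Matlis

/-! ### Bimodules inducing a duality -/

section Duality

/-- The evaluation map `M → Hom_{A'}(Hom_A(M, W), W)`, for a bimodule `W`. -/
def dualEval (A A' W : Type u) [Ring A] [Ring A'] [AddCommGroup W] [Module A W] [Module A' W]
    [SMulCommClass A A' W] [SMulCommClass A' A W] (M : Type u) [AddCommGroup M] [Module A M] :
    M →ₗ[A] ((M →ₗ[A] W) →ₗ[A'] W) where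
  toFun x :=
    { toFun := fun φ => φ x
      map_add' := fun _ _ => rfl
      map_smul' := fun _ _ => rfl }
  map_add' x y := LinearMap.ext fun φ => map_add φ x y
  map_smul' a x := LinearMap.ext fun φ => map_smul φ a x

/-- One half of a Morita duality between the finitely generated modules over `A` and over `A'`:
`Hom_A(-, W)` is exact, takes finitely generated `A`-modules to finitely generated `A'`-modules and
makes them reflexive. A Morita duality is given by both `InducesDuality A A' W` and
`InducesDuality A' A W`. -/
structure InducesDuality (A A' W : Type u) [Ring A] [Ring A'] [AddCommGroup W] [Module A W]
    [Module A' W] [SMulCommClass A A' W] [SMulCommClass A' A W] : Prop where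
  injective : Module.Injective A W
  finite : ∀ (M : Type u) [AddCommGroup M] [Module A M] [Module.Finite A M],
    Module.Finite A' (M →ₗ[A] W)
  reflexive : ∀ (M : Type u) [AddCommGroup M] [Module A M] [Module.Finite A M],
    Function.Bijective (dualEval A A' W M)

section Coinduced

variable {R A W E : Type u} [CommRing R] [Ring A] [Algebra R A]
  [AddCommGroup W] [Module A W] [Module R W] [IsScalarTower R A W]
  [AddCommGroup E] [Module R E] (τ : W →ₗ[R] E)

variable (A) in
/-- The map `W → Hom_R(A, E)` which corresponds to an `R`-linear map `τ : W → E`. -/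
def toCoinduced (w : W) : A →ₗ[R] E :=
  τ ∘ₗ (LinearMap.toSpanSingleton A W w).restrictScalars R

variable {τ}

variable {M : Type u} [AddCommGroup M] [Module A M] [Module R M] [IsScalarTower R A M]

variable (A τ M) in
/-- The map `Hom_A(M, W) → Hom_R(M, E)` given by composition with `τ : W → E`. -/
def homCoinduced : (M →ₗ[A] W) →ₗ[R] (M →ₗ[R] E) where
  toFun φ := τ ∘ₗ φ.restrictScalars R
  map_add' φ ψ := LinearMap.ext fun x => map_add τ (φ x) (ψ x)
  map_smul' r φ := LinearMap.ext fun x => map_smul τ r (φ x)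

theorem homCoinduced_bijective (hτ : Function.Bijective (toCoinduced A τ)) :
    Function.Bijective (homCoinduced A τ M) := by
  constructor
  · intro φ ψ h
    refine LinearMap.ext fun x => hτ.1 (LinearMap.ext fun a => ?_)
    have hx : τ (φ (a • x)) = τ (ψ (a • x)) := LinearMap.congr_fun h (a • x)
    rwa [map_smul φ, map_smul ψ] at hx
  · intro f
    choose w hw using fun x : M =>
      hτ.2 (f ∘ₗ (LinearMap.toSpanSingleton A M x).restrictScalars R)
    have hw' : ∀ x (a : A), τ (a • w x) = f (a • x) := fun x a => LinearMap.congr_fun (hw x) a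
    refine ⟨{ toFun := w, map_add' := fun x y => ?_, map_smul' := fun a x => ?_ }, ?_⟩
    · refine hτ.1 (LinearMap.ext fun a => ?_)
      change τ (a • w (x + y)) = τ (a • (w x + w y))
      rw [hw', smul_add, smul_add, map_add, map_add, hw', hw']
    · refine hτ.1 (LinearMap.ext fun b => ?_)
      change τ (b • w (a • x)) = τ (b • a • w x)
      rw [hw', smul_smul, smul_smul, hw']
    · refine LinearMap.ext fun x => ?_
      change τ (w x) = f x
      simpa only [one_smul] using hw' x 1

theorem exists_isScalarTower (R A M : Type u) [CommRing R] [Ring A] [Algebra R A]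
    [AddCommGroup M] [Module A M] : ∃ _ : Module R M, IsScalarTower R A M :=
  letI := Module.compHom M (algebraMap R A)
  ⟨inferInstance, ⟨fun r a x => by
    rw [Algebra.smul_def, mul_smul]
    rfl⟩⟩

theorem injective_of_coinduced [hE : Module.Injective R E]
    (hτ : Function.Bijective (toCoinduced A τ)) : Module.Injective A W := by
  refine ⟨fun X Y _ _ _ _ f hf k => ?_⟩
  obtain ⟨_, _⟩ := exists_isScalarTower R A X
  obtain ⟨_, _⟩ := exists_isScalarTower R A Y
  obtain ⟨g, hg⟩ := hE.out (f.restrictScalars R) hf (homCoinduced A τ X k)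
  obtain ⟨g, rfl⟩ := (homCoinduced_bijective hτ).2 g
  exact ⟨g, LinearMap.congr_fun ((homCoinduced_bijective hτ).1 (a₁ := g ∘ₗ f)
    (LinearMap.ext hg))⟩

end Coinduced

section

variable {R A A' W : Type u} [CommRing R] [IsArtinianRing R] [Ring A] [Algebra R A]
  [Module.Finite R A] [Ring A'] [Algebra R A'] [AddCommGroup W] [Module A W] [Module A' W]
  [Module R W] [IsScalarTower R A W] [IsScalarTower R A' W] [SMulCommClass A A' W]
  [SMulCommClass A' A W] {τ : W →ₗ[R] matlisModule R}

theorem dualEval_bijective_of_coinduced {M : Type u} [AddCommGroup M] [Module A M]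
    [Module.Finite A M] (hτ : Function.Bijective (toCoinduced A τ))
    (hτ' : Function.Bijective (toCoinduced A' τ)) :
    Function.Bijective (dualEval A A' W M) := by
  obtain ⟨_, _⟩ := exists_isScalarTower R A M
  have : Module.Finite R M := Module.Finite.trans A M
  let e := LinearEquiv.ofBijective _ (homCoinduced_bijective (M := M) hτ)
  have he : Function.Bijective (LinearMap.lcomp R (matlisModule R) e.symm.toLinearMap) :=
    (LinearEquiv.congrLeft (matlisModule R) R e).bijective
  have hco : Function.Bijective (homCoinduced A' τ (M →ₗ[A] W)) := homCoinduced_bijective hτ'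
  have hfactor : ⇑(matlisBidual R M) = LinearMap.lcomp R (matlisModule R) e.symm.toLinearMap ∘
      homCoinduced A' τ (M →ₗ[A] W) ∘ dualEval A A' W M := by
    funext x
    refine LinearMap.ext fun f => ?_
    obtain ⟨φ, rfl⟩ := e.surjective f
    change e φ x = τ (e.symm (e φ) x)
    rw [e.symm_apply_apply]
    rfl
  have hbi := matlisBidual_bijective (R := R) (M := M)
  rwa [hfactor, Function.Bijective.of_comp_iff' he, Function.Bijective.of_comp_iff' hco] at hbi

theorem inducesDuality_of_coinduced (hτ : Function.Bijective (toCoinduced A τ))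
    (hτ' : Function.Bijective (toCoinduced A' τ)) : InducesDuality A A' W where
  injective := injective_of_coinduced hτ
  finite M _ _ _ := by
    obtain ⟨_, _⟩ := exists_isScalarTower R A M
    have : Module.Finite R M := Module.Finite.trans A M
    have : Module.Finite R (M →ₗ[R] matlisModule R) := finite_matlisDual
    have : Module.Finite R (M →ₗ[A] W) := Module.Finite.equiv
      (LinearEquiv.ofBijective _ (homCoinduced_bijective (M := M) hτ)).symm
    exact Module.Finite.of_restrictScalars_finite R A' _
  reflexive M _ _ _ := dualEval_bijective_of_coinduced hτ hτ'

end

namespace MatlisDual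

variable (R Λ : Type u) [CommRing R] [Ring Λ] [Algebra R Λ]

instance moduleBase : Module R (MatlisDual R Λ) :=
  inferInstanceAs (Module R (Λ →ₗ[R] matlisModule R))

instance isScalarTower : IsScalarTower R Λ (MatlisDual R Λ) where
  smul_assoc r a f := LinearMap.ext fun x => by
    change toLinearMap f (x * r • a) = r • toLinearMap f (x * a)
    rw [mul_smul_comm, map_smul]

instance isScalarTower_op : IsScalarTower R Λᵐᵒᵖ (MatlisDual R Λ) where
  smul_assoc r a f := LinearMap.ext fun x => by
    change toLinearMap f (r • unop a * x) = r • toLinearMap f (unop a * x)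
    rw [smul_mul_assoc, map_smul]

/-- The evaluation `f ↦ f 1`, through which `D(Λ)` is coinduced from `E⁰(R / J(R))` on either
side. -/
def evalOne : MatlisDual R Λ →ₗ[R] matlisModule R :=
  LinearMap.applyₗ (1 : Λ)

theorem toCoinduced_bijective : Function.Bijective (toCoinduced Λ (evalOne R Λ)) := by
  have h : ∀ (f : MatlisDual R Λ) (a : Λ), toCoinduced Λ (evalOne R Λ) f a = toLinearMap f a :=
    fun f a => congrArg (toLinearMap f) (one_mul a)
  refine ⟨fun f g hfg => LinearMap.ext fun a => ?_, fun f => ⟨f, LinearMap.ext fun a => h f a⟩⟩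
  exact (h f a).symm.trans ((LinearMap.congr_fun hfg a).trans (h g a))

theorem toCoinduced_op_bijective : Function.Bijective (toCoinduced Λᵐᵒᵖ (evalOne R Λ)) := by
  have h : ∀ (f : MatlisDual R Λ) (a : Λ),
      toCoinduced Λᵐᵒᵖ (evalOne R Λ) f (op a) = toLinearMap f a :=
    fun f a => congrArg (toLinearMap f) (mul_one a)
  refine ⟨fun f g hfg => LinearMap.ext fun a => ?_, fun f =>
    ⟨f ∘ₗ (opLinearEquiv R).toLinearMap, LinearMap.ext fun a => h _ (unop a)⟩⟩
  exact (h f a).symm.trans ((LinearMap.congr_fun hfg (op a)).trans (h g a))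

instance smulCommClass_op : SMulCommClass Λᵐᵒᵖ Λ (MatlisDual R Λ) := SMulCommClass.symm _ _ _

variable [IsArtinianRing R] [Module.Finite R Λ]

theorem inducesDuality : InducesDuality Λ Λᵐᵒᵖ (MatlisDual R Λ) :=
  inducesDuality_of_coinduced (toCoinduced_bijective R Λ) (toCoinduced_op_bijective R Λ)

theorem inducesDuality_op : InducesDuality Λᵐᵒᵖ Λ (MatlisDual R Λ) :=
  inducesDuality_of_coinduced (toCoinduced_op_bijective R Λ) (toCoinduced_bijective R Λ)

end MatlisDual

namespace InducesDuality

variable {A A' W : Type u} [Ring A] [Ring A'] [AddCommGroup W] [Module A W] [Module A' W]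
  [SMulCommClass A A' W] [SMulCommClass A' A W]

theorem exists_ne_zero (h : InducesDuality A A' W) {M : Type u} [AddCommGroup M] [Module A M]
    {x : M} (hx : x ≠ 0) : ∃ f : M →ₗ[A] W, f x ≠ 0 := by
  let x' : Submodule.span A {x} := ⟨x, Submodule.mem_span_singleton_self x⟩
  have hx' : dualEval A A' W _ x' ≠ 0 :=
    (map_ne_zero_iff _ (h.reflexive (Submodule.span A {x})).1).2 (mt (congrArg Subtype.val) hx)
  obtain ⟨φ, hφ⟩ := DFunLike.ne_iff.1 hx'
  obtain ⟨f, hf⟩ := h.injective.out _ (Submodule.span A {x}).injective_subtype φ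
  exact ⟨f, (hf x').trans_ne hφ⟩

theorem subsingleton_iff (h : InducesDuality A A' W) {M : Type u} [AddCommGroup M] [Module A M] :
    Subsingleton (M →ₗ[A] W) ↔ Subsingleton M := by
  refine ⟨fun hM => subsingleton_of_forall_eq 0 fun x => ?_, fun _ => inferInstance⟩
  by_contra hx
  obtain ⟨f, hf⟩ := h.exists_ne_zero hx
  exact hf (by rw [Subsingleton.elim f 0, LinearMap.zero_apply])

theorem isShortExact_dual (h : InducesDuality A A' W) {X Y Z : Type u} [AddCommGroup X]
    [Module A X] [AddCommGroup Y] [Module A Y] [AddCommGroup Z] [Module A Z]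
    {f : X →ₗ[A] Y} {g : Y →ₗ[A] Z} (hfg : IsShortExact f g) :
    IsShortExact (LinearMap.lcomp A' W g) (LinearMap.lcomp A' W f) where
  injective := injective_lcomp hfg.surjective
  exact := exact_lcomp hfg.exact hfg.surjective
  surjective φ := by
    obtain ⟨ψ, hψ⟩ := h.injective.out f hfg.injective φ
    exact ⟨ψ, LinearMap.ext hψ⟩

theorem lcomp_subtype_surjective (h : InducesDuality A A' W) {M : Type u} [AddCommGroup M]
    [Module A M] (X : Submodule A M) :
    Function.Surjective (LinearMap.lcomp A' W X.subtype) :=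
  (h.isShortExact_dual (IsShortExact.ker_subtype_mkQ X)).surjective

theorem exists_quotient_equiv (h : InducesDuality A A' W) {M : Type u} [AddCommGroup M]
    [Module A M] (X : Submodule A M) :
    ∃ K : Submodule A' (M →ₗ[A] W), Nonempty (((M →ₗ[A] W) ⧸ K) ≃ₗ[A'] (X →ₗ[A] W)) :=
  ⟨_, ⟨LinearMap.quotKerEquivOfSurjective _
    (h.lcomp_subtype_surjective X)⟩⟩

theorem exists_submodule_equiv (h : InducesDuality A A' W) (h' : InducesDuality A' A W)
    {M : Type u} [AddCommGroup M] [Module A M] [Module.Finite A M]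
    (K : Submodule A' (M →ₗ[A] W)) :
    ∃ X : Submodule A M, Nonempty (((M →ₗ[A] W) ⧸ K) ≃ₗ[A'] (X →ₗ[A] W)) := by
  let X : Submodule A M := ⨅ φ ∈ K, LinearMap.ker φ
  have hX {x : M} : x ∈ X ↔ ∀ φ ∈ K, φ x = 0 := by
    simp only [X, Submodule.mem_iInf, LinearMap.mem_ker]
  have hK : K = LinearMap.ker (LinearMap.lcomp A' W X.subtype) := by
    refine le_antisymm (fun φ hφ => LinearMap.ext fun x => hX.1 x.2 φ hφ) fun φ hφ => ?_
    by_contra hn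
    obtain ⟨θ, hθ⟩ := h'.exists_ne_zero (x := K.mkQ φ) (by simpa using hn)
    obtain ⟨x, hx⟩ := (h.reflexive M).2 (θ ∘ₗ K.mkQ)
    have hxX : x ∈ X := hX.2 fun ψ hψ => (LinearMap.congr_fun hx ψ).trans
      ((congrArg θ ((Submodule.Quotient.mk_eq_zero K).2 hψ)).trans (map_zero θ))
    exact hθ ((LinearMap.congr_fun hx φ).symm.trans (LinearMap.congr_fun hφ ⟨x, hxX⟩))
  exact ⟨X, ⟨(Submodule.quotEquivOfEq _ _ hK).trans (LinearMap.quotKerEquivOfSurjective _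
    (h.lcomp_subtype_surjective X))⟩⟩

theorem dualEval_submodule_bijective (h : InducesDuality A A' W) {M : Type u} [AddCommGroup M]
    [Module A M] [Module.Finite A M] (X : Submodule A M) :
    Function.Bijective (dualEval A A' W X) := by
  refine ⟨(injective_iff_map_eq_zero _).2 fun x hx => ?_, fun θ => ?_⟩
  · by_contra hx0
    obtain ⟨f, hf⟩ := h.exists_ne_zero hx0
    exact hf (LinearMap.congr_fun hx f)
  obtain ⟨x, hx⟩ := (h.reflexive M).2 (θ ∘ₗ LinearMap.lcomp A' W X.subtype)
  have hxθ (φ : M →ₗ[A] W) : φ x = θ (φ ∘ₗ X.subtype) := LinearMap.congr_fun hx φ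
  have hxX : x ∈ X := by
    by_contra hn
    obtain ⟨f, hf⟩ := h.exists_ne_zero (x := X.mkQ x) (by simpa using hn)
    refine hf ((hxθ (f ∘ₗ X.mkQ)).trans ?_)
    rw [LinearMap.comp_assoc, (LinearMap.exact_subtype_mkQ X).linearMap_comp_eq_zero,
      LinearMap.comp_zero, map_zero]
  refine ⟨⟨x, hxX⟩, LinearMap.ext fun φ => ?_⟩
  obtain ⟨φ, rfl⟩ := h.lcomp_subtype_surjective X φ
  exact hxθ φ

theorem isNoetherianRing (h : InducesDuality A A' W) (h' : InducesDuality A' A W) :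
    IsNoetherianRing A := by
  refine isNoetherianRing_iff_ideal_fg A |>.2 fun I => Module.Finite.iff_fg.1 ?_
  have := h.finite A
  have : Module.Finite A' (I →ₗ[A] W) := Module.Finite.of_surjective _
    (h.lcomp_subtype_surjective I)
  have := h'.finite (I →ₗ[A] W)
  exact Module.Finite.equiv
    (LinearEquiv.ofBijective _ (h.dualEval_submodule_bijective I)).symm

end InducesDuality

end Duality

/-! ### Ext groups of dual modules -/

theorem isRegularBimodule_one (Λ : Type u) [Ring Λ] : IsRegularBimodule Λ Λᵐᵒᵖ (1 : Λ) where
  left := by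
    have : (fun a : Λ => a • (1 : Λ)) = id := funext fun a => mul_one a
    rw [this]
    exact Function.bijective_id
  right := by
    have : (fun a : Λᵐᵒᵖ => a • (1 : Λ)) = unop := funext fun a => one_mul (unop a)
    rw [this]
    exact unop_bijective

namespace InducesDuality

variable {Λ W : Type u} [Ring Λ] [AddCommGroup W] [Module Λ W] [Module Λᵐᵒᵖ W]
  [SMulCommClass Λ Λᵐᵒᵖ W] [SMulCommClass Λᵐᵒᵖ Λ W]

theorem exists_op_smul_eq (h' : InducesDuality Λᵐᵒᵖ Λ W) (φ : W →ₗ[Λ] W) :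
    ∃ a : Λ, ∀ w, φ w = op a • w := by
  obtain ⟨c, hc⟩ := (h'.reflexive Λᵐᵒᵖ).2 (φ ∘ₗ dualEval Λᵐᵒᵖ Λ W Λᵐᵒᵖ 1)
  refine ⟨unop c, fun w => ?_⟩
  have hcw : c • w = φ ((1 : Λᵐᵒᵖ) • w) :=
    LinearMap.congr_fun hc (LinearMap.toSpanSingleton Λᵐᵒᵖ W w)
  rw [one_smul] at hcw
  exact hcw.symm

theorem eq_of_op_smul_eq (h' : InducesDuality Λᵐᵒᵖ Λ W) {a b : Λ}
    (hab : ∀ w : W, op a • w = op b • w) : a = b := by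
  refine op_injective ((h'.reflexive Λᵐᵒᵖ).1 (LinearMap.ext fun ψ => ?_))
  have hψ (c : Λᵐᵒᵖ) : ψ c = c • ψ 1 := by rw [← map_smul, smul_eq_mul, mul_one]
  exact (hψ _).trans ((hab _).trans (hψ _).symm)

section ExtDual

variable (N : Type u) [AddCommGroup N] [Module Λᵐᵒᵖ N]

variable (W) in
/-- The map `Hom_{Λᵒᵖ}(N, Λ) → Hom_Λ(W, Hom_{Λᵒᵖ}(N, W))`, `ν ↦ (w ↦ (x ↦ w ν(x)))`. -/
def homToHomDual :
    letI := homFromModule Λ Λ W (N →ₗ[Λᵐᵒᵖ] W)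
    (N →ₗ[Λᵐᵒᵖ] Λ) →ₗ[Λ] (W →ₗ[Λ] (N →ₗ[Λᵐᵒᵖ] W)) :=
  letI := homFromModule Λ Λ W (N →ₗ[Λᵐᵒᵖ] W)
  { toFun := fun ν =>
      { toFun := fun w =>
          { toFun := fun x => op (ν x) • w
            map_add' := fun x y => by rw [map_add, MulOpposite.op_add, add_smul]
            map_smul' := fun a x => by
              rw [map_smul, RingHom.id_apply, smul_smul]
              rfl }
        map_add' := fun w w' => LinearMap.ext fun x => smul_add _ _ _
        map_smul' := fun a w => LinearMap.ext fun x => smul_comm _ _ _ }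
    map_add' := fun ν ν' => LinearMap.ext fun w => LinearMap.ext fun x => add_smul _ _ _
    map_smul' := fun a ν => LinearMap.ext fun w => LinearMap.ext fun x =>
      mul_smul (op (ν x)) (op a) w }

theorem homToHomDual_bijective (h' : InducesDuality Λᵐᵒᵖ Λ W) :
    Function.Bijective (homToHomDual (Λ := Λ) W N) := by
  constructor
  · intro ν ν' hν
    refine LinearMap.ext fun x => h'.eq_of_op_smul_eq fun w => ?_
    exact LinearMap.congr_fun (LinearMap.congr_fun hν w) x
  · intro ψ
    have hν : ∀ x : N, ∃ a : Λ, ∀ w, ψ w x = op a • w := fun x =>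
      h'.exists_op_smul_eq (dualEval Λᵐᵒᵖ Λ W N x ∘ₗ ψ)
    choose ν hν using hν
    refine ⟨{ toFun := ν, map_add' := fun x y => ?_, map_smul' := fun a x => ?_ },
      LinearMap.ext fun w => LinearMap.ext fun x => (hν x w).symm⟩
    · refine h'.eq_of_op_smul_eq fun w => ?_
      rw [← hν, map_add, hν, hν, MulOpposite.op_add, add_smul]
    · refine h'.eq_of_op_smul_eq fun w => ?_
      rw [← hν, map_smul, hν, smul_smul]
      rfl

variable {N}

theorem injective_dual_pi (h : InducesDuality Λ Λᵐᵒᵖ W) (n : ℕ) :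
    Module.Injective Λ ((Fin n → Λᵐᵒᵖ) →ₗ[Λᵐᵒᵖ] W) := by
  have := h.injective
  let e : (Fin n → W) ≃ₗ[Λ] ((Fin n → Λᵐᵒᵖ) →ₗ[Λᵐᵒᵖ] W) := (Pi.basisFun Λᵐᵒᵖ (Fin n)).constr Λ
  exact (Module.Baer.of_equiv e (Module.Baer.of_injective inferInstance)).injective

theorem nonempty_extFrom_one_equiv (h' : InducesDuality Λᵐᵒᵖ Λ W)
    {K P : Type u} [AddCommGroup K] [Module Λᵐᵒᵖ K] [AddCommGroup P] [Module Λᵐᵒᵖ P]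
    [Module.Projective Λᵐᵒᵖ P] [Module.Injective Λ (P →ₗ[Λᵐᵒᵖ] W)]
    {f : K →ₗ[Λᵐᵒᵖ] P} {g : P →ₗ[Λᵐᵒᵖ] N} (hfg : IsShortExact f g) :
    Nonempty (extFromBimodule Λ Λ W (ModuleCat.of Λ (N →ₗ[Λᵐᵒᵖ] W)) 1 ≃ₗ[Λ]
      extToBimodule Λᵐᵒᵖ Λ Λ (ModuleCat.of Λᵐᵒᵖ N) 1) := by
  let _ := homFromModule Λ Λ W (K →ₗ[Λᵐᵒᵖ] W)
  have hd := h'.isShortExact_dual hfg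
  let δ : (K →ₗ[Λᵐᵒᵖ] Λ) →ₗ[Λ]
      extFromBimodule Λ Λ W (ModuleCat.of Λ (N →ₗ[Λᵐᵒᵖ] W)) 1 :=
    hd.connectingFrom Λ W 0 ∘ₗ (homEquivExtFrom Λ Λ W (K →ₗ[Λᵐᵒᵖ] W)).toLinearMap ∘ₗ
      homToHomDual W K
  have hδ : Function.Surjective δ :=
    (hd.connectingFrom_surjective W 0 (subsingleton_ext_of_injective 0)).comp
      ((homEquivExtFrom Λ Λ W (K →ₗ[Λᵐᵒᵖ] W)).surjective.comp (homToHomDual_bijective K h').2)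
  have hex : Function.Exact (LinearMap.lcomp Λ Λ f) δ := fun ν => by
    change hd.connectingFrom Λ W 0
      (homEquivExtFrom Λ Λ W (K →ₗ[Λᵐᵒᵖ] W) (homToHomDual W K ν)) = 0 ↔ _
    rw [hd.connectingFrom_zero_eq_zero_iff W]
    constructor
    · rintro ⟨ψ, hψ⟩
      obtain ⟨μ, rfl⟩ := (homToHomDual_bijective P h').2 ψ
      exact ⟨μ, (homToHomDual_bijective K h').1 hψ⟩
    · rintro ⟨μ, rfl⟩
      exact ⟨homToHomDual W P μ, rfl⟩
  exact ⟨(hex.linearEquivOfSurjective hδ).symm.trans (hfg.extToOne Λ Λ)⟩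

theorem nonempty_extFrom_equiv (h : InducesDuality Λ Λᵐᵒᵖ W)
    (h' : InducesDuality Λᵐᵒᵖ Λ W) (i : ℕ) : ∀ (N : Type u) [AddCommGroup N] [Module Λᵐᵒᵖ N]
    [Module.Finite Λᵐᵒᵖ N], Nonempty (extFromBimodule Λ Λ W (ModuleCat.of Λ (N →ₗ[Λᵐᵒᵖ] W)) i ≃ₗ[Λ]
      extToBimodule Λᵐᵒᵖ Λ Λ (ModuleCat.of Λᵐᵒᵖ N) i) := by
  have := h'.isNoetherianRing h
  induction i with
  | zero =>
    intro N _ _ _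
    let _ := homFromModule Λ Λ W (N →ₗ[Λᵐᵒᵖ] W)
    exact ⟨(homEquivExtFrom Λ Λ W (N →ₗ[Λᵐᵒᵖ] W)).symm.trans
      ((LinearEquiv.ofBijective _ (homToHomDual_bijective N h')).symm.trans
        (homEquivExtTo Λᵐᵒᵖ Λ Λ N))⟩
  | succ i ih =>
    intro N _ _ _
    obtain ⟨n, g, hg⟩ := Module.Finite.exists_fin' Λᵐᵒᵖ N
    have := h.injective_dual_pi n
    have hfg := IsShortExact.of_surjective hg
    rcases i with - | i
    · exact nonempty_extFrom_one_equiv h' hfg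
    · obtain ⟨e⟩ := ih (LinearMap.ker g)
      exact ⟨((h'.isShortExact_dual hfg).extFromShift Λ W i).symm.trans
        (e.trans (hfg.extToShift Λ Λ i))⟩

theorem subsingleton_ext_dual_iff (h : InducesDuality Λ Λᵐᵒᵖ W)
    (h' : InducesDuality Λᵐᵒᵖ Λ W) (i : ℕ) [Module.Finite Λᵐᵒᵖ N] :
    Subsingleton (ExtGroup Λ W (N →ₗ[Λᵐᵒᵖ] W) i) ↔ Subsingleton (ExtGroup Λᵐᵒᵖ N Λ i) :=
  (h.nonempty_extFrom_equiv h' i N).some.toEquiv.subsingleton_congr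

end ExtDual

end InducesDuality

/-! ### Tensor products of dual modules -/

namespace BalancedTensor

variable {S : Type v} {A : Type u} [Ring S] [Ring A] {X : Type u} [AddCommGroup X] [Module S X]
  [Module Aᵐᵒᵖ X] [SMulCommClass S Aᵐᵒᵖ X] {K Y Z : Type u} [AddCommGroup K] [Module A K]
  [AddCommGroup Y] [Module A Y] [AddCommGroup Z] [Module A Z]

theorem linearMap_ext {M : Type*} [AddCommGroup M] [Module S M]
    {f g : BalancedTensor A X Y →ₗ[S] M} (hfg : ∀ x y, f (tmul A x y) = g (tmul A x y)) : f = g :=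
  LinearMap.ext fun z => DFunLike.congr_fun
    (addHom_ext (f := f.toAddMonoidHom) (g := g.toAddMonoidHom) hfg) z

theorem tmul_zero (x : X) : tmul A x (0 : Y) = 0 := by
  simpa using tmul_add (A := A) x (0 : Y) 0

variable {f : K →ₗ[A] Y} {g : Y →ₗ[A] Z}

theorem mapRight_tmul (x : X) (y : Y) : mapRight S X g (tmul A x y) = tmul A x (g y) := rfl

theorem mapRight_surjective (hg : Function.Surjective g) :
    Function.Surjective (mapRight (S := S) (X := X) g) := by
  intro z
  induction z using tmul_induction with
  | zero => exact ⟨0, map_zero _⟩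
  | tmul x z =>
    obtain ⟨y, rfl⟩ := hg z
    exact ⟨tmul A x y, rfl⟩
  | add z w hz hw =>
    obtain ⟨z, rfl⟩ := hz
    obtain ⟨w, rfl⟩ := hw
    exact ⟨z + w, map_add _ _ _⟩

theorem mkQ_tmul_eq_of_map_eq (hfg : Function.Exact f g) (x : X) {y y' : Y} (h : g y = g y') :
    (LinearMap.range (mapRight S X f)).mkQ (tmul A x y) =
      (LinearMap.range (mapRight S X f)).mkQ (tmul A x y') := by
  obtain ⟨k, hk⟩ := (hfg (y - y')).1 (by rw [map_sub, h, sub_self])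
  have hk0 : (LinearMap.range (mapRight S X f)).mkQ (tmul A x (f k)) = 0 :=
    (Submodule.Quotient.mk_eq_zero _).2 ⟨tmul A x k, rfl⟩
  rw [← sub_add_cancel y y', ← hk, tmul_add, map_add, hk0, zero_add]

theorem exists_comp_mapRight_eq_mkQ (hfg : Function.Exact f g) (hg : Function.Surjective g) :
    ∃ r : BalancedTensor A X Z →+ (BalancedTensor A X Y ⧸ LinearMap.range (mapRight S X f)),
      ∀ t, r (mapRight S X g t) = (LinearMap.range (mapRight S X f)).mkQ t := by
  let π := (LinearMap.range (mapRight S X f)).mkQ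
  let s := Function.surjInv hg
  have hs : ∀ z, g (s z) = z := Function.surjInv_eq hg
  let r : BalancedTensor A X Z →+ (BalancedTensor A X Y ⧸ LinearMap.range (mapRight S X f)) :=
    lift (AddMonoidHom.mk' (fun x => AddMonoidHom.mk' (fun z => π (tmul A x (s z)))
        fun z z' => by
          rw [← map_add, ← tmul_add]
          exact mkQ_tmul_eq_of_map_eq hfg x (by rw [map_add, hs, hs, hs]))
        fun x x' => AddMonoidHom.ext fun z =>
          (congrArg π (add_tmul x x' (s z))).trans (map_add π _ _))
      fun a x z => (congrArg π (op_smul_tmul a x (s z))).trans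
        (mkQ_tmul_eq_of_map_eq hfg x (by rw [map_smul, hs, hs]))
  exact ⟨r, fun t => DFunLike.congr_fun (addHom_ext (f := r.comp (mapRight S X g).toAddMonoidHom)
    (g := π.toAddMonoidHom) fun x y => mkQ_tmul_eq_of_map_eq hfg x (hs _)) t⟩

theorem mapRight_exact (hfg : Function.Exact f g) (hg : Function.Surjective g) :
    Function.Exact (mapRight S X f) (mapRight S X g) := by
  refine LinearMap.exact_of_comp_eq_zero_of_ker_le_range ?_ fun t ht => ?_
  · refine linearMap_ext fun x k => ?_
    rw [LinearMap.comp_apply, mapRight_tmul, mapRight_tmul, hfg.apply_apply_eq_zero, tmul_zero,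
      LinearMap.zero_apply]
  · obtain ⟨r, hr⟩ := exists_comp_mapRight_eq_mkQ (S := S) (X := X) hfg hg
    refine (Submodule.Quotient.mk_eq_zero _).1 ((hr t).symm.trans ?_)
    rw [LinearMap.mem_ker.1 ht, map_zero]

end BalancedTensor

namespace InducesDuality

variable {Λ W : Type u} [Ring Λ] [AddCommGroup W] [Module Λ W] [Module Λᵐᵒᵖ W]
  [SMulCommClass Λ Λᵐᵒᵖ W] [SMulCommClass Λᵐᵒᵖ Λ W] (M : Type u) [AddCommGroup M] [Module Λ M]

variable (Λ W) in
/-- The map `W ⊗_Λ M → Hom_{Λᵒᵖ}(Hom_Λ(M, Λ), W)`, `w ⊗ x ↦ (φ ↦ w φ(x))`. -/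
def tensorToDual : BalancedTensor Λ W M →ₗ[Λ] ((M →ₗ[Λ] Λ) →ₗ[Λᵐᵒᵖ] W) :=
  let F : BalancedTensor Λ W M →+ ((M →ₗ[Λ] Λ) →ₗ[Λᵐᵒᵖ] W) :=
    BalancedTensor.lift
      (AddMonoidHom.mk' (fun w => AddMonoidHom.mk' (fun x =>
          ({ toFun := fun φ => op (φ x) • w
             map_add' := fun φ ψ => by rw [LinearMap.add_apply, MulOpposite.op_add, add_smul]
             map_smul' := fun a φ => by
               rw [RingHom.id_apply, smul_smul]
               rfl } : (M →ₗ[Λ] Λ) →ₗ[Λᵐᵒᵖ] W))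
        fun x y => LinearMap.ext fun φ => by
          change op (φ (x + y)) • w = op (φ x) • w + op (φ y) • w
          rw [map_add, MulOpposite.op_add, add_smul])
        fun w w' => AddMonoidHom.ext fun x => LinearMap.ext fun φ => smul_add _ _ _)
      fun a w x => LinearMap.ext fun φ => by
        change op (φ x) • op a • w = op (φ (a • x)) • w
        rw [map_smul, smul_smul]
        rfl
  { F with
    map_smul' := fun a z => by
      change F (a • z) = a • F z
      induction z using BalancedTensor.tmul_induction with
      | zero => rw [smul_zero, map_zero, smul_zero]
      | tmul w x => exact LinearMap.ext fun φ => smul_comm (op (φ x)) a w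
      | add z z' hz hz' => rw [smul_add, map_add, hz, hz', map_add, smul_add] }

variable {M}

theorem exists_dualEval_comp_tensorToDual_eq (h' : InducesDuality Λᵐᵒᵖ Λ W)
    (χ : BalancedTensor Λ W M →ₗ[Λ] W) :
    ∃ φ, dualEval Λᵐᵒᵖ Λ W (M →ₗ[Λ] Λ) φ ∘ₗ tensorToDual Λ W M = χ := by
  have hφ : ∀ x : M, ∃ a : Λ, ∀ w, χ (BalancedTensor.tmul Λ w x) = op a • w := fun x =>
    h'.exists_op_smul_eq
      { toFun := fun w => χ (BalancedTensor.tmul Λ w x)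
        map_add' := fun w w' => by rw [BalancedTensor.add_tmul, map_add]
        map_smul' := fun a w => by rw [← BalancedTensor.smul_tmul, map_smul, RingHom.id_apply] }
  choose φ hφ using hφ
  refine ⟨{ toFun := φ, map_add' := fun x y => ?_, map_smul' := fun a x => ?_ },
    BalancedTensor.linearMap_ext fun w x => (hφ x w).symm⟩
  · refine h'.eq_of_op_smul_eq fun w => ?_
    rw [← hφ, BalancedTensor.tmul_add, map_add, hφ, hφ, MulOpposite.op_add, add_smul]
  · refine h'.eq_of_op_smul_eq fun w => ?_
    rw [← hφ, ← BalancedTensor.op_smul_tmul, hφ, smul_smul]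
    rfl

theorem tensorToDual_injective (h : InducesDuality Λ Λᵐᵒᵖ W) (h' : InducesDuality Λᵐᵒᵖ Λ W) :
    Function.Injective (tensorToDual Λ W M) := by
  refine (injective_iff_map_eq_zero _).2 fun z hz => ?_
  by_contra hz0
  obtain ⟨χ, hχ⟩ := h.exists_ne_zero hz0
  obtain ⟨φ, rfl⟩ := h'.exists_dualEval_comp_tensorToDual_eq χ
  exact hχ (by rw [LinearMap.comp_apply, hz, map_zero])

theorem tensorToDual_surjective (h : InducesDuality Λ Λᵐᵒᵖ W) (h' : InducesDuality Λᵐᵒᵖ Λ W)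
    [Module.Finite Λ M] : Function.Surjective (tensorToDual Λ W M) := by
  rw [← LinearMap.range_eq_top]
  by_contra hne
  obtain ⟨y, -, hy⟩ := SetLike.exists_of_lt (lt_top_iff_ne_top.2 hne)
  let π := (LinearMap.range (tensorToDual Λ W M)).mkQ
  have hπ (z) : π (tensorToDual Λ W M z) = 0 := (Submodule.Quotient.mk_eq_zero _).2 ⟨z, rfl⟩
  obtain ⟨θ, hθ⟩ := h.exists_ne_zero (x := π y) (mt (Submodule.Quotient.mk_eq_zero _).1 hy)
  have := h'.isNoetherianRing h
  have : Module.Finite Λᵐᵒᵖ (M →ₗ[Λ] Λ) := (isRegularBimodule_one Λ).finite_dual M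
  obtain ⟨φ, hφ⟩ := (h'.reflexive (M →ₗ[Λ] Λ)).2 (θ ∘ₗ π)
  have hφ0 : φ = 0 := LinearMap.ext fun x => h'.eq_of_op_smul_eq fun w =>
    calc op (φ x) • w = θ (π (tensorToDual Λ W M (BalancedTensor.tmul Λ w x))) :=
          LinearMap.congr_fun hφ (tensorToDual Λ W M (BalancedTensor.tmul Λ w x))
      _ = 0 := by rw [hπ, map_zero]
      _ = op ((0 : M →ₗ[Λ] Λ) x) • w := by rw [LinearMap.zero_apply, op_zero, zero_smul]
  rw [hφ0, map_zero] at hφ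
  exact hθ (LinearMap.congr_fun hφ y).symm

theorem tensorToDual_bijective (h : InducesDuality Λ Λᵐᵒᵖ W) (h' : InducesDuality Λᵐᵒᵖ Λ W)
    [Module.Finite Λ M] : Function.Bijective (tensorToDual Λ W M) :=
  ⟨tensorToDual_injective h h', tensorToDual_surjective h h'⟩

theorem tensorToDual_mapRight {P : Type u} [AddCommGroup P] [Module Λ P] (f : M →ₗ[Λ] P)
    (z : BalancedTensor Λ W M) :
    tensorToDual Λ W P (BalancedTensor.mapRight Λ W f z) =
      LinearMap.lcomp Λ W (LinearMap.lcomp Λᵐᵒᵖ Λ f) (tensorToDual Λ W M z) :=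
  LinearMap.congr_fun (BalancedTensor.linearMap_ext
    (f := tensorToDual Λ W P ∘ₗ BalancedTensor.mapRight Λ W f)
    (g := LinearMap.lcomp Λ W (LinearMap.lcomp Λᵐᵒᵖ Λ f) ∘ₗ tensorToDual Λ W M)
    fun _ _ => rfl) z

end InducesDuality

/-! ### Dimension shifting for left derived functors -/

section Splice

variable {C : Type*} [Category C] [Abelian C] {S : ShortComplex C}

/-- The augmentation `Q₀ → X` of a projective resolution. The codomain of `Q.π.f 0` is `X` only up
to unfolding the complex concentrated in degree `0`. -/
def resolutionAugmentation {X : C} (Q : ProjectiveResolution X) : Q.complex.X 0 ⟶ X := Q.π.f 0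

theorem d_comp_resolutionAugmentation {X : C} (Q : ProjectiveResolution X) :
    Q.complex.d 1 0 ≫ resolutionAugmentation Q = 0 := Q.complex_d_comp_π_f_zero

theorem d_comp_resolutionAugmentation_comp {X Y : C} (Q : ProjectiveResolution X) (f : X ⟶ Y) :
    Q.complex.d 1 0 ≫ resolutionAugmentation Q ≫ f = 0 := by
  rw [← Category.assoc, d_comp_resolutionAugmentation, Limits.zero_comp]

instance epi_resolutionAugmentation {X : C} (Q : ProjectiveResolution X) :
    Epi (resolutionAugmentation Q) := inferInstanceAs (Epi (Q.π.f 0))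

theorem exact_resolutionAugmentation {X : C} (Q : ProjectiveResolution X) :
    (ShortComplex.mk _ _ (d_comp_resolutionAugmentation Q)).Exact := Q.exact₀

/-- The complex obtained by splicing a projective resolution of `X₁` with an exact sequence
`0 → X₁ → X₂ → X₃ → 0`. -/
abbrev spliceComplex (S : ShortComplex C) (Q : ProjectiveResolution S.X₁) : ChainComplex C ℕ :=
  Q.complex.augment (X := S.X₂) (resolutionAugmentation Q ≫ S.f)
    (d_comp_resolutionAugmentation_comp Q S.f)

theorem resolutionAugmentation_comp_f_comp_g (Q : ProjectiveResolution S.X₁) :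
    (resolutionAugmentation Q ≫ S.f) ≫ S.g = 0 := by
  rw [Category.assoc, S.zero, Limits.comp_zero]

theorem exact_resolutionAugmentation_comp_f (hS : S.ShortExact) (Q : ProjectiveResolution S.X₁) :
    (ShortComplex.mk _ _ (resolutionAugmentation_comp_f_comp_g Q)).Exact := by
  let β : ShortComplex.mk _ _ (resolutionAugmentation_comp_f_comp_g Q) ⟶ S :=
    { τ₁ := resolutionAugmentation Q
      τ₂ := 𝟙 _
      τ₃ := 𝟙 _ }
  have : Epi β.τ₁ := inferInstanceAs (Epi (resolutionAugmentation Q))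
  have : IsIso β.τ₂ := inferInstanceAs (IsIso (𝟙 _))
  have : Mono β.τ₃ := inferInstanceAs (Mono (𝟙 _))
  exact (ShortComplex.exact_iff_of_epi_of_isIso_of_mono β).2 hS.exact

theorem spliceComplex_exactAt_succ (hS : S.ShortExact) (Q : ProjectiveResolution S.X₁) (n : ℕ) :
    (spliceComplex S Q).ExactAt (n + 1) := by
  rw [HomologicalComplex.exactAt_iff' _ (n + 1 + 1) (n + 1) n (by simp) (by simp)]
  match n with
  | 0 =>
    have := hS.mono_f
    let α : ShortComplex.mk _ _ (d_comp_resolutionAugmentation Q) ⟶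
        (spliceComplex S Q).sc' (0 + 1 + 1) (0 + 1) 0 :=
      { τ₁ := 𝟙 _
        τ₂ := 𝟙 _
        τ₃ := S.f
        comm₁₂ := (Category.id_comp _).trans (Category.comp_id _).symm
        comm₂₃ := Category.id_comp _ }
    have : Epi α.τ₁ := inferInstanceAs (Epi (𝟙 _))
    have : IsIso α.τ₂ := inferInstanceAs (IsIso (𝟙 _))
    have : Mono α.τ₃ := inferInstanceAs (Mono S.f)
    exact (ShortComplex.exact_iff_of_epi_of_isIso_of_mono α).1 (exact_resolutionAugmentation Q)
  | n + 1 => exact Q.exact_succ n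

/-- The augmentation of `spliceComplex S Q` by the map `X₂ → X₃`. -/
def spliceAugmentation (S : ShortComplex C) (Q : ProjectiveResolution S.X₁) :
    spliceComplex S Q ⟶ (ChainComplex.single₀ C).obj S.X₃ :=
  (ChainComplex.toSingle₀Equiv _ _).symm ⟨S.g, resolutionAugmentation_comp_f_comp_g Q⟩

theorem quasiIsoAt_zero_spliceAugmentation (hS : S.ShortExact) (Q : ProjectiveResolution S.X₁) :
    QuasiIsoAt (spliceAugmentation S Q) 0 := by
  rw [ChainComplex.quasiIsoAt₀_iff, ShortComplex.quasiIso_iff_of_zeros' _ rfl rfl rfl]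
  refine (ShortComplex.exact_and_epi_g_iff_of_iso ?_).2
    ⟨exact_resolutionAugmentation_comp_f hS Q, hS.epi_g⟩
  refine ShortComplex.isoMk (Iso.refl _) (Iso.refl _) (Iso.refl _) ?_ ?_
  · exact (Category.id_comp _).trans (Category.comp_id _).symm
  · refine (Category.id_comp _).trans (Eq.trans ?_ (Category.comp_id _).symm)
    exact (ChainComplex.toSingle₀Equiv_symm_apply_f_zero (C := spliceComplex S Q) S.g _).symm

/-- The projective resolution of `X₃` obtained by splicing a projective resolution of `X₁` with an
exact sequence `0 → X₁ → X₂ → X₃ → 0`, where `X₂` is projective. -/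
def spliceResolution (hS : S.ShortExact) [Projective S.X₂] (Q : ProjectiveResolution S.X₁) :
    ProjectiveResolution S.X₃ where
  complex := spliceComplex S Q
  projective
    | 0 => inferInstanceAs (Projective S.X₂)
    | n + 1 => inferInstanceAs (Projective (Q.complex.X n))
  π := spliceAugmentation S Q
  quasiIso := ⟨fun
    | 0 => quasiIsoAt_zero_spliceAugmentation hS Q
    | n + 1 => (quasiIsoAt_iff_exactAt' _ _ (ChainComplex.exactAt_succ_single_obj _ _)).2
        (spliceComplex_exactAt_succ hS Q n)⟩

variable {D : Type*} [Category D] [Abelian D] (F : C ⥤ D) [F.Additive] [HasProjectiveResolutions C]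

/-- `L_{n+2} F (X₃) ≅ L_{n+1} F (X₁)` if `X₂` is projective. -/
def leftDerivedShift (hS : S.ShortExact) [Projective S.X₂] (n : ℕ) :
    (F.leftDerived (n + 2)).obj S.X₃ ≅ (F.leftDerived (n + 1)).obj S.X₁ :=
  let Q := projectiveResolution S.X₁
  (spliceResolution hS Q).isoLeftDerivedObj F (n + 2) ≪≫
    ShortComplex.homologyMapIso (HomologicalComplex.isoSc' _ (n + 3) (n + 2) (n + 1)
      (by simp) (by simp)) ≪≫
    ShortComplex.homologyMapIso (ShortComplex.isoMk (Iso.refl _) (Iso.refl _) (Iso.refl _)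
      ((Category.id_comp _).trans (Category.comp_id _).symm)
      ((Category.id_comp _).trans (Category.comp_id _).symm) :
      ((F.mapHomologicalComplex _).obj (spliceComplex S Q)).sc' (n + 3) (n + 2) (n + 1) ≅
      ((F.mapHomologicalComplex _).obj Q.complex).sc' (n + 2) (n + 1) n) ≪≫
    (ShortComplex.homologyMapIso (HomologicalComplex.isoSc' _ (n + 2) (n + 1) n
      (by simp) (by simp))).symm ≪≫
    (Q.isoLeftDerivedObj F (n + 1)).symm

/-- `L_1 F (X₃)` is the homology of `F(Q₁) → F(Q₀) → F(X₂)` if `X₂` is projective and `Q` is a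
projective resolution of `X₁`. -/
def leftDerivedOne (hS : S.ShortExact) [Projective S.X₂] (Q : ProjectiveResolution S.X₁) :
    (F.leftDerived 1).obj S.X₃ ≅
      (ShortComplex.mk (F.map (Q.complex.d 1 0)) (F.map (resolutionAugmentation Q ≫ S.f)) (by
        rw [← F.map_comp, d_comp_resolutionAugmentation_comp, F.map_zero])).homology :=
  (spliceResolution hS Q).isoLeftDerivedObj F 1 ≪≫
    ShortComplex.homologyMapIso (HomologicalComplex.isoSc' _ 2 1 0 (by simp) (by simp)) ≪≫
    ShortComplex.homologyMapIso (ShortComplex.isoMk (Iso.refl _) (Iso.refl _) (Iso.refl _)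
      ((Category.id_comp _).trans (Category.comp_id _).symm)
      ((Category.id_comp _).trans (Category.comp_id _).symm))

end Splice

/-! ### Tor modules and duality -/

section TorModule

variable (S : Type v) {A : Type u} [Ring S] [Ring A] (X : Type u) [AddCommGroup X] [Module S X]
  [Module Aᵐᵒᵖ X] [SMulCommClass S Aᵐᵒᵖ X]

instance tensorFunctor_preservesFiniteColimits :
    Limits.PreservesFiniteColimits (tensorFunctor S A X) := by
  rw [Functor.preservesFiniteColimits_iff_forall_exact_map_and_epi]
  intro T hT
  have hg := hT.moduleCat_surjective_g
  have hfg := (ShortComplex.ShortExact.moduleCat_exact_iff_function_exact _).1 hT.exact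
  exact ⟨(ShortComplex.ShortExact.moduleCat_exact_iff_function_exact _).2
    (BalancedTensor.mapRight_exact hfg hg),
    (ModuleCat.epi_iff_surjective _).2 (BalancedTensor.mapRight_surjective hg)⟩

variable {K Y Z : Type u} [AddCommGroup K] [Module A K] [AddCommGroup Y] [Module A Y]
  [AddCommGroup Z] [Module A Z] {f : K →ₗ[A] Y} {g : Y →ₗ[A] Z}

variable (Y) in
/-- `Tor_0^A(X, Y) ≅ X ⊗_A Y`. -/
def torZero : torModule S A X 0 (ModuleCat.of A Y) ≃ₗ[S] BalancedTensor A X Y :=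
  ((tensorFunctor S A X).leftDerivedZeroIsoSelf.app (ModuleCat.of A Y)).toLinearEquiv

/-- `Tor_{n+2}^A(X, Z) ≅ Tor_{n+1}^A(X, K)` for an exact sequence `0 → K → Y → Z → 0` with `Y`
projective. -/
def IsShortExact.torShift (h : IsShortExact f g) [Module.Projective A Y] (n : ℕ) :
    torModule S A X (n + 2) (ModuleCat.of A Z) ≃ₗ[S] torModule S A X (n + 1) (ModuleCat.of A K) :=
  have : Projective (ModuleCat.of A Y) := (IsProjective.iff_projective Y).1 inferInstance
  (leftDerivedShift (S := h.shortComplex) (tensorFunctor S A X) h.shortExact n).toLinearEquiv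

variable {S} in
theorem nonempty_homology_equiv_ker {T : ShortComplex (ModuleCat.{u} S)} {K : Type u}
    [AddCommGroup K] [Module S K] {p : T.X₂ →ₗ[S] K} {u : K →ₗ[S] T.X₃}
    (hp : Function.Surjective p) (hT : Function.Exact T.f.hom p) (hu : u ∘ₗ p = T.g.hom) :
    Nonempty (T.homology ≃ₗ[S] LinearMap.ker u) := by
  have hpu (x) : u (p x) = T.g.hom x := LinearMap.congr_fun hu x
  let q : LinearMap.ker T.g.hom →ₗ[S] LinearMap.ker u := p.restrict fun x hx => (hpu x).trans hx
  have hq : Function.Surjective q := fun ⟨k, hk⟩ => by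
    obtain ⟨y, rfl⟩ := hp k
    exact ⟨⟨y, (hpu y).symm.trans hk⟩, rfl⟩
  have hex : Function.Exact T.moduleCatToCycles q := fun y => by
    refine Subtype.ext_iff.trans ((hT y.1).trans ?_)
    exact exists_congr fun x => (Subtype.ext_iff (a1 := T.moduleCatToCycles x)).symm
  exact ⟨T.moduleCatHomologyIso.toLinearEquiv.trans (hex.linearEquivOfSurjective hq)⟩

theorem IsShortExact.nonempty_torOne (h : IsShortExact f g) [Module.Projective A Y] :
    Nonempty (torModule S A X 1 (ModuleCat.of A Z) ≃ₗ[S]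
      LinearMap.ker (BalancedTensor.mapRight S X f)) := by
  have : Projective (ModuleCat.of A Y) := (IsProjective.iff_projective Y).1 inferInstance
  let Q := projectiveResolution (ModuleCat.of A K)
  have hsurj : Function.Surjective (resolutionAugmentation Q).hom :=
    (ModuleCat.epi_iff_surjective _).1 inferInstance
  have hex : Function.Exact (Q.complex.d 1 0).hom (resolutionAugmentation Q).hom :=
    (ShortComplex.ShortExact.moduleCat_exact_iff_function_exact _).1
      (exact_resolutionAugmentation Q)
  obtain ⟨e⟩ := nonempty_homology_equiv_ker
    (T := ShortComplex.mk ((tensorFunctor S A X).map (Q.complex.d 1 0))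
      ((tensorFunctor S A X).map (resolutionAugmentation Q ≫ ModuleCat.ofHom f)) (by
        rw [← Functor.map_comp, d_comp_resolutionAugmentation_comp, Functor.map_zero]))
    (p := BalancedTensor.mapRight S X (resolutionAugmentation Q).hom)
    (u := BalancedTensor.mapRight S X f)
    (BalancedTensor.mapRight_surjective hsurj) (BalancedTensor.mapRight_exact hex hsurj)
    (BalancedTensor.linearMap_ext fun _ _ => rfl)
  exact ⟨(leftDerivedOne (S := h.shortComplex) (tensorFunctor S A X)
    h.shortExact Q).toLinearEquiv.trans e⟩

end TorModule

namespace InducesDuality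

variable {Λ W : Type u} [Ring Λ] [AddCommGroup W] [Module Λ W] [Module Λᵐᵒᵖ W]
  [SMulCommClass Λ Λᵐᵒᵖ W] [SMulCommClass Λᵐᵒᵖ Λ W]

theorem nonempty_ker_mapRight_equiv (h : InducesDuality Λ Λᵐᵒᵖ W) (h' : InducesDuality Λᵐᵒᵖ Λ W)
    {K P : Type u} [AddCommGroup K] [Module Λ K] [Module.Finite Λ K] [AddCommGroup P] [Module Λ P]
    (f : K →ₗ[Λ] P) :
    Nonempty (LinearMap.ker (BalancedTensor.mapRight Λ W f) ≃ₗ[Λ]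
      LinearMap.ker (LinearMap.lcomp Λ W (LinearMap.lcomp Λᵐᵒᵖ Λ f))) := by
  let eK := LinearEquiv.ofBijective _ (tensorToDual_bijective (M := K) h h')
  refine ⟨eK.ofSubmodules _ _ ?_⟩
  ext y
  obtain ⟨z, rfl⟩ := eK.surjective y
  rw [Submodule.mem_map_equiv, eK.symm_apply_apply, LinearMap.mem_ker, LinearMap.mem_ker,
    ← map_eq_zero_iff _ (tensorToDual_injective (M := P) h h'), tensorToDual_mapRight]
  rfl

theorem nonempty_torOne_equiv (h : InducesDuality Λ Λᵐᵒᵖ W) (h' : InducesDuality Λᵐᵒᵖ Λ W)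
    {K P M : Type u} [AddCommGroup K] [Module Λ K] [Module.Finite Λ K] [AddCommGroup P]
    [Module Λ P] [Module.Projective Λ P] [AddCommGroup M] [Module Λ M]
    {f : K →ₗ[Λ] P} {g : P →ₗ[Λ] M} (hfg : IsShortExact f g) :
    Nonempty (torModule Λ Λ W 1 (ModuleCat.of Λ M) ≃ₗ[Λ]
      (extToBimodule Λ Λᵐᵒᵖ Λ (ModuleCat.of Λ M) 1 →ₗ[Λᵐᵒᵖ] W)) := by
  obtain ⟨eTor⟩ := hfg.nonempty_torOne Λ W
  obtain ⟨eKer⟩ := nonempty_ker_mapRight_equiv h h' f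
  let ρ : (P →ₗ[Λ] Λ) →ₗ[Λᵐᵒᵖ] (K →ₗ[Λ] Λ) := LinearMap.lcomp Λᵐᵒᵖ Λ f
  have hsurj := (LinearMap.range ρ).mkQ_surjective
  have hrange : LinearMap.range (LinearMap.lcomp Λ W (LinearMap.range ρ).mkQ) =
      LinearMap.ker (LinearMap.lcomp Λ W ρ) :=
    (LinearMap.exact_iff.1 (exact_lcomp (LinearMap.exact_iff.2 (by simp)) hsurj)).symm
  let eCoker : (((K →ₗ[Λ] Λ) ⧸ LinearMap.range ρ) →ₗ[Λᵐᵒᵖ] W) ≃ₗ[Λ]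
      LinearMap.ker (LinearMap.lcomp Λ W ρ) :=
    (LinearEquiv.ofInjective _ (injective_lcomp hsurj)).trans (LinearEquiv.ofEq _ _ hrange)
  exact ⟨eTor.trans (eKer.trans (eCoker.symm.trans
    (LinearEquiv.congrLeft W Λ (hfg.extToOne Λᵐᵒᵖ Λ))))⟩

theorem nonempty_tor_equiv (h : InducesDuality Λ Λᵐᵒᵖ W) (h' : InducesDuality Λᵐᵒᵖ Λ W) (i : ℕ) :
    ∀ (M : Type u) [AddCommGroup M] [Module Λ M] [Module.Finite Λ M],
      Nonempty (torModule Λ Λ W i (ModuleCat.of Λ M) ≃ₗ[Λ]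
        (extToBimodule Λ Λᵐᵒᵖ Λ (ModuleCat.of Λ M) i →ₗ[Λᵐᵒᵖ] W)) := by
  have := h.isNoetherianRing h'
  induction i with
  | zero =>
    intro M _ _ _
    exact ⟨(torZero Λ W M).trans ((LinearEquiv.ofBijective _ (tensorToDual_bijective h h')).trans
      (LinearEquiv.congrLeft W Λ (homEquivExtTo Λ Λᵐᵒᵖ Λ M)))⟩
  | succ i ih =>
    intro M _ _ _
    obtain ⟨n, g, hg⟩ := Module.Finite.exists_fin' Λ M
    have hfg := IsShortExact.of_surjective hg
    rcases i with - | i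
    · exact nonempty_torOne_equiv h h' hfg
    · obtain ⟨e⟩ := ih (LinearMap.ker g)
      exact ⟨(hfg.torShift Λ W i).trans
        (e.trans (LinearEquiv.congrLeft W Λ (hfg.extToShift Λᵐᵒᵖ Λ i)))⟩

end InducesDuality

/-! ### Strong grade and cograde conditions -/

section StrongGrade

variable {A A' : Type u} [Ring A] [Ring A'] {B : Type u} [AddCommGroup B]
  [Module A B] [Module A' B] {b : B}

theorem strongGradeGE_iff (h : IsRegularBimodule A A' b) {M : ModuleCat.{u} A} {m : ℕ} :
    StrongGradeGE M m ↔ ∀ X : Submodule A M, ∀ j < m, Subsingleton (ExtGroup A X B j) := by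
  refine forall_congr' fun X => natCast_le_iInf_nontrivial_iff.trans ?_
  refine forall₂_congr fun j _ => ⟨subsingleton_ext_congr_right h.leftEquiv.symm,
    subsingleton_ext_congr_right h.leftEquiv⟩

theorem StrongGradeGE.of_equiv {M M' : ModuleCat.{u} A} {m : ℕ} (hM : StrongGradeGE M m)
    (e : M' ≃ₗ[A] M) : StrongGradeGE M' m := fun X =>
  natCast_le_iInf_nontrivial_iff.2 fun j hj => subsingleton_ext_congr_left (e.submoduleMap X)
    (natCast_le_iInf_nontrivial_iff.1 (hM (X.map e.toLinearMap)) j hj)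

theorem strongGradeCondition_iff [SMulCommClass A' A B] (h : IsRegularBimodule A A' b) {n : ℕ} :
    StrongGradeCondition A A' B n ↔
      ∀ (N : ModuleCat.{u} A') [Module.Finite A' N] (i : ℕ), 1 ≤ i → i ≤ n →
        StrongGradeGE (extToBimodule A' A B N i) i := by
  constructor
  · intro H N _ i h1 hi
    exact (strongGradeGE_iff h).2 fun X j hj =>
      H N i h1 hi X X.subtype X.injective_subtype j hj
  · intro H N _ _ _ i h1 hi Y _ _ ι hι j hj
    exact subsingleton_ext_congr_left (LinearEquiv.ofInjective ι hι)
      ((strongGradeGE_iff h).1 (H (ModuleCat.of A' N) i h1 hi) _ j hj)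

theorem IsRegularBimodule.finite_ext [SMulCommClass A A' B] [IsNoetherianRing A]
    [IsNoetherianRing A'] (h : IsRegularBimodule A A' b) (i : ℕ) :
    ∀ (M : Type u) [AddCommGroup M] [Module A M] [Module.Finite A M],
      Module.Finite A' (extToBimodule A A' B (ModuleCat.of A M) i) := by
  induction i with
  | zero =>
    intro M _ _ _
    have := h.finite_dual M
    exact Module.Finite.equiv (homEquivExtTo A A' B M)
  | succ i ih =>
    intro M _ _ _
    obtain ⟨n, g, hg⟩ := Module.Finite.exists_fin' A M
    have hfg := IsShortExact.of_surjective hg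
    rcases i with - | i
    · have := h.finite_dual (LinearMap.ker g)
      exact Module.Finite.equiv (hfg.extToOne A' B)
    · have := ih (LinearMap.ker g)
      exact Module.Finite.equiv (hfg.extToShift A' B i)

end StrongGrade

namespace InducesDuality

variable {Λ W : Type u} [Ring Λ] [AddCommGroup W] [Module Λ W] [Module Λᵐᵒᵖ W]
  [SMulCommClass Λ Λᵐᵒᵖ W] [SMulCommClass Λᵐᵒᵖ Λ W]

theorem nonempty_extFrom_equiv_dual (h : InducesDuality Λ Λᵐᵒᵖ W) (h' : InducesDuality Λᵐᵒᵖ Λ W)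
    (M : Type u) [AddCommGroup M] [Module Λ M] [Module.Finite Λ M] (i : ℕ) :
    Nonempty (extFromBimodule Λ Λ W (ModuleCat.of Λ M) i ≃ₗ[Λ]
      extToBimodule Λᵐᵒᵖ Λ Λ (ModuleCat.of Λᵐᵒᵖ (M →ₗ[Λ] W)) i) := by
  have := h.finite M
  obtain ⟨e⟩ := h.nonempty_extFrom_equiv h' i (M →ₗ[Λ] W)
  exact ⟨(extFromCongr Λ W (LinearEquiv.ofBijective _ (h.reflexive M)) i).trans e⟩

theorem strongExtCogradeGE_tor_iff (h : InducesDuality Λ Λᵐᵒᵖ W) (h' : InducesDuality Λᵐᵒᵖ Λ W)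
    (M : ModuleCat.{u} Λ) [Module.Finite Λ M] (i m : ℕ) :
    StrongExtCogradeGE Λ W (torModule Λ Λ W i M) m ↔
      StrongGradeGE (extToBimodule Λ Λᵐᵒᵖ Λ M i) m := by
  have := h.isNoetherianRing h'
  have := h'.isNoetherianRing h
  obtain ⟨e⟩ := h.nonempty_tor_equiv h' i M
  have : Module.Finite Λᵐᵒᵖ (extToBimodule Λ Λᵐᵒᵖ Λ M i) :=
    (isRegularBimodule_one Λ).finite_ext i M
  rw [strongGradeGE_iff (isRegularBimodule_one Λ).symm]
  constructor
  · intro H X j hj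
    obtain ⟨K, ⟨eK⟩⟩ := h'.exists_quotient_equiv X
    rw [← h.subsingleton_ext_dual_iff h' j]
    exact subsingleton_ext_congr_right
      (eK.symm.trans (Submodule.Quotient.equiv _ _ e.symm rfl))
      (natCast_le_iInf_nontrivial_iff.1 (H (K.map e.symm.toLinearMap)) j hj)
  · intro H K
    refine natCast_le_iInf_nontrivial_iff.2 fun j hj => ?_
    obtain ⟨X, ⟨eX⟩⟩ := h'.exists_submodule_equiv h (K.map e.toLinearMap)
    exact subsingleton_ext_congr_right ((Submodule.Quotient.equiv K _ e rfl).trans eX)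
      ((h.subsingleton_ext_dual_iff h' j).2 (H X j hj))

theorem strongTorCogradeGE_iff (h : InducesDuality Λ Λᵐᵒᵖ W) (h' : InducesDuality Λᵐᵒᵖ Λ W)
    (M : ModuleCat.{u} Λ) [Module.Finite Λ M] (m : ℕ) :
    StrongTorCogradeGE Λ Λ W M m ↔ StrongGradeGE M m := by
  have := h.isNoetherianRing h'
  rw [strongGradeGE_iff (isRegularBimodule_one Λ)]
  refine forall_congr' fun Y => natCast_le_iInf_nontrivial_iff.trans (forall₂_congr fun j _ => ?_)
  obtain ⟨e⟩ := h.nonempty_tor_equiv h' j Y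
  exact e.toEquiv.subsingleton_congr.trans h'.subsingleton_iff

theorem strongTorCogradeGE_ext_iff (h : InducesDuality Λ Λᵐᵒᵖ W) (h' : InducesDuality Λᵐᵒᵖ Λ W)
    (M : ModuleCat.{u} Λ) [Module.Finite Λ M] (i m : ℕ) :
    StrongTorCogradeGE Λ Λ W (extFromBimodule Λ Λ W M i) m ↔
      StrongGradeGE (extToBimodule Λᵐᵒᵖ Λ Λ (ModuleCat.of Λᵐᵒᵖ (M →ₗ[Λ] W)) i) m := by
  have := h.isNoetherianRing h'
  have := h'.isNoetherianRing h
  obtain ⟨e⟩ := h.nonempty_extFrom_equiv_dual h' M i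
  have := h.finite M
  have := (isRegularBimodule_one Λ).symm.finite_ext i (M →ₗ[Λ] W)
  have : Module.Finite Λ (extFromBimodule Λ Λ W M i) := Module.Finite.equiv e.symm
  rw [h.strongTorCogradeGE_iff h']
  exact ⟨fun H => H.of_equiv e.symm, fun H => H.of_equiv e⟩

theorem forall_strongTorCogradeGE_ext_iff (h : InducesDuality Λ Λᵐᵒᵖ W)
    (h' : InducesDuality Λᵐᵒᵖ Λ W) (n : ℕ) :
    (∀ (M : ModuleCat.{u} Λ) [Module.Finite Λ M] (i : ℕ), 1 ≤ i → i ≤ n →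
      StrongTorCogradeGE Λ Λ W (extFromBimodule Λ Λ W M i) i) ↔
    ∀ (N : ModuleCat.{u} Λᵐᵒᵖ) [Module.Finite Λᵐᵒᵖ N] (i : ℕ), 1 ≤ i → i ≤ n →
      StrongGradeGE (extToBimodule Λᵐᵒᵖ Λ Λ N i) i := by
  constructor
  · intro H N _ i h1 hi
    have := h'.finite N
    have hM := (h.strongTorCogradeGE_ext_iff h' (ModuleCat.of Λ (N →ₗ[Λᵐᵒᵖ] W)) i i).1
      (H (ModuleCat.of Λ (N →ₗ[Λᵐᵒᵖ] W)) i h1 hi)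
    exact hM.of_equiv (extToCongr Λ Λ (LinearEquiv.ofBijective _ (h'.reflexive N)) i)
  · intro H M _ i h1 hi
    have := h.finite M
    exact (h.strongTorCogradeGE_ext_iff h' M i i).2
      (H (ModuleCat.of Λᵐᵒᵖ (M →ₗ[Λ] W)) i h1 hi)

end InducesDuality

section Noetherian

variable (Λ : Type u) [Ring Λ] (n : ℕ)

theorem isAuslanderGorenstein_iff_strongGradeCondition [IsNoetherianRing Λᵐᵒᵖ] :
    IsAuslanderGorenstein Λ n ↔ StrongGradeCondition Λ Λᵐᵒᵖ Λ n :=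
  isAuslanderGorenstein_iff (isRegularBimodule_one Λ) (ρ := RingEquiv.refl _)
    (fun a => (one_mul (unop a)).trans (mul_one (unop a)).symm) n

theorem isAuslanderGorenstein_op_iff_strongGradeCondition [IsNoetherianRing Λ] :
    IsAuslanderGorenstein Λᵐᵒᵖ n ↔ StrongGradeCondition Λᵐᵒᵖ Λ Λ n :=
  isAuslanderGorenstein_iff (isRegularBimodule_one Λ).symm (ρ := RingEquiv.opOp Λ)
    (fun a => (mul_one a).trans (one_mul a).symm) n

theorem strongGradeCondition_op_iff [IsNoetherianRing Λ] [IsNoetherianRing Λᵐᵒᵖ] :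
    StrongGradeCondition Λᵐᵒᵖ Λ Λ n ↔ StrongGradeCondition Λ Λᵐᵒᵖ Λ n :=
  ⟨fun H => H.symm (isRegularBimodule_one Λ).symm, fun H => H.symm (isRegularBimodule_one Λ)⟩

end Noetherian

theorem corollary6p10_general {Λ W : Type u} [Ring Λ] [AddCommGroup W] [Module Λ W]
    [Module Λᵐᵒᵖ W] [SMulCommClass Λ Λᵐᵒᵖ W] [SMulCommClass Λᵐᵒᵖ Λ W]
    (h : InducesDuality Λ Λᵐᵒᵖ W) (h' : InducesDuality Λᵐᵒᵖ Λ W) (n : ℕ) :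
    List.TFAE [
      IsAuslanderGorenstein Λ n,
      IsAuslanderGorenstein Λᵐᵒᵖ n,
      ∀ (M : ModuleCat.{u} Λ) [Module.Finite Λ M] (i : ℕ), 1 ≤ i → i ≤ n →
        StrongGradeGE (extToBimodule Λ Λᵐᵒᵖ Λ M i) i,
      ∀ (N : ModuleCat.{u} Λᵐᵒᵖ) [Module.Finite Λᵐᵒᵖ N] (i : ℕ), 1 ≤ i → i ≤ n →
        StrongGradeGE (extToBimodule Λᵐᵒᵖ Λ Λ N i) i,
      ∀ (M : ModuleCat.{u} Λ) [Module.Finite Λ M] (i : ℕ), 1 ≤ i → i ≤ n →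
        StrongExtCogradeGE Λ W (torModule Λ Λ W i M) i,
      ∀ (M : ModuleCat.{u} Λ) [Module.Finite Λ M] (i : ℕ), 1 ≤ i → i ≤ n →
        StrongTorCogradeGE Λ Λ W (extFromBimodule Λ Λ W M i) i] := by
  have := h.isNoetherianRing h'
  have := h'.isNoetherianRing h
  have hleft := strongGradeCondition_iff (isRegularBimodule_one Λ) (n := n)
  have hright := strongGradeCondition_iff (isRegularBimodule_one Λ).symm (n := n)
  tfae_have 1 ↔ 4 := (isAuslanderGorenstein_iff_strongGradeCondition Λ n).trans hleft
  tfae_have 2 ↔ 3 := (isAuslanderGorenstein_op_iff_strongGradeCondition Λ n).trans hright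
  tfae_have 3 ↔ 4 := hright.symm.trans ((strongGradeCondition_op_iff Λ n).trans hleft)
  tfae_have 5 ↔ 3 := forall₂_congr fun M _ => forall₃_congr fun i _ _ =>
    h.strongExtCogradeGE_tor_iff h' M i i
  tfae_have 6 ↔ 4 := h.forall_strongTorCogradeGE_ext_iff h' n
  tfae_finish

end

theorem corollary6p10 (R Λ : Type u) [CommRing R] [IsArtinianRing R] [Ring Λ] [Algebra R Λ]
    [Module.Finite R Λ] (n : ℕ) (hn : 1 ≤ n) :
    List.TFAE [
      IsAuslanderGorenstein Λ n,
      IsAuslanderGorenstein Λᵐᵒᵖ n,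
      ∀ (M : ModuleCat.{u} Λ) [Module.Finite Λ M] (i : ℕ), 1 ≤ i → i ≤ n →
        StrongGradeGE (extToBimodule Λ Λᵐᵒᵖ Λ M i) i,
      ∀ (N : ModuleCat.{u} Λᵐᵒᵖ) [Module.Finite Λᵐᵒᵖ N] (i : ℕ), 1 ≤ i → i ≤ n →
        StrongGradeGE (extToBimodule Λᵐᵒᵖ Λ Λ N i) i,
      ∀ (M : ModuleCat.{u} Λ) [Module.Finite Λ M] (i : ℕ), 1 ≤ i → i ≤ n →
        StrongExtCogradeGE Λ (MatlisDual R Λ) (torModule Λ Λ (MatlisDual R Λ) i M) i,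
      ∀ (M : ModuleCat.{u} Λ) [Module.Finite Λ M] (i : ℕ), 1 ≤ i → i ≤ n →
        StrongTorCogradeGE Λ Λ (MatlisDual R Λ)
          (extFromBimodule Λ Λ (MatlisDual R Λ) M i) i] := by
  exact corollary6p10_general (MatlisDual.inducesDuality R Λ) (MatlisDual.inducesDuality_op R Λ) n
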